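/- Let $q\colon G'\to G$ be a group epimorphism with finite kernel $\Gamma$, and let $[\Gamma,G']\subset\Gamma$ be the subgroup generated by the commutators of elements of $\Gamma$ with elements of $G'$. Let $W$ be a closed connected oriented surface of positive genus with fundamental group $\pi=\pi_1(W)$ and fundamental class $[W]\in H_2(W;\mathbb{Z})=H_2(\pi;\mathbb{Z})$. Suppose that the first Betti number $b=2-\chi(W)$ of $W$ satisfies $b>\log_2(|[\Gamma,G']|-1)$ (if $[\Gamma,G']=1$, this condition is empty). Let $g\colon\pi\to G$ be an epimorphism. Then $g$ lifts to $G'$, i.e. there is a homomorphism $g'\colon\pi\to G'$ with $q g'=g$, if and only if the homological obstruction vanishes, i.e. $g_*([W])\in H_2(G;\mathbb{Z})$ lies in the image of $q_*\colon H_2(G';\mathbb{Z})\to H_2(G;\mathbb{Z})$. Moreover, if $g$ lifts to $G'$, then the set of all lifts $g'$ of $g$ is finite and its number of elements is at least $$|\Gamma|^b\,|[\Gamma,G']|^{-1}\left(1-\frac{|[\Gamma,G']|-1}{2^b}\right).$$ -/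

import Mathlib

universe u

noncomputable section

/-- The point at parameter `t ∈ [0, 1]` of the `k`-th of the `4d` consecutive arcs of equal length
into which the boundary circle of the closed unit disc is divided, traversed counterclockwise. -/
def boundaryArc (d k : ℕ) (t : ℝ) : Metric.closedBall (0 : ℂ) 1 :=
  ⟨(Circle.exp (2 * Real.pi * ((k + t) / (4 * d))) : ℂ), by
    rw [mem_closedBall_zero_iff, Circle.norm_coe]⟩

/-- The side identifications of the `4d`-gon with boundary word
`a₁ b₁ a₁⁻¹ b₁⁻¹ ⋯ a_d b_d a_d⁻¹ b_d⁻¹`. -/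
inductive SideIdentification (d : ℕ) :
    Metric.closedBall (0 : ℂ) 1 → Metric.closedBall (0 : ℂ) 1 → Prop
  | a (i : ℕ) (hi : i < d) (t : ℝ) (ht : t ∈ Set.Icc (0 : ℝ) 1) :
      SideIdentification d (boundaryArc d (4 * i) t) (boundaryArc d (4 * i + 2) (1 - t))
  | b (i : ℕ) (hi : i < d) (t : ℝ) (ht : t ∈ Set.Icc (0 : ℝ) 1) :
      SideIdentification d (boundaryArc d (4 * i + 1) t) (boundaryArc d (4 * i + 3) (1 - t))

/-- The standard closed orientable surface of genus `d ≥ 1`: the closed disc, viewed as a `4d`-gon,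
modulo the equivalence relation generated by the side identifications, with the quotient
topology. -/
def StandardSurface (d : ℕ) : Type := Quot (SideIdentification d)

instance (d : ℕ) : TopologicalSpace (StandardSurface d) :=
  inferInstanceAs (TopologicalSpace (Quot (SideIdentification d)))

/-- `W` is a closed connected orientable surface of genus `d ≥ 1`. -/
def IsClosedOrientableSurface (d : ℕ) (W : Type u) [TopologicalSpace W] : Prop :=
  1 ≤ d ∧ Nonempty (W ≃ₜ StandardSurface d)

/-- The first Betti number of a path connected space `W` (with base point `w`): the rank of
`H₁(W; ℤ)`, that is, of the abelianization of `π₁(W, w)`. -/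
def firstBetti (W : Type u) [TopologicalSpace W] (w : W) : ℕ :=
  Module.finrank ℤ (Additive (Abelianization (FundamentalGroup W w)))

/-- The second homology `H₂(G; ℤ)` of a group with trivial coefficients (the coefficients `ℤ` are
lifted to the universe of `G`). -/
abbrev H₂ (G : Type u) [Group G] : ModuleCat (ULift.{u} ℤ) :=
  groupHomology (Rep.trivial (ULift.{u} ℤ) G (ULift.{u} ℤ)) 2

/-- The homomorphism `f_* : H₂(G; ℤ) → H₂(H; ℤ)` induced by a group homomorphism `f : G → H`. -/
def H₂map {G H : Type u} [Group G] [Group H] (f : G →* H) : H₂ G →ₗ[ULift.{u} ℤ] H₂ H :=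
  (groupHomology.map (A := Rep.trivial (ULift.{u} ℤ) G (ULift.{u} ℤ))
    (B := Rep.trivial (ULift.{u} ℤ) H (ULift.{u} ℤ)) f
    (CategoryTheory.CategoryStruct.id (Rep.trivial (ULift.{u} ℤ) G (ULift.{u} ℤ))) 2).hom

/-- `μ ∈ H₂(π; ℤ)` is a fundamental class `[W]` of a closed oriented surface `W` of positive genus
with fundamental group `π`, where `H₂(W; ℤ) = H₂(π; ℤ) ≅ ℤ`. An orientation of `W` is the choice of
a generator of this infinite cyclic group. -/
def IsFundamentalClass {P : Type u} [Group P] (μ : H₂ P) : Prop :=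
  Submodule.span (ULift.{u} ℤ) {μ} = ⊤

/-- The homological obstruction to lifting `g : π → G` along `q : G' → G` vanishes: the class
`g_*([W]) ∈ H₂(G)` lies in the image of `q_* : H₂(G') → H₂(G)`. -/
def HomologicalObstructionVanishes {P G G' : Type u} [Group P] [Group G] [Group G']
    (q : G' →* G) (g : P →* G) (μ : H₂ P) : Prop :=
  H₂map g μ ∈ LinearMap.range (H₂map q)

/-- The set of lifts of `g` along `q`. -/
def Lifts {P G G' : Type u} [Group P] [Group G] [Group G'] (q : G' →* G) (g : P →* G) :
    Set (P →* G') :=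
  {g' | q.comp g' = g}

end

/-! ### Traces and Fourier inversion in a complex group algebra -/

noncomputable section BlockTrace

open Module

/-! The group `π` has generators `a_j, b_j` (`j < d`, `b = 2d`) with the single relation `∏ ⁅a_j,
b_j⁆ = 1`. After choosing preimages `α_j, β_j` in `G'` of the elements `g a_j, g b_j`, the lifts of
`g` correspond to the tuples in `Γ^(2d)` by which `α_j, β_j` can be modified so that the word `∏
⁅α_j x_j, β_j y_j⁆` becomes `1` (`exists_equiv_lifts`). The theorem is thus about counting the
solutions of this equation.

Counting (`card_twistedWord_eq_one_ge`). Suppose that the unmodified word lies in `K = [Γ, G']`. The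
number of solutions is the coefficient of `1` in the sum of all modified words in `ℂ[Γ]`. By the
trace of the regular representation, `|Γ|` times this coefficient is the sum over the matrix blocks
of `ℂ[Γ]`, of sizes `m_i`, of `m_i` times the trace of the sum in the block. Where `K` acts
trivially all words act as `1`, since they stay in `K`; these blocks contribute `m_i² |Γ|^(2d)`
each, and their `m_i²` add up to `|Γ| / |K|` (`sum_block_sq_of_trivial`). A block moved by
conjugation by some element of `G'` contributes `0`, by orthogonality of its central idempotent to
its conjugates (`sum_blockRep_eq_zero`). In a block stable under conjugation, Schur's lemma makes
the sum a scalar of absolute value `(|Γ| / m_i)^(2d)` (`exists_sum_blockRep_eq`). If `K` acts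
nontrivially there, then `m_i ≥ 2`, so the contribution is at least `-m_i² |Γ|^(2d) / 2^(2d)`.
Adding up gives the asserted bound, which is positive exactly when `|K| - 1 < 2^b`. The same
estimate therefore yields both the existence and the number of lifts.

Obstruction (`surfaceWord_mem_of_obstruction`). The extension `G' / K → G` is central, and the value
of its cocycle on the 2-cycle of the surface relation is, up to normalization, the class of the word
modulo `K`. If `g_*[W]` comes from `H₂(G')`, where the cocycle becomes a coboundary, this value is
trivial, so the word lies in `K`. The converse implication is functoriality of `H₂`.

Presentation of `π`. The surface is a quotient of a `4d`-gon. Neighbourhoods contracting along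
liftable tracks show that the sides generate (`closure_sideElement`). Given elements of a group `H`
satisfying the relation, copies of the polygon indexed by `H` are glued to a covering whose
monodromy is the required homomorphism (`exists_hom_sideElement`). -/

theorem Matrix.trace_mulLeft_pi {ι : Type*} [Fintype ι] [DecidableEq ι] (m : ι → ℕ)
    (x : Π i, Matrix (Fin (m i)) (Fin (m i)) ℂ) :
    LinearMap.trace ℂ _ (LinearMap.mulLeft ℂ x) = ∑ i, (m i : ℂ) * (x i).trace := by
  classical
  rw [LinearMap.trace_eq_matrix_trace ℂ
      (Pi.basis fun i => Matrix.stdBasis ℂ (Fin (m i)) (Fin (m i))),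
    Matrix.trace, Fintype.sum_sigma]
  refine Finset.sum_congr rfl fun i _ => ?_
  rw [Fintype.sum_prod_type, Matrix.trace, Finset.mul_sum]
  refine Finset.sum_congr rfl fun a _ => ?_
  -- Left multiplication acts on each column separately, so the diagonal entry at a matrix unit does
  -- not depend on its column `b`; this produces the factor `m i`.
  have : ∀ b : Fin (m i), (LinearMap.toMatrix
      (Pi.basis fun i => Matrix.stdBasis ℂ (Fin (m i)) (Fin (m i)))
      (Pi.basis fun i => Matrix.stdBasis ℂ (Fin (m i)) (Fin (m i)))
      (LinearMap.mulLeft ℂ x)).diag ⟨i, (a, b)⟩ = x i a a := by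
    intro b
    rw [Matrix.diag_apply, LinearMap.toMatrix_apply, Pi.basis_repr, Pi.basis_apply,
      Matrix.stdBasis_eq_single, LinearMap.mulLeft_apply, Pi.mul_apply, Pi.single_eq_same]
    simp [Matrix.stdBasis]
  rw [Finset.sum_congr rfl fun b _ => this b]
  simp

/-- A group element other than `1` permutes the basis without fixed points, so only the coefficient
of `1` is seen by the trace. -/
theorem MonoidAlgebra.trace_mulLeft {N : Type*} [Group N] [Fintype N] (x : MonoidAlgebra ℂ N) :
    LinearMap.trace ℂ _ (LinearMap.mulLeft ℂ x) = (Fintype.card N : ℂ) * x.coeff 1 := by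
  classical
  rw [LinearMap.trace_eq_matrix_trace ℂ (MonoidAlgebra.basis N ℂ), Matrix.trace]
  have : ∀ g : N, (LinearMap.toMatrix (MonoidAlgebra.basis N ℂ) (MonoidAlgebra.basis N ℂ)
      (LinearMap.mulLeft ℂ x)).diag g = x.coeff 1 := by
    intro g
    rw [Matrix.diag_apply, LinearMap.toMatrix_apply, MonoidAlgebra.basis_apply]
    change (x * MonoidAlgebra.single g 1).coeff g = _
    simp
  rw [Finset.sum_congr rfl fun b _ => this b]
  simp

variable {N : Type*} [Group N] {ι : Type*} {m : ι → ℕ}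

/-- The coefficient of `1` in an element of a complex group algebra, in terms of the matrix blocks
of the algebra. -/
theorem MonoidAlgebra.card_mul_coeff_one [Fintype N] [Fintype ι] [DecidableEq ι]
    (e : MonoidAlgebra ℂ N ≃ₐ[ℂ] Π i, Matrix (Fin (m i)) (Fin (m i)) ℂ) (x : MonoidAlgebra ℂ N) :
    (Fintype.card N : ℂ) * x.coeff 1 = ∑ i, (m i : ℂ) * (e x i).trace := by
  rw [← Matrix.trace_mulLeft_pi, ← MonoidAlgebra.trace_mulLeft,
    ← LinearMap.trace_conj' (LinearMap.mulLeft ℂ x) e.toLinearEquiv]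
  congr 1
  refine LinearMap.ext fun y => ?_
  simp [LinearEquiv.conj_apply]

variable (e : MonoidAlgebra ℂ N ≃ₐ[ℂ] Π i, Matrix (Fin (m i)) (Fin (m i)) ℂ)

/-- The `i`-th block of the group algebra. -/
def blockHom (i : ι) : MonoidAlgebra ℂ N →ₐ[ℂ] Matrix (Fin (m i)) (Fin (m i)) ℂ :=
  (Pi.evalAlgHom ℂ _ i).comp e.toAlgHom

/-- The representation given by the `i`-th block of the group algebra. -/
def blockRep (i : ι) : N →* Matrix (Fin (m i)) (Fin (m i)) ℂ :=
  (blockHom e i : MonoidAlgebra ℂ N →* _).comp (MonoidAlgebra.of ℂ N)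

theorem blockHom_apply (i : ι) (x : MonoidAlgebra ℂ N) : blockHom e i x = e x i := rfl

theorem blockRep_apply (i : ι) (g : N) : blockRep e i g = blockHom e i (.of ℂ N g) := rfl

theorem blockHom_symm_single [DecidableEq ι] (i : ι) (X : Matrix (Fin (m i)) (Fin (m i)) ℂ) :
    blockHom e i (e.symm (Pi.single i X)) = X := by
  simp [blockHom_apply]

theorem blockHom_surjective (i : ι) : Function.Surjective (blockHom e i) := by
  classical
  exact fun X => ⟨_, blockHom_symm_single e i X⟩

theorem blockHom_eq_sum [Fintype N] (i : ι) (x : MonoidAlgebra ℂ N) :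
    blockHom e i x = ∑ g : N, x.coeff g • blockRep e i g := by
  have : x = ∑ g : N, x.coeff g • MonoidAlgebra.of ℂ N g := by
    ext h
    simp [MonoidAlgebra.coeff_sum]
  conv_lhs => rw [this, map_sum]
  refine Finset.sum_congr rfl fun g _ => ?_
  rw [map_smul, blockRep_apply]

/-- A matrix commuting with a block of the group algebra is scalar. -/
theorem exists_scalar_of_commute_blockRep (i : ι) (X : Matrix (Fin (m i)) (Fin (m i)) ℂ)
    (h : ∀ g : N, Commute (blockRep e i g) X) :
    ∃ c : ℂ, X = c • (1 : Matrix (Fin (m i)) (Fin (m i)) ℂ) := by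
  have hall : ∀ x, Commute (blockHom e i x) X := by
    intro x
    induction x using MonoidAlgebra.induction_on with
    | of g => exact h g
    | add x y hx hy => rw [map_add]; exact hx.add_left hy
    | smul r x hx => rw [map_smul]; exact hx.smul_left r
  obtain ⟨c, hc⟩ := Matrix.mem_range_scalar_iff_commute_single (M := X).2 fun a b _ => by
    obtain ⟨x, hx⟩ := blockHom_surjective e i (Matrix.single a b 1)
    exact hx ▸ hall x
  exact ⟨c, by rw [← hc, Matrix.scalar_apply, Matrix.smul_one_eq_diagonal]⟩

/-- A central idempotent is `0` or `1` in each block. -/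
theorem blockHom_central_idem (i : ι) {f : MonoidAlgebra ℂ N} (hf : f * f = f)
    (hc : ∀ n : N, Commute (MonoidAlgebra.of ℂ N n) f) :
    blockHom e i f = 0 ∨ blockHom e i f = 1 := by
  obtain ⟨c, hc'⟩ := exists_scalar_of_commute_blockRep e i (blockHom e i f) fun n => by
    rw [blockRep_apply, Commute, SemiconjBy, ← map_mul, (hc n).eq, map_mul]
  rcases Nat.eq_zero_or_pos (m i) with h0 | hpos
  · have : IsEmpty (Fin (m i)) := by rw [h0]; infer_instance
    exact Or.inl (Subsingleton.elim _ _)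
  have : Nonempty (Fin (m i)) := ⟨⟨0, hpos⟩⟩
  have h2 : blockHom e i f * blockHom e i f = blockHom e i f := by rw [← map_mul, hf]
  rw [hc'] at h2 ⊢
  rw [smul_mul_smul_comm, one_mul] at h2
  have h3 : c * c = c := smul_left_injective ℂ (one_ne_zero' (Matrix (Fin (m i)) (Fin (m i)) ℂ)) h2
  rcases IsIdempotentElem.iff_eq_zero_or_one.1 h3 with h | h
  · left; rw [h, zero_smul]
  · right; rw [h, one_smul]

variable [Fintype N]

/-- Fourier inversion in one block. -/
theorem sum_trace_smul_blockRep [Finite ι] (i : ι) (X : Matrix (Fin (m i)) (Fin (m i)) ℂ) :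
    ∑ g : N, (X * blockRep e i g⁻¹).trace • blockRep e i g =
      ((Fintype.card N : ℂ) / m i) • X := by
  classical
  have := Fintype.ofFinite ι
  rcases Nat.eq_zero_or_pos (m i) with h0 | hpos
  · have : IsEmpty (Fin (m i)) := by rw [h0]; infer_instance
    exact Subsingleton.elim _ _
  have hm : (m i : ℂ) ≠ 0 := by exact_mod_cast hpos.ne'
  set x := e.symm (Pi.single i X) with hx
  -- The coefficient of `g` in `x` is the coefficient of `1` in `x g⁻¹`. As `x` is supported in
  -- block `i`, only that block survives in the trace formula.
  have hc : ∀ g : N, (m i : ℂ) * (X * blockRep e i g⁻¹).trace =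
      (Fintype.card N : ℂ) * x.coeff g := by
    intro g
    have := MonoidAlgebra.card_mul_coeff_one e (x * .of ℂ N g⁻¹)
    rw [Finset.sum_eq_single i] at this
    · rw [MonoidAlgebra.of_apply, MonoidAlgebra.coeff_mul_single_apply] at this
      simp only [inv_inv, one_mul, mul_one] at this
      rw [this, map_mul, Pi.mul_apply, hx, AlgEquiv.apply_symm_apply, Pi.single_eq_same]
      rfl
    · intro j _ hj
      rw [map_mul, Pi.mul_apply, hx, AlgEquiv.apply_symm_apply, Pi.single_eq_of_ne hj]
      simp
    · simp
  have hsum : ∑ g : N, x.coeff g • blockRep e i g = X := by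
    rw [← blockHom_eq_sum, blockHom_symm_single]
  have : ∀ g : N, (X * blockRep e i g⁻¹).trace =
      ((Fintype.card N : ℂ) / m i) * x.coeff g := by
    intro g
    rw [div_mul_eq_mul_div, ← hc g, mul_div_cancel_left₀ _ hm]
  simp_rw [this, mul_smul, ← Finset.smul_sum, hsum]

/-- The sum commutes with the block, hence is scalar by Schur's lemma; comparing traces determines
the scalar. -/
theorem sum_conj_blockRep (i : ι) (X : Matrix (Fin (m i)) (Fin (m i)) ℂ) :
    ∑ g : N, blockRep e i g * X * blockRep e i g⁻¹ =
      ((Fintype.card N : ℂ) / m i * X.trace) • (1 : Matrix (Fin (m i)) (Fin (m i)) ℂ) := by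
  rcases Nat.eq_zero_or_pos (m i) with h0 | hpos
  · have : IsEmpty (Fin (m i)) := by rw [h0]; infer_instance
    exact Subsingleton.elim _ _
  have hm : (m i : ℂ) ≠ 0 := by exact_mod_cast hpos.ne'
  obtain ⟨c, hc⟩ := exists_scalar_of_commute_blockRep e i
    (∑ g : N, blockRep e i g * X * blockRep e i g⁻¹) fun h => by
      rw [Commute, SemiconjBy, Finset.mul_sum, Finset.sum_mul]
      refine Fintype.sum_equiv (Equiv.mulLeft h) _ _ fun g => ?_
      rw [Equiv.coe_mulLeft, mul_assoc _ (blockRep e i (h * g)⁻¹), ← map_mul, _root_.mul_inv_rev,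
        inv_mul_cancel_right, map_mul]
      simp only [mul_assoc]
  have ht := congrArg Matrix.trace hc
  rw [Matrix.trace_sum] at ht
  have : ∀ g : N, (blockRep e i g * X * blockRep e i g⁻¹).trace = X.trace := by
    intro g
    rw [Matrix.trace_mul_comm, ← mul_assoc, ← map_mul, inv_mul_cancel, map_one, one_mul]
  simp only [this, Finset.sum_const, Finset.card_univ, nsmul_eq_mul, Matrix.trace_smul,
    Matrix.trace_one, Fintype.card_fin, smul_eq_mul] at ht
  have hc' : c = (Fintype.card N : ℂ) / m i * X.trace := by
    rw [div_mul_eq_mul_div, ht, mul_div_cancel_right₀ _ hm]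
  rw [hc, hc']

/-- The sum over all modifications by a finite group of a commutator of matrices. -/
theorem sum_commutator_blockRep [Finite ι] (i : ι) (A B : (Matrix (Fin (m i)) (Fin (m i)) ℂ)ˣ) :
    ∑ p : N × N, (A.val * blockRep e i p.1) * (B.val * blockRep e i p.2) *
        (blockRep e i p.1⁻¹ * A⁻¹.val) * (blockRep e i p.2⁻¹ * B⁻¹.val) =
      ((Fintype.card N : ℂ) / m i) ^ 2 • (1 : Matrix (Fin (m i)) (Fin (m i)) ℂ) := by
  rw [Fintype.sum_prod_type]
  -- The inner sum is a sum of conjugates and collapses to a trace. What remains over `g` is Fourier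
  -- inversion for `A⁻¹`, which then cancels against `A`.
  have h1 : ∀ g : N, ∑ h : N, (A.val * blockRep e i g) * (B.val * blockRep e i h) *
        (blockRep e i g⁻¹ * A⁻¹.val) * (blockRep e i h⁻¹ * B⁻¹.val) =
      ((Fintype.card N : ℂ) / m i) • (A.val *
        ((A⁻¹.val * blockRep e i g⁻¹).trace • blockRep e i g)) := by
    intro g
    have := sum_conj_blockRep e i (blockRep e i g⁻¹ * A⁻¹.val)
    calc _ = (A.val * blockRep e i g) * B.val * (∑ h : N, blockRep e i h *
          (blockRep e i g⁻¹ * A⁻¹.val) * blockRep e i h⁻¹) * B⁻¹.val := by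
          rw [Finset.mul_sum, Finset.sum_mul]
          simp only [mul_assoc]
      _ = _ := by
          rw [this, Matrix.trace_mul_comm]
          simp only [mul_smul_comm, smul_mul_assoc, mul_one, smul_smul]
          rw [mul_assoc, Units.mul_inv, mul_one]
  rw [Finset.sum_congr rfl fun g _ => h1 g, ← Finset.smul_sum, ← Finset.mul_sum,
    sum_trace_smul_blockRep]
  rw [mul_smul_comm, Units.mul_inv, smul_smul, sq]

theorem sum_block_sq [Fintype ι]
    (e : MonoidAlgebra ℂ N ≃ₐ[ℂ] Π i, Matrix (Fin (m i)) (Fin (m i)) ℂ) :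
    ∑ i, (m i : ℂ) ^ 2 = Fintype.card N := by
  classical
  have := MonoidAlgebra.card_mul_coeff_one e 1
  simp only [map_one, Pi.one_apply, Matrix.trace_one, Fintype.card_fin] at this
  rw [MonoidAlgebra.one_def, MonoidAlgebra.coeff_single, Finsupp.single_eq_same, mul_one] at this
  rw [this]
  exact Finset.sum_congr rfl fun i _ => sq _

end BlockTrace

/-! ### Products of commutators -/

section SurfaceWord

open scoped commutatorElement

/-- The product of commutators `⁅x₀, y₀⁆ ⋯ ⁅x_{d-1}, y_{d-1}⁆`. -/
def surfaceWord {H : Type*} [Group H] {d : ℕ} (x y : Fin d → H) : H :=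
  (List.ofFn fun j => ⁅x j, y j⁆).prod

theorem map_surfaceWord {H H' : Type*} [Group H] [Group H'] (f : H →* H') {d : ℕ}
    (x y : Fin d → H) : f (surfaceWord x y) = surfaceWord (fun j => f (x j)) (fun j => f (y j)) := by
  simp only [surfaceWord, map_list_prod, List.map_ofFn, Function.comp_def, map_commutatorElement]

theorem surfaceWord_eq_one_of_comm {H : Type*} [CommGroup H] {d : ℕ} (x y : Fin d → H) :
    surfaceWord x y = 1 := by
  refine List.prod_eq_one fun z hz => ?_
  obtain ⟨j, rfl⟩ := (List.mem_ofFn ..).1 hz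
  rw [commutatorElement_def, mul_comm (x j), mul_inv_cancel_right, mul_inv_cancel]

/-- Distributivity without commutativity: it splits a sum over all modifications of a word into a
product of independent sums, one for each handle. -/
theorem sum_prod_ofFn {R X : Type*} [Semiring R] [Fintype X] {d : ℕ} (f : Fin d → X → R) :
    ∑ x : Fin d → X, (List.ofFn fun j => f j (x j)).prod =
      (List.ofFn fun j => ∑ x, f j x).prod := by
  induction d with
  | zero => simp
  | succ d ih =>
    rw [← (Fin.consEquiv fun _ => X).sum_comp, Fintype.sum_prod_type]
    simp only [List.ofFn_succ, List.prod_cons, Fin.consEquiv_apply, Fin.cons_zero, Fin.cons_succ]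
    rw [Finset.sum_mul]
    refine Finset.sum_congr rfl fun a _ => ?_
    rw [← Finset.mul_sum, ih fun j => f j.succ]

end SurfaceWord

/-! ### Idempotents orthogonal to their conjugates -/

section ConjugateIdempotents

variable {Γ : Type*} [Group Γ] (N : Subgroup Γ) {R : Type*} [Ring R] (u : Γ →* R)

/-- The conditions on an idempotent `E` under which the sums of commutators over cosets of `N`
annihilate `E` unless both cosets fix `E`. -/
structure IsBlockIdempotent (E : R) : Prop where
  idem : E * E = E
  comm : ∀ n ∈ N, Commute (u n) E
  comm_of_comm : ∀ Y, (∀ n ∈ N, Commute (u n) Y) → Commute E Y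
  conj : ∀ g, u g * E * u g⁻¹ = E ∨ E * (u g * E * u g⁻¹) = 0

variable {N u}

theorem map_inv_mul_cancel_left (g : Γ) (x : R) : u g⁻¹ * (u g * x) = x := by
  rw [← mul_assoc, ← map_mul, inv_mul_cancel, map_one, one_mul]

theorem map_mul_inv_cancel_left (g : Γ) (x : R) : u g * (u g⁻¹ * x) = x := by
  rw [← mul_assoc, ← map_mul, mul_inv_cancel, map_one, one_mul]

/-- All four conditions are transported by conjugation because `N` is normal. -/
theorem IsBlockIdempotent.conjugate [N.Normal] {E : R} (hE : IsBlockIdempotent N u E) (h : Γ) :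
    IsBlockIdempotent N u (u h * E * u h⁻¹) where
  idem := by
    simp only [mul_assoc, map_inv_mul_cancel_left]
    rw [← mul_assoc E E, hE.idem]
  comm n hn := by
    have := hE.comm (h⁻¹ * n * h) (by simpa using (inferInstance : N.Normal).conj_mem n hn h⁻¹)
    rw [Commute, SemiconjBy] at this ⊢
    calc u n * (u h * E * u h⁻¹) = u h * (u (h⁻¹ * n * h) * E) * u h⁻¹ := by
          simp only [map_mul, mul_assoc, map_mul_inv_cancel_left]
      _ = _ := by
          rw [this]
          simp only [map_mul, mul_assoc]
          rw [← map_mul u h h⁻¹, mul_inv_cancel, map_one, mul_one]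
  comm_of_comm Y hY := by
    have := hE.comm_of_comm (u h⁻¹ * Y * u h) fun n hn => by
      have := hY (h * n * h⁻¹) ((inferInstance : N.Normal).conj_mem n hn h)
      rw [Commute, SemiconjBy] at this ⊢
      calc u n * (u h⁻¹ * Y * u h) = u h⁻¹ * (u (h * n * h⁻¹) * Y) * u h := by
            simp only [map_mul, mul_assoc, map_inv_mul_cancel_left]
        _ = _ := by
            rw [this]
            simp only [map_mul, mul_assoc]
            rw [← map_mul u h⁻¹ h, inv_mul_cancel, map_one, mul_one]
    rw [Commute, SemiconjBy] at this ⊢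
    calc u h * E * u h⁻¹ * Y = u h * (E * (u h⁻¹ * Y * u h)) * u h⁻¹ := by
          simp only [mul_assoc]
          rw [← map_mul u h h⁻¹, mul_inv_cancel, map_one, mul_one]
      _ = _ := by
          rw [this]
          simp only [mul_assoc, map_mul_inv_cancel_left]
  conj g := by
    have key : u g * (u h * E * u h⁻¹) * u g⁻¹ =
        u h * (u (h⁻¹ * g * h) * E * u (h⁻¹ * g * h)⁻¹) * u h⁻¹ := by
      simp only [mul_inv_rev, inv_inv, map_mul, mul_assoc, map_mul_inv_cancel_left]
      rw [← map_mul u h h⁻¹, mul_inv_cancel, map_one, mul_one]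
    rw [key]
    rcases hE.conj (h⁻¹ * g * h) with h' | h'
    · left; rw [h']
    · right
      calc _ = u h * (E * (u (h⁻¹ * g * h) * E * u (h⁻¹ * g * h)⁻¹)) * u h⁻¹ := by
            simp only [mul_assoc, map_inv_mul_cancel_left]
        _ = 0 := by rw [h', mul_zero, zero_mul]

/-- The elements whose conjugation fixes `E`. -/
def conjStabilizer (u : Γ →* R) (E : R) : Subgroup Γ where
  carrier := {g | Commute (u g) E}
  mul_mem' ha hb := by
    rw [Set.mem_ofPred_eq, map_mul]
    exact Commute.mul_left ha hb
  one_mem' := by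
    rw [Set.mem_ofPred_eq, map_one]
    exact Commute.one_left _
  inv_mem' {g} h := by
    rw [Set.mem_ofPred_eq, Commute, SemiconjBy] at *
    calc u g⁻¹ * E = u g⁻¹ * (E * u g) * u g⁻¹ := by
          simp only [mul_assoc]
          rw [← map_mul u g g⁻¹, mul_inv_cancel, map_one, mul_one]
      _ = E * u g⁻¹ := by rw [← h, ← mul_assoc, ← map_mul, inv_mul_cancel, map_one, one_mul]

theorem mem_conjStabilizer_iff {E : R} {g : Γ} :
    g ∈ conjStabilizer u E ↔ u g * E * u g⁻¹ = E := by
  change u g * E = E * u g ↔ _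
  constructor
  · intro h
    rw [h, mul_assoc, ← map_mul, mul_inv_cancel, map_one, mul_one]
  · intro h
    conv_rhs => rw [← h]
    rw [mul_assoc _ _ (u g), ← map_mul, inv_mul_cancel, map_one, mul_one]

theorem mem_conjStabilizer_conjugate {E : R} {g h : Γ} :
    g ∈ conjStabilizer u (u h⁻¹ * E * u h) ↔ h * g * h⁻¹ ∈ conjStabilizer u E := by
  rw [mem_conjStabilizer_iff, mem_conjStabilizer_iff]
  have key : u (h * g * h⁻¹) * E * u (h * g * h⁻¹)⁻¹ =
      u h * (u g * (u h⁻¹ * E * u h) * u g⁻¹) * u h⁻¹ := by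
    simp only [mul_inv_rev, inv_inv, map_mul, mul_assoc]
  rw [key]
  constructor
  · intro h'
    rw [h']
    simp only [mul_assoc, map_mul_inv_cancel_left]
    rw [← map_mul u h h⁻¹, mul_inv_cancel, map_one, mul_one]
  · intro h'
    conv_rhs => rw [← h']
    simp only [mul_assoc, map_inv_mul_cancel_left]
    rw [← map_mul u h⁻¹ h, inv_mul_cancel, map_one, mul_one]

variable [Fintype N]

/-- The sum commutes with `N`, hence with `E`, and since `E` is idempotent a second factor `E` may
be put on the right. Each term then contains `E * (u g * E * u g⁻¹)`, which vanishes. -/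
theorem IsBlockIdempotent.mul_sum_conj {E : R} (hE : IsBlockIdempotent N u E) {g : Γ}
    (hg : g ∉ conjStabilizer u E) : E * ∑ n : N, u (n * g * n⁻¹) = 0 := by
  have h0 := (hE.conj g).resolve_left fun h => hg (mem_conjStabilizer_iff.2 h)
  have hY : Commute E (∑ n : N, u (n * g * n⁻¹)) := hE.comm_of_comm _ fun k hk => by
    rw [Commute, SemiconjBy, Finset.mul_sum, Finset.sum_mul]
    refine Fintype.sum_equiv (Equiv.mulLeft ⟨k, hk⟩) _ _ fun n => ?_
    rw [← map_mul, ← map_mul, Equiv.coe_mulLeft]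
    congr 1
    simp [mul_assoc]
  rw [← hE.idem, mul_assoc, hY.eq, ← mul_assoc, Finset.mul_sum, Finset.sum_mul]
  refine Finset.sum_eq_zero fun n _ => ?_
  have hn := hE.comm n n.2
  have hn' := hE.comm _ (N.inv_mem n.2)
  rw [Commute, SemiconjBy] at hn hn'
  calc _ = E * u n * u g * (u (n : Γ)⁻¹ * E) := by
        rw [InvMemClass.coe_inv, map_mul, map_mul]
        simp only [mul_assoc]
    _ = u n * (E * (u g * E * u g⁻¹)) * (u g * u (n : Γ)⁻¹) := by
        rw [hn', ← hn]
        simp only [mul_assoc, map_inv_mul_cancel_left]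
    _ = 0 := by rw [h0, mul_zero, zero_mul]

variable [N.Normal]

/-- Moving `u h` to the left of `E` replaces `E` by its conjugate under `h⁻¹`, to which
`mul_sum_conj` applies. -/
theorem IsBlockIdempotent.mul_mul_sum_conj {E : R} (hE : IsBlockIdempotent N u E) {g h : Γ}
    (hg : h * g * h⁻¹ ∉ conjStabilizer u E) : E * (u h * ∑ n : N, u (n * g * n⁻¹)) = 0 := by
  have h1 := hE.conjugate h⁻¹
  rw [inv_inv] at h1
  have h2 := h1.mul_sum_conj (g := g) (by rwa [mem_conjStabilizer_conjugate])
  calc _ = u h * (u h⁻¹ * E * u h * ∑ n : N, u (n * g * n⁻¹)) := by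
        simp only [mul_assoc, map_mul_inv_cancel_left]
    _ = 0 := by rw [h2, mul_zero]

open scoped commutatorElement

/-- The double sum is read in two ways. With the second modification fixed, it is `a` times a sum of
`N`-conjugates of `b k`, up to a right factor; nonvanishing forces `a b a⁻¹` into the stabilizer.
With the first one fixed, it is `a k b` times a sum of conjugates of `(a k)⁻¹`; together with the
previous result this forces `a`, and then `b`, into the stabilizer. -/
theorem IsBlockIdempotent.mem_of_mul_sum_commutator_ne_zero {E : R}
    (hE : IsBlockIdempotent N u E) {a b : Γ}
    (h : E * ∑ p : N × N, u ⁅a * p.1, b * p.2⁆ ≠ 0) :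
    a ∈ conjStabilizer u E ∧ b ∈ conjStabilizer u E := by
  set S := conjStabilizer u E with hS
  have hN : ∀ n ∈ N, n ∈ S := fun n hn => hE.comm n hn
  have hN' : ∀ n ∈ N, ∀ g : Γ, g * n * g⁻¹ ∈ S := fun n hn g =>
    hN _ ((inferInstance : N.Normal).conj_mem n hn g)
  have h1 : a * b * a⁻¹ ∈ S := by
    rw [Fintype.sum_prod_type_right, Finset.mul_sum] at h
    obtain ⟨k, -, hk⟩ := Finset.exists_ne_zero_of_sum_ne_zero h
    by_contra hab
    refine hk ?_
    have h2 := hE.mul_mul_sum_conj (g := b * k) (h := a) fun h3 => hab <| by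
      have := S.mul_mem h3 (S.inv_mem (hN' k k.2 a))
      convert this using 1
      group
    calc _ = E * (u a * ∑ n : N, u (n * (b * k) * n⁻¹)) * u (a⁻¹ * (b * k)⁻¹) := by
          rw [mul_assoc E]
          congr 1
          rw [Finset.mul_sum, Finset.sum_mul]
          refine Finset.sum_congr rfl fun n _ => ?_
          rw [← map_mul, ← map_mul]
          congr 1
          simp only [commutatorElement_def, InvMemClass.coe_inv]
          group
      _ = 0 := by rw [h2, zero_mul]
  have ha : a ∈ S := by
    rw [Fintype.sum_prod_type, Finset.mul_sum] at h
    obtain ⟨k, -, hk⟩ := Finset.exists_ne_zero_of_sum_ne_zero h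
    by_contra haS
    refine hk ?_
    have hs : (a * k) * b * (a * k)⁻¹ ∈ S := by
      have := S.mul_mem h1 (S.mul_mem (hN' _ (N.mul_mem
        ((inferInstance : N.Normal).conj_mem k k.2 b⁻¹) (N.inv_mem k.2)) a) S.one_mem)
      convert this using 1
      group
    have h2 := hE.mul_mul_sum_conj (g := (a * k)⁻¹) (h := a * k * b) fun h3 => haS <| by
      have h4 := S.inv_mem h3
      have h5 := S.mul_mem (S.mul_mem (S.inv_mem hs) h4) hs
      have h6 : a * k ∈ S := by
        convert h5 using 1
        group
      simpa using S.mul_mem h6 (S.inv_mem (hN k k.2))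
    calc _ = E * (u (a * k * b) * ∑ n : N, u (n * (a * k)⁻¹ * n⁻¹)) * u b⁻¹ := by
          rw [mul_assoc E]
          congr 1
          rw [Finset.mul_sum, Finset.sum_mul]
          refine Finset.sum_congr rfl fun n _ => ?_
          rw [← map_mul, ← map_mul]
          congr 1
          simp only [commutatorElement_def, InvMemClass.coe_inv]
          group
      _ = 0 := by rw [h2, zero_mul]
  refine ⟨ha, ?_⟩
  have := S.mul_mem (S.mul_mem (S.inv_mem ha) h1) ha
  convert this using 1
  group

/-- Once the first pair is known to stabilize `E`, the first factor commutes with `E`, so `E` can be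
passed on to the remaining handles. -/
theorem IsBlockIdempotent.mem_of_mul_prod_ne_zero {E : R} (hE : IsBlockIdempotent N u E) {d : ℕ}
    (a b : Fin d → Γ)
    (h : E * (List.ofFn fun j => ∑ p : N × N, u ⁅a j * p.1, b j * p.2⁆).prod ≠ 0) (j : Fin d) :
    a j ∈ conjStabilizer u E ∧ b j ∈ conjStabilizer u E := by
  induction d with
  | zero => exact j.elim0
  | succ d ih =>
    rw [List.ofFn_succ, List.prod_cons, ← mul_assoc] at h
    have h0 := hE.mem_of_mul_sum_commutator_ne_zero (left_ne_zero_of_mul h)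
    refine Fin.cases h0 (fun j => ?_) j
    refine ih (fun j => a j.succ) (fun j => b j.succ) ?_ j
    have hc : Commute E (∑ p : N × N, u ⁅a 0 * p.1, b 0 * p.2⁆) := by
      refine Commute.sum_right _ _ _ fun p _ => Commute.symm ?_
      have hN : ∀ n : N, (n : Γ) ∈ conjStabilizer u E := fun n => hE.comm n n.2
      have h1 := (conjStabilizer u E).mul_mem h0.1 (hN p.1)
      have h2 := (conjStabilizer u E).mul_mem h0.2 (hN p.2)
      exact (conjStabilizer u E).mul_mem ((conjStabilizer u E).mul_mem
        ((conjStabilizer u E).mul_mem h1 h2) ((conjStabilizer u E).inv_mem h1))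
        ((conjStabilizer u E).inv_mem h2)
    rw [hc.eq, mul_assoc] at h
    exact right_ne_zero_of_mul h

end ConjugateIdempotents

/-! ### Conjugation action on the blocks of a normal subgroup -/

noncomputable section Blocks

open scoped commutatorElement

variable {Γ : Type*} [Group Γ] {N : Subgroup Γ}

/-- The inclusion of the group algebra of a subgroup. -/
def subgroupAlgebra (N : Subgroup Γ) : MonoidAlgebra ℂ N →ₐ[ℂ] MonoidAlgebra ℂ Γ :=
  MonoidAlgebra.mapDomainAlgHom ℂ ℂ N.subtype

theorem subgroupAlgebra_of (n : N) :
    subgroupAlgebra N (.of ℂ N n) = .of ℂ Γ n := by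
  simp [subgroupAlgebra]

theorem subgroupAlgebra_injective : Function.Injective (subgroupAlgebra N) :=
  MonoidAlgebra.mapDomain_injective Subtype.val_injective

theorem commute_subgroupAlgebra {Y : MonoidAlgebra ℂ Γ}
    (h : ∀ n ∈ N, Commute (MonoidAlgebra.of ℂ Γ n) Y) (x : MonoidAlgebra ℂ N) :
    Commute (subgroupAlgebra N x) Y := by
  induction x using MonoidAlgebra.induction_on with
  | of n => rw [subgroupAlgebra_of]; exact h n n.2
  | add x y hx hy => rw [map_add]; exact hx.add_left hy
  | smul r x hx => rw [map_smul]; exact hx.smul_left r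

variable [N.Normal]

/-- Conjugation by an element of the ambient group on the group algebra of a normal subgroup. -/
def conjAlg (g : Γ) : MonoidAlgebra ℂ N ≃ₐ[ℂ] MonoidAlgebra ℂ N :=
  MonoidAlgebra.domCongr ℂ ℂ (MulAut.conjNormal g)

theorem conjAlg_of (g : Γ) (n : N) :
    conjAlg g (.of ℂ N n) = .of ℂ N (MulAut.conjNormal g n) := by
  simp [conjAlg]

theorem subgroupAlgebra_conjAlg (g : Γ) (x : MonoidAlgebra ℂ N) :
    subgroupAlgebra N (conjAlg g x) =
      MonoidAlgebra.of ℂ Γ g * subgroupAlgebra N x * MonoidAlgebra.of ℂ Γ g⁻¹ := by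
  induction x using MonoidAlgebra.induction_on with
  | of n =>
    rw [conjAlg_of, subgroupAlgebra_of, subgroupAlgebra_of, ← map_mul, ← map_mul,
      MulAut.conjNormal_apply]
  | add x y hx hy => simp only [map_add, hx, hy, mul_add, add_mul]
  | smul r x hx => simp only [map_smul, hx, mul_smul_comm, smul_mul_assoc]

theorem conjAlg_inv_conjAlg (g : Γ) (x : MonoidAlgebra ℂ N) :
    conjAlg g (conjAlg g⁻¹ x) = x := by
  apply subgroupAlgebra_injective
  rw [subgroupAlgebra_conjAlg, subgroupAlgebra_conjAlg, inv_inv]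
  simp only [mul_assoc, map_mul_inv_cancel_left]
  rw [← map_mul, mul_inv_cancel, map_one, mul_one]

variable {ι : Type*} [DecidableEq ι] {m : ι → ℕ}
  (e : MonoidAlgebra ℂ N ≃ₐ[ℂ] Π i, Matrix (Fin (m i)) (Fin (m i)) ℂ)

/-- The central idempotent of the `i`-th block. -/
def blockIdem (i : ι) : MonoidAlgebra ℂ N := e.symm (Pi.single i 1)

omit [N.Normal] in
theorem blockHom_blockIdem (i : ι) : blockHom e i (blockIdem e i) = 1 :=
  blockHom_symm_single e i 1

omit [N.Normal] in
theorem blockIdem_mul (i : ι) (x : MonoidAlgebra ℂ N) :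
    blockIdem e i * x = e.symm (Pi.single i (blockHom e i x)) := by
  apply e.injective
  rw [map_mul, blockIdem, e.apply_symm_apply, e.apply_symm_apply, ← Pi.single_mul_left, one_mul]
  rfl

omit [N.Normal] in
theorem mul_blockIdem (i : ι) (x : MonoidAlgebra ℂ N) :
    x * blockIdem e i = e.symm (Pi.single i (blockHom e i x)) := by
  apply e.injective
  rw [map_mul, blockIdem, e.apply_symm_apply, e.apply_symm_apply, ← Pi.single_mul_right, mul_one]
  rfl

omit [N.Normal] in
theorem blockIdem_idem (i : ι) : blockIdem e i * blockIdem e i = blockIdem e i := by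
  rw [blockIdem_mul, blockHom_blockIdem, blockIdem]

/-- A conjugate of the central idempotent is again a central idempotent, hence `0` or `1` in block
`i`; so its product with the original is `0` or the original. In the second case the same dichotomy
for `g⁻¹` yields equality, the value `0` being excluded because the block is nonzero. -/
theorem isBlockIdempotent_blockIdem (i : ι) (hm : m i ≠ 0) :
    IsBlockIdempotent N (MonoidAlgebra.of ℂ Γ) (subgroupAlgebra N (blockIdem e i)) where
  idem := by rw [← map_mul, blockIdem_idem]
  comm n hn := by
    rw [← subgroupAlgebra_of ⟨n, hn⟩, Commute, SemiconjBy, ← map_mul, ← map_mul, mul_blockIdem,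
      blockIdem_mul]
  comm_of_comm Y hY := commute_subgroupAlgebra hY _
  conj g := by
    have hcases : ∀ g : Γ, blockIdem e i * conjAlg g (blockIdem e i) = 0 ∨
        blockIdem e i * conjAlg g (blockIdem e i) = blockIdem e i := by
      intro g
      have := blockHom_central_idem e i (f := conjAlg g (blockIdem e i))
        (by rw [← map_mul, blockIdem_idem]) fun n => by
          have : MonoidAlgebra.of ℂ N n = conjAlg g (conjAlg g⁻¹ (MonoidAlgebra.of ℂ N n)) :=
            (conjAlg_inv_conjAlg g _).symm
          rw [this, Commute, SemiconjBy, ← map_mul, ← map_mul, mul_blockIdem, blockIdem_mul]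
      rw [blockIdem_mul]
      rcases this with h | h
      · left; rw [h, Pi.single_zero, map_zero]
      · right; rw [h, blockIdem]
    have hcomm : ∀ x, x * blockIdem e i = blockIdem e i * x := fun x => by
      rw [mul_blockIdem, blockIdem_mul]
    rw [← subgroupAlgebra_conjAlg, ← map_mul]
    rcases hcases g with h | h
    · right; rw [h, map_zero]
    · left
      congr 1
      rcases hcases g⁻¹ with h' | h'
      · have h2 := congrArg (conjAlg g) h'
        rw [map_mul, conjAlg_inv_conjAlg, map_zero, hcomm, h] at h2
        have := congrArg (blockHom e i) h2
        rw [blockHom_blockIdem, map_zero] at this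
        have : Nonempty (Fin (m i)) := ⟨⟨0, Nat.pos_of_ne_zero hm⟩⟩
        exact absurd ‹_› one_ne_zero
      · have h2 := congrArg (conjAlg g) h'
        rw [map_mul, conjAlg_inv_conjAlg, hcomm, h] at h2
        exact h2.symm

/-- If conjugation by `g` fixes a block, it is implemented on the block by a matrix. -/
theorem exists_conj_matrix (i : ι) (hm : m i ≠ 0) (g : Γ)
    (hg : g ∈ conjStabilizer (MonoidAlgebra.of ℂ Γ) (subgroupAlgebra N (blockIdem e i))) :
    ∃ A : (Matrix (Fin (m i)) (Fin (m i)) ℂ)ˣ, ∀ n : N,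
      blockRep e i (MulAut.conjNormal g n) = A.val * blockRep e i n * A⁻¹.val := by
  have hne : Nonempty (Fin (m i)) := ⟨⟨0, Nat.pos_of_ne_zero hm⟩⟩
  have hfix : conjAlg g (blockIdem e i) = blockIdem e i := by
    apply subgroupAlgebra_injective
    rw [subgroupAlgebra_conjAlg]
    exact mem_conjStabilizer_iff.1 hg
  have key : ∀ x, blockHom e i (conjAlg g x) =
      blockHom e i (conjAlg g (e.symm (Pi.single i (blockHom e i x)))) := by
    intro x
    rw [← blockIdem_mul, map_mul (conjAlg g), map_mul, hfix, blockHom_blockIdem, one_mul]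
  -- Conjugation by `g` restricted to the block; it is unital because the idempotent is fixed.
  let f : Matrix (Fin (m i)) (Fin (m i)) ℂ →ₐ[ℂ] Matrix (Fin (m i)) (Fin (m i)) ℂ :=
    AlgHom.ofLinearMap ((blockHom e i).toLinearMap ∘ₗ (conjAlg g).toLinearMap ∘ₗ
      e.symm.toLinearMap ∘ₗ LinearMap.single ℂ (fun j => Matrix (Fin (m j)) (Fin (m j)) ℂ) i)
      (by
        change blockHom e i (conjAlg g (blockIdem e i)) = 1
        rw [hfix, blockHom_blockIdem])
      (fun X Y => by
        change blockHom e i (conjAlg g (e.symm (Pi.single i (X * Y)))) =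
          blockHom e i (conjAlg g (e.symm (Pi.single i X))) *
            blockHom e i (conjAlg g (e.symm (Pi.single i Y)))
        rw [← map_mul, ← map_mul, ← map_mul, Pi.single_mul])
  have hf : ∀ x, f (blockHom e i x) = blockHom e i (conjAlg g x) := fun x => (key x).symm
  have hinj : Function.Injective f := f.toRingHom.injective
  have hbij : Function.Bijective f :=
    ⟨hinj, (LinearMap.injective_iff_surjective (f := f.toLinearMap)).1 hinj⟩
  let F : Matrix (Fin (m i)) (Fin (m i)) ℂ ≃ₐ[ℂ] Matrix (Fin (m i)) (Fin (m i)) ℂ :=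
    AlgEquiv.ofBijective f hbij
  let M := Matrix.toLinAlgEquiv' (R := ℂ) (n := Fin (m i))
  -- Skolem–Noether: an automorphism of a matrix algebra is inner.
  obtain ⟨T, hT⟩ := ((M.symm.trans F).trans M).eq_linearEquivConjAlgEquiv
  have hTT : M.symm T.toLinearMap * M.symm T.symm.toLinearMap = 1 := by
    rw [← map_mul, ← map_one M.symm]
    congr 1
    refine LinearMap.ext fun v => ?_
    simp
  have hTT' : M.symm T.symm.toLinearMap * M.symm T.toLinearMap = 1 := by
    rw [← map_mul, ← map_one M.symm]
    congr 1
    refine LinearMap.ext fun v => ?_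
    simp
  refine ⟨⟨_, _, hTT, hTT'⟩, fun n => ?_⟩
  have h1 := congrArg M.symm (AlgEquiv.congr_fun hT (M (blockRep e i n)))
  change M.symm (M (f (M.symm (M (blockRep e i n))))) = _ at h1
  rw [AlgEquiv.symm_apply_apply, AlgEquiv.symm_apply_apply, blockRep_apply, hf, conjAlg_of] at h1
  rw [blockRep_apply, h1]
  change _ = M.symm T.toLinearMap * blockRep e i n * M.symm T.symm.toLinearMap
  have h2 : blockRep e i n = M.symm (M (blockRep e i n)) := (M.symm_apply_apply _).symm
  conv_rhs => rw [h2]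
  rw [← map_mul, ← map_mul]
  congr 1

end Blocks

/-! ### Sums of modified words in moved and in stable blocks -/

noncomputable section Counting

open scoped commutatorElement

variable {Γ : Type*} [Group Γ] {N : Subgroup Γ}

/-- The surface word of modifications of given elements by elements of a subgroup. -/
def twistedWord {d : ℕ} (a b : Fin d → Γ) (x : Fin d → N × N) : Γ :=
  surfaceWord (fun j => a j * (x j).1) (fun j => b j * (x j).2)

theorem surfaceWord_inv_mul_twistedWord_mem [hN : N.Normal] {d : ℕ} (a b : Fin d → Γ)
    (x : Fin d → N × N) : (surfaceWord a b)⁻¹ * twistedWord a b x ∈ N := by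
  rw [← QuotientGroup.eq]
  change QuotientGroup.mk' N _ = QuotientGroup.mk' N _
  rw [twistedWord, map_surfaceWord, map_surfaceWord]
  simp only [map_mul, QuotientGroup.mk'_apply, (QuotientGroup.eq_one_iff _).2 (SetLike.coe_mem _),
    mul_one]

theorem twistedWord_mem [N.Normal] {d : ℕ} {a b : Fin d → Γ} (h : surfaceWord a b ∈ N)
    (x : Fin d → N × N) : twistedWord a b x ∈ N := by
  have := N.mul_mem h (surfaceWord_inv_mul_twistedWord_mem a b x)
  rwa [mul_inv_cancel_left] at this

variable [N.Normal] [Fintype N] {ι : Type*} {m : ι → ℕ}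
  (e : MonoidAlgebra ℂ N ≃ₐ[ℂ] Π i, Matrix (Fin (m i)) (Fin (m i)) ℂ)
  {d : ℕ} {a b : Fin d → Γ}

/-- If the block is moved, some generator fails to stabilize its idempotent, so the idempotent kills
the product of the handle sums. In block `i` the idempotent is `1`, hence the sum itself vanishes
there. -/
theorem sum_blockRep_eq_zero [DecidableEq ι] (h : surfaceWord a b ∈ N)
    (hgen : Subgroup.closure (Set.range a ∪ Set.range b ∪ N) = ⊤) (i : ι) (hm : m i ≠ 0)
    (hS : conjStabilizer (MonoidAlgebra.of ℂ Γ) (subgroupAlgebra N (blockIdem e i)) ≠ ⊤) :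
    ∑ x, blockRep e i ⟨twistedWord a b x, twistedWord_mem h x⟩ = 0 := by
  have hE := isBlockIdempotent_blockIdem e i hm
  have h0 : subgroupAlgebra N (blockIdem e i) *
      (List.ofFn fun j => ∑ p : N × N, MonoidAlgebra.of ℂ Γ ⁅a j * p.1, b j * p.2⁆).prod = 0 := by
    by_contra hne
    refine hS (top_le_iff.1 (hgen ▸ (Subgroup.closure_le _).2 ?_))
    have := hE.mem_of_mul_prod_ne_zero a b hne
    rintro g ((⟨j, rfl⟩ | ⟨j, rfl⟩) | hg)
    · exact (this j).1
    · exact (this j).2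
    · exact hE.comm g hg
  rw [← sum_prod_ofFn (fun j (p : N × N) => MonoidAlgebra.of ℂ Γ ⁅a j * p.1, b j * p.2⁆)] at h0
  have h1 : ∀ x : Fin d → N × N,
      (List.ofFn fun j => MonoidAlgebra.of ℂ Γ ⁅a j * (x j).1, b j * (x j).2⁆).prod =
        subgroupAlgebra N (.of ℂ N ⟨twistedWord a b x, twistedWord_mem h x⟩) := by
    intro x
    rw [subgroupAlgebra_of]
    change _ = MonoidAlgebra.of ℂ Γ (List.ofFn fun j => ⁅a j * (x j).1, b j * (x j).2⁆).prod
    rw [map_list_prod, List.map_ofFn]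
    rfl
  simp only [h1] at h0
  rw [← map_sum, ← map_mul, map_eq_zero_iff _ subgroupAlgebra_injective] at h0
  have h2 := congrArg (blockHom e i) h0
  rw [map_mul, blockHom_blockIdem, one_mul, map_zero, map_sum] at h2
  exact h2

/-- The pairs of a group element and a matrix implementing its conjugation action on a
representation. -/
def conjPairs {k : ℕ} (ρ : N →* Matrix (Fin k) (Fin k) ℂ) :
    Subgroup (Γ × (Matrix (Fin k) (Fin k) ℂ)ˣ) where
  carrier := {p | ∀ n : N, ρ (MulAut.conjNormal p.1 n) * p.2.val = p.2.val * ρ n}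
  mul_mem' {p p'} hp hp' n := by
    have h1 := hp (MulAut.conjNormal p'.1 n)
    have h2 := hp' n
    rw [Prod.fst_mul, Prod.snd_mul, map_mul, MulAut.mul_apply, Units.val_mul, ← mul_assoc, h1,
      mul_assoc, h2, mul_assoc]
  one_mem' n := by simp
  inv_mem' {p} hp n := by
    have h1 := hp (MulAut.conjNormal p.1⁻¹ n)
    rw [← MulAut.mul_apply, ← map_mul, mul_inv_cancel, map_one, MulAut.one_apply] at h1
    rw [Prod.fst_inv, Prod.snd_inv]
    calc _ = p.2⁻¹.val * (p.2.val * ρ (MulAut.conjNormal p.1⁻¹ n)) * p.2⁻¹.val := by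
          rw [← mul_assoc p.2⁻¹.val, Units.inv_mul, one_mul]
      _ = _ := by rw [← h1, mul_assoc, mul_assoc, Units.mul_inv, mul_one]

/-- A group element together with its matrix. -/
def pairHom {k : ℕ} (ρ : N →* Matrix (Fin k) (Fin k) ℂ) : N →* conjPairs ρ where
  toFun n := ⟨(n, ρ.toHomUnits n), fun n' => by
    change ρ _ * ρ n = ρ n * ρ n'
    rw [← map_mul, ← map_mul]
    congr 1
    ext
    simp⟩
  map_one' := by ext1; simp
  map_mul' x y := by ext1; simp

-- Conjugating `(n, ρ n)` by `(g, A)` gives the pair of `g n g⁻¹`, by the defining relation.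
-- Normality lets words be compared modulo `N` in the group and in the matrices at once.
omit [Fintype N] in
theorem pairHom_range_normal {k : ℕ} (ρ : N →* Matrix (Fin k) (Fin k) ℂ) :
    (pairHom ρ).range.Normal where
  conj_mem := by
    rintro _ ⟨n, rfl⟩ ⟨p, hp⟩
    refine ⟨MulAut.conjNormal p.1 n, Subtype.ext (Prod.ext ?_ (Units.ext ?_))⟩
    · simp [pairHom]
    · change ρ _ = p.2.val * ρ n * p.2⁻¹.val
      rw [← hp n, mul_assoc, Units.mul_inv, mul_one]

/-- The matrices `A g` need not form a representation, but the word formed from them differs from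
`ρ` of the word in the group by a factor independent of the modification `x`. This factor is a
scalar of finite order, and the sum of the matrix words factors into handle sums, each given by
`sum_commutator_blockRep`. -/
theorem exists_sum_blockRep_eq [Finite ι] (h : surfaceWord a b ∈ N) (i : ι) (hm : m i ≠ 0)
    (hS : ∀ g : Γ, ∃ A : (Matrix (Fin (m i)) (Fin (m i)) ℂ)ˣ, ∀ n : N,
      blockRep e i (MulAut.conjNormal g n) = A.val * blockRep e i n * A⁻¹.val) :
    ∃ c : ℂ, ‖c‖ = 1 ∧ ∑ x, blockRep e i ⟨twistedWord a b x, twistedWord_mem h x⟩ =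
      (c * (((Fintype.card N : ℂ) / m i) ^ 2) ^ d) •
        (1 : Matrix (Fin (m i)) (Fin (m i)) ℂ) := by
  have hne : Nonempty (Fin (m i)) := ⟨⟨0, Nat.pos_of_ne_zero hm⟩⟩
  set ρ := blockRep e i with hρ
  choose A hA using hS
  have hA' : ∀ g, (g, A g) ∈ conjPairs ρ := fun g n => by
    change ρ _ * (A g).val = _
    rw [hA, mul_assoc, Units.inv_mul, mul_one]
  let a' : Fin d → conjPairs ρ := fun j => ⟨_, hA' (a j)⟩
  let b' : Fin d → conjPairs ρ := fun j => ⟨_, hA' (b j)⟩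
  set Z₀ : (Matrix (Fin (m i)) (Fin (m i)) ℂ)ˣ :=
    surfaceWord (fun j => A (a j)) (fun j => A (b j)) with hZ₀
  set Z : (Fin d → N × N) → (Matrix (Fin (m i)) (Fin (m i)) ℂ)ˣ := fun x =>
    surfaceWord (fun j => A (a j) * ρ.toHomUnits (x j).1) (fun j => A (b j) * ρ.toHomUnits (x j).2)
    with hZ
  have fst_word : ∀ {k : ℕ} (s t : Fin k → conjPairs ρ), (surfaceWord s t).1.1 =
      surfaceWord (fun j => (s j).1.1) (fun j => (t j).1.1) := fun s t =>
    map_surfaceWord ((MonoidHom.fst _ _).comp (conjPairs ρ).subtype) s t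
  have snd_word : ∀ {k : ℕ} (s t : Fin k → conjPairs ρ), (surfaceWord s t).1.2 =
      surfaceWord (fun j => (s j).1.2) (fun j => (t j).1.2) := fun s t =>
    map_surfaceWord ((MonoidHom.snd _ _).comp (conjPairs ρ).subtype) s t
  -- In the group of pairs, the modified and the unmodified word differ by an element of the image
  -- of `N`; its two components give the relation.
  have hrel : ∀ x, ρ.toHomUnits ⟨twistedWord a b x, twistedWord_mem h x⟩ =
      ρ.toHomUnits ⟨surfaceWord a b, h⟩ * Z₀⁻¹ * Z x := by
    intro x
    have := pairHom_range_normal ρ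
    have h1 : (surfaceWord a' b')⁻¹ * surfaceWord (fun j => a' j * pairHom ρ (x j).1)
        (fun j => b' j * pairHom ρ (x j).2) ∈ (pairHom ρ).range := by
      rw [← QuotientGroup.eq]
      change QuotientGroup.mk' _ _ = QuotientGroup.mk' _ _
      rw [map_surfaceWord, map_surfaceWord]
      have hone : ∀ n, QuotientGroup.mk' (pairHom ρ).range (pairHom ρ n) = 1 := fun n =>
        (QuotientGroup.eq_one_iff _).2 ⟨n, rfl⟩
      simp only [map_mul, hone, mul_one]
    obtain ⟨n, hn⟩ := h1
    have h2 := congrArg (fun p : conjPairs ρ => p.1.1) hn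
    have h3 := congrArg (fun p : conjPairs ρ => p.1.2) hn
    simp only [Subgroup.coe_mul, Subgroup.coe_inv, Prod.fst_mul, Prod.fst_inv, Prod.snd_mul,
      Prod.snd_inv, fst_word, snd_word] at h2 h3
    change (n : Γ) = (surfaceWord a b)⁻¹ * twistedWord a b x at h2
    change ρ.toHomUnits n = Z₀⁻¹ * Z x at h3
    rw [mul_assoc, ← h3, ← map_mul]
    congr 1
    ext
    rw [Subgroup.coe_mul, h2, mul_inv_cancel_left]
  set C := ρ.toHomUnits ⟨surfaceWord a b, h⟩ * Z₀⁻¹ with hC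
  obtain ⟨c, hc⟩ := exists_scalar_of_commute_blockRep e i C.val fun n => by
    have h1 : (surfaceWord a' b')⁻¹ ∈ (⊤ : Subgroup (conjPairs ρ)) := trivial
    have h2 := (surfaceWord a' b')⁻¹.2
    have h3 := (conjPairs ρ).mul_mem (pairHom ρ ⟨surfaceWord a b, h⟩).2 h2
    have h4 := h3 n
    rw [Subgroup.coe_inv, Prod.snd_mul, Prod.fst_mul, Prod.fst_inv, Prod.snd_inv, fst_word,
      snd_word] at h4
    change ρ (MulAut.conjNormal (surfaceWord a b * (surfaceWord a b)⁻¹) n) * C.val =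
      C.val * ρ n at h4
    rw [mul_inv_cancel, map_one, MulAut.one_apply] at h4
    exact h4
  -- A product of commutators has determinant `1` and `ρ` has finite order on `N`, so a power of the
  -- determinant of `C`, and hence of `c`, is `1`.
  have hnorm : ‖c‖ = 1 := by
    have hdet : (Units.map (Matrix.detMonoidHom (n := Fin (m i)) (R := ℂ)) C) ^ Fintype.card N =
        1 := by
      rw [hC, map_mul, map_inv, hZ₀, map_surfaceWord, surfaceWord_eq_one_of_comm, inv_one, mul_one,
        ← map_pow, ← map_pow, pow_card_eq_one, map_one, map_one]
    have h1 := congrArg Units.val hdet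
    rw [Units.val_pow_eq_pow_val, Units.coe_map] at h1
    change (Matrix.det C.val) ^ _ = 1 at h1
    rw [hc, Matrix.det_smul, Matrix.det_one, mul_one, ← pow_mul] at h1
    exact Complex.norm_eq_one_of_pow_eq_one h1 (mul_ne_zero (by simpa using hm) Fintype.card_ne_zero)
  refine ⟨c, hnorm, ?_⟩
  have h5 : ∀ x, ρ ⟨twistedWord a b x, twistedWord_mem h x⟩ = c • (Z x).val := by
    intro x
    have := congrArg Units.val (hrel x)
    rw [Units.val_mul, hc, smul_mul_assoc, one_mul] at this
    exact this
  rw [Finset.sum_congr rfl fun x _ => h5 x, ← Finset.smul_sum, mul_smul]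
  congr 1
  let F : Fin d → N × N → Matrix (Fin (m i)) (Fin (m i)) ℂ := fun j p =>
    ((A (a j)).val * ρ p.1) * ((A (b j)).val * ρ p.2) *
      (ρ p.1⁻¹ * (A (a j))⁻¹.val) * (ρ p.2⁻¹ * (A (b j))⁻¹.val)
  have h6 : ∀ x, (Z x).val = (List.ofFn fun j => F j (x j)).prod := by
    intro x
    rw [hZ]
    simp only [surfaceWord]
    rw [← Units.coeHom_apply, map_list_prod, List.map_ofFn]
    congr 2
  rw [Finset.sum_congr rfl fun x _ => h6 x, sum_prod_ofFn]
  have h7 : ∀ j, ∑ p, F j p = ((Fintype.card N : ℂ) / m i) ^ 2 • 1 := fun j =>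
    sum_commutator_blockRep e i _ _
  simp only [h7]
  rw [List.ofFn_const, List.prod_replicate, smul_pow, one_pow]

end Counting

/-! ### The lower bound for the number of solutions -/

noncomputable section CountBound

open scoped commutatorElement

/-- The blocks of the group algebra on which a normal subgroup acts trivially account for the
dimension of the group algebra of the quotient. -/
theorem sum_block_sq_of_trivial {N : Type*} [Group N] [Fintype N] {ι : Type*} [Fintype ι]
    {m : ι → ℕ} (e : MonoidAlgebra ℂ N ≃ₐ[ℂ] Π i, Matrix (Fin (m i)) (Fin (m i)) ℂ)
    (K : Subgroup N) [K.Normal] (p : ι → Prop) [DecidablePred p]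
    (hp : ∀ i, p i ↔ ∀ k ∈ K, blockRep e i k = 1) :
    ∑ i with p i, (m i : ℂ) ^ 2 = Fintype.card N / Nat.card K := by
  classical
  have hKne : (Nat.card K : ℂ) ≠ 0 := by exact_mod_cast Nat.card_pos.ne'
  set s : MonoidAlgebra ℂ N := ∑ k : K, MonoidAlgebra.of ℂ N k with hs
  have hleft : ∀ k : K, MonoidAlgebra.of ℂ N k * s = s := by
    intro k
    rw [hs, Finset.mul_sum]
    refine Fintype.sum_equiv (Equiv.mulLeft k) _ _ fun k' => ?_
    rw [← map_mul]
    rfl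
  set f : MonoidAlgebra ℂ N := (Nat.card K : ℂ)⁻¹ • s with hf
  have hleft' : ∀ k : K, MonoidAlgebra.of ℂ N k * f = f := fun k => by
    rw [hf, mul_smul_comm, hleft]
  have hidem : f * f = f := by
    conv_lhs => rw [hf, smul_mul_assoc, hs, Finset.sum_mul]
    rw [Finset.sum_congr rfl fun k _ => hleft' k, Finset.sum_const, Finset.card_univ, ← Nat.card_eq_fintype_card, ← Nat.cast_smul_eq_nsmul ℂ, smul_smul, inv_mul_cancel₀ hKne,
      one_smul]
  have hcent : ∀ n : N, Commute (MonoidAlgebra.of ℂ N n) f := by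
    intro n
    refine Commute.smul_right ?_ _
    rw [hs, Commute, SemiconjBy, Finset.mul_sum, Finset.sum_mul]
    refine Fintype.sum_equiv (MulAut.conjNormal n).toEquiv _ _ fun k => ?_
    rw [← map_mul, ← map_mul]
    congr 1
    change _ = ((MulAut.conjNormal n k : K) : N) * n
    rw [MulAut.conjNormal_apply, inv_mul_cancel_right]
  have hblock : ∀ i, blockHom e i f = if p i then 1 else 0 := by
    intro i
    split_ifs with hi
    · have h1 : ∀ k : K, blockHom e i (MonoidAlgebra.of ℂ N k) = 1 := fun k => (hp i).1 hi k k.2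
      rw [hf, map_smul, hs, map_sum, Finset.sum_congr rfl fun k _ => h1 k, Finset.sum_const,
        Finset.card_univ, ← Nat.card_eq_fintype_card, ← Nat.cast_smul_eq_nsmul ℂ, smul_smul,
        inv_mul_cancel₀ hKne, one_smul]
    · refine (blockHom_central_idem e i hidem hcent).resolve_right fun h1 => hi ((hp i).2 ?_)
      intro k hk
      have := congrArg (blockHom e i) (hleft' ⟨k, hk⟩)
      rwa [map_mul, h1, mul_one] at this
  have h1 := MonoidAlgebra.card_mul_coeff_one e f
  have h2 : f.coeff 1 = (Nat.card K : ℂ)⁻¹ := by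
    rw [hf, MonoidAlgebra.coeff_smul_apply, hs, MonoidAlgebra.coeff_sum, Finsupp.finsetSum_apply,
      Finset.sum_eq_single 1]
    · simp
    · intro k _ hk
      rw [MonoidAlgebra.of_apply, MonoidAlgebra.coeff_single, Finsupp.single_apply, if_neg]
      simpa using hk
    · simp
  rw [h2] at h1
  rw [div_eq_mul_inv, h1, Finset.sum_filter]
  refine Finset.sum_congr rfl fun i _ => ?_
  rw [← blockHom_apply, hblock]
  split_ifs with hi
  · rw [Matrix.trace_one, Fintype.card_fin, sq]
  · rw [Matrix.trace_zero, mul_zero]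

variable {Γ : Type*} [Group Γ] {N : Subgroup Γ} [N.Normal]

theorem commutator_top_le (N : Subgroup Γ) [N.Normal] : ⁅N, (⊤ : Subgroup Γ)⁆ ≤ N :=
  Subgroup.commutator_le_left N ⊤

/-- Modulo `⁅N, ⊤⁆` the modifications are central and drop out of every commutator. -/
theorem twistedWord_mem_commutator {d : ℕ} {a b : Fin d → Γ}
    (h : surfaceWord a b ∈ ⁅N, (⊤ : Subgroup Γ)⁆) (x : Fin d → N × N) :
    twistedWord a b x ∈ ⁅N, (⊤ : Subgroup Γ)⁆ := by
  set K := ⁅N, (⊤ : Subgroup Γ)⁆ with hK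
  have hcent : ∀ (n : N) (g : Γ), QuotientGroup.mk' K n * QuotientGroup.mk' K g =
      QuotientGroup.mk' K g * QuotientGroup.mk' K n := fun n g => by
    rw [← commutatorElement_eq_one_iff_mul_comm, ← map_commutatorElement]
    exact (QuotientGroup.eq_one_iff _).2 (Subgroup.commutator_mem_commutator n.2 trivial)
  rw [← QuotientGroup.eq_one_iff] at h ⊢
  rw [← h]
  change QuotientGroup.mk' K _ = QuotientGroup.mk' K _
  rw [twistedWord, map_surfaceWord, map_surfaceWord, surfaceWord, surfaceWord]
  congr 2
  funext j
  simp only [map_mul, commutatorElement_def, mul_inv_rev]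
  set s := QuotientGroup.mk' K (a j)
  set t := QuotientGroup.mk' K (b j)
  have h1 : ∀ g, Commute (QuotientGroup.mk' K ((x j).1 : Γ)) g := fun g => by
    obtain ⟨g, rfl⟩ := QuotientGroup.mk'_surjective K g
    exact hcent _ _
  have h2 : ∀ g, Commute (QuotientGroup.mk' K ((x j).2 : Γ)) g := fun g => by
    obtain ⟨g, rfl⟩ := QuotientGroup.mk'_surjective K g
    exact hcent _ _
  set u := QuotientGroup.mk' K ((x j).1 : Γ)
  set v := QuotientGroup.mk' K ((x j).2 : Γ)
  calc s * u * (t * v) * (u⁻¹ * s⁻¹) * (v⁻¹ * t⁻¹)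
      = s * (u * (t * v)) * u⁻¹ * s⁻¹ * v⁻¹ * t⁻¹ := by simp only [mul_assoc]
    _ = s * t * (v * s⁻¹) * v⁻¹ * t⁻¹ := by
        rw [(h1 (t * v)).eq]; simp only [mul_assoc, mul_inv_cancel_left]
    _ = s * t * s⁻¹ * t⁻¹ := by
        rw [(h2 s⁻¹).eq]; simp only [mul_assoc, mul_inv_cancel_left]

/-- A lower bound for the number of solutions of a surface equation in a coset of a finite normal
subgroup. -/
theorem card_twistedWord_eq_one_ge [Finite N] {d : ℕ} {a b : Fin d → Γ}
    (h : surfaceWord a b ∈ ⁅N, (⊤ : Subgroup Γ)⁆)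
    (hgen : Subgroup.closure (Set.range a ∪ Set.range b ∪ N) = ⊤) :
    (Nat.card N : ℝ) ^ (2 * d) * (Nat.card (⁅N, (⊤ : Subgroup Γ)⁆ : Subgroup Γ) : ℝ)⁻¹ *
        (1 - ((Nat.card (⁅N, (⊤ : Subgroup Γ)⁆ : Subgroup Γ) : ℝ) - 1) / 2 ^ (2 * d)) ≤
      (Nat.card {x : Fin d → N × N // twistedWord a b x = 1} : ℝ) := by
  classical
  have := Fintype.ofFinite N
  set K := ⁅N, (⊤ : Subgroup Γ)⁆ with hK
  have hKN : K ≤ N := commutator_top_le N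
  have hN := hKN h
  obtain ⟨r, m, hm, ⟨e⟩⟩ :=
    IsSemisimpleRing.exists_algEquiv_pi_matrix_of_isAlgClosed ℂ (MonoidAlgebra ℂ N)
  have hm' : ∀ i, m i ≠ 0 := fun i => (hm i).out
  set w : (Fin d → N × N) → N := fun x => ⟨twistedWord a b x, twistedWord_mem hN x⟩ with hw
  set p : Fin r → Prop := fun i => ∀ k ∈ K.subgroupOf N, blockRep e i k = 1 with hp
  set C : Fin r → ℂ := fun i => (m i : ℂ) * (∑ x, blockRep e i (w x)).trace with hC
  -- The coefficient of `1` in the sum of all modified words counts the solutions.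
  have hcount : (Fintype.card N : ℂ) * Nat.card {x : Fin d → N × N // twistedWord a b x = 1} =
      ∑ i, C i := by
    have h1 := MonoidAlgebra.card_mul_coeff_one e (∑ x, MonoidAlgebra.of ℂ N (w x))
    rw [MonoidAlgebra.coeff_sum, Finsupp.finsetSum_apply] at h1
    have h2 : ∀ x, (MonoidAlgebra.of ℂ N (w x)).coeff 1 =
        if twistedWord a b x = 1 then 1 else 0 := fun x => by
      rw [MonoidAlgebra.of_apply, MonoidAlgebra.coeff_single, Finsupp.single_apply]
      congr 1
      rw [hw, ← OneMemClass.coe_eq_one]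
    rw [Finset.sum_congr rfl fun x _ => h2 x, Finset.sum_boole, ← Fintype.card_subtype,
      ← Nat.card_eq_fintype_card (α := {x : Fin d → N × N // twistedWord a b x = 1})] at h1
    rw [h1]
    refine Finset.sum_congr rfl fun i _ => ?_
    rw [map_sum, Finset.sum_apply]
    rfl
  set n : ℝ := (Fintype.card N : ℝ) with hn
  have hnpos : 0 < n := by rw [hn]; exact_mod_cast Fintype.card_pos
  have hcardX : (Fintype.card (Fin d → N × N) : ℝ) = n ^ (2 * d) := by
    rw [Fintype.card_fun, Fintype.card_prod, Fintype.card_fin, hn, pow_mul, sq]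
    push_cast
    rfl
  have htriv : ∀ i, p i → (C i).re = (m i : ℝ) ^ 2 * n ^ (2 * d) := by
    intro i hi
    have h1 : ∀ x, blockRep e i (w x) = 1 := fun x =>
      hi _ (Subgroup.mem_subgroupOf.2 (twistedWord_mem_commutator h x))
    have : C i = (((m i : ℝ) ^ 2 * n ^ (2 * d) : ℝ) : ℂ) := by
      rw [← hcardX, hC]
      simp only [h1, Finset.sum_const, Finset.card_univ, Matrix.trace_smul, Matrix.trace_one,
        Fintype.card_fin]
      push_cast
      rw [nsmul_eq_mul]
      ring
    rw [this, Complex.ofReal_re]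
  have hnon : ∀ i, ¬ p i → -((m i : ℝ) ^ 2 * n ^ (2 * d) / 2 ^ (2 * d)) ≤ (C i).re := by
    intro i hi
    have hnonneg : 0 ≤ (m i : ℝ) ^ 2 * n ^ (2 * d) / 2 ^ (2 * d) := by positivity
    by_cases hS : conjStabilizer (MonoidAlgebra.of ℂ Γ) (subgroupAlgebra N (blockIdem e i)) = ⊤
    · have hA := fun g => exists_conj_matrix e i (hm' i) g (hS ▸ trivial)
      obtain ⟨c, hc, hsum⟩ := exists_sum_blockRep_eq e hN i (hm' i) hA
      -- A stable block of size `1` is a character of `N` invariant under conjugation by `Γ`, hence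
      -- trivial on `⁅N, ⊤⁆`. This is the origin of the base `2` in the bound.
      have hm2 : 2 ≤ m i := by
        by_contra hlt
        have hm1 : m i = 1 := by have := hm' i; omega
        have hcomm : ∀ X Y : Matrix (Fin (m i)) (Fin (m i)) ℂ, X * Y = Y * X := by
          have : Subsingleton (Fin (m i)) := by rw [hm1]; infer_instance
          intro X Y
          ext s t
          rw [Subsingleton.elim t s, Matrix.mul_apply, Matrix.mul_apply]
          refine Finset.sum_congr rfl fun u _ => ?_
          rw [Subsingleton.elim u s, mul_comm]
        refine hi fun k hk => ?_
        have hle : K ≤ (blockRep e i).ker.map N.subtype := by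
          rw [hK, Subgroup.commutator_le]
          intro u hu g _
          refine ⟨⟨u, hu⟩ * (MulAut.conjNormal g ⟨u, hu⟩)⁻¹, ?_, ?_⟩
          · rw [SetLike.mem_coe, MonoidHom.mem_ker]
            obtain ⟨A, hA⟩ := hA g
            have h1 := hA ⟨u, hu⟩
            rw [hcomm A.val, mul_assoc, Units.mul_inv, mul_one] at h1
            rw [map_mul, ← h1, ← map_mul, mul_inv_cancel, map_one]
          · simp [commutatorElement_def, mul_assoc]
        obtain ⟨k', hk', hkk⟩ := hle (Subgroup.mem_subgroupOf.1 hk)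
        rw [← Subtype.ext hkk]
        exact hk'
      have hval : ‖C i‖ = (m i : ℝ) ^ 2 * (n / m i) ^ (2 * d) := by
        rw [hC]
        simp only [hw, hsum, Matrix.trace_smul, Matrix.trace_one, Fintype.card_fin, smul_eq_mul,
          norm_mul, hc, one_mul, norm_pow, norm_div, Complex.norm_natCast]
        rw [pow_mul]
        ring
      have hle : ‖C i‖ ≤ (m i : ℝ) ^ 2 * n ^ (2 * d) / 2 ^ (2 * d) := by
        rw [hval, mul_div_assoc, ← div_pow]
        have : (2 : ℝ) ≤ m i := by exact_mod_cast hm2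
        gcongr
      exact (neg_le_neg hle).trans (neg_le_of_abs_le (Complex.abs_re_le_norm _))
    · have : C i = 0 := by
        rw [hC]
        simp only [hw, sum_blockRep_eq_zero e hN hgen i (hm' i) hS, Matrix.trace_zero, mul_zero]
      rw [this]
      simpa using hnonneg
  have hKcard : Nat.card (K.subgroupOf N) = Nat.card K :=
    Nat.card_congr (Subgroup.subgroupOfEquivOfLe hKN).toEquiv
  set k : ℝ := (Nat.card K : ℝ) with hk
  have hKfin : Finite K := Finite.of_injective _ (Subgroup.inclusion_injective hKN)
  have hkpos : 0 < k := by rw [hk]; exact_mod_cast Nat.card_pos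
  have hs1 : ∑ i with p i, (m i : ℝ) ^ 2 = n / k := by
    have := sum_block_sq_of_trivial e (K.subgroupOf N) p fun i => Iff.rfl
    rw [hKcard] at this
    rw [hn, hk]
    apply Complex.ofReal_injective
    push_cast
    exact this
  have hs2 : ∑ i with p i, (m i : ℝ) ^ 2 + ∑ i with ¬ p i, (m i : ℝ) ^ 2 = n := by
    rw [Finset.sum_filter_add_sum_filter_not]
    rw [hn]
    exact_mod_cast sum_block_sq e
  have hre := congrArg Complex.re hcount
  rw [← Nat.cast_mul, Complex.natCast_re, Complex.re_sum,
    ← Finset.sum_filter_add_sum_filter_not _ p, Nat.cast_mul] at hre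
  have hb1 : ∑ i with p i, (C i).re = n / k * n ^ (2 * d) := by
    rw [← hs1, Finset.sum_mul]
    exact Finset.sum_congr rfl fun i hi => htriv i (Finset.mem_filter.1 hi).2
  have hb2 : -((n - n / k) * n ^ (2 * d) / 2 ^ (2 * d)) ≤ ∑ i with ¬ p i, (C i).re := by
    have : n - n / k = ∑ i with ¬ p i, (m i : ℝ) ^ 2 := by rw [← hs1]; linarith
    rw [this, Finset.sum_mul, Finset.sum_div, ← Finset.sum_neg_distrib]
    exact Finset.sum_le_sum fun i hi => hnon i (Finset.mem_filter.1 hi).2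
  rw [Nat.card_eq_fintype_card (α := N)]
  refine le_of_mul_le_mul_left ?_ hnpos
  change _ ≤ (Fintype.card N : ℝ) * _
  rw [hre, hb1]
  -- Uses `n - n / k = (n / k) (k - 1)`, the total of the `m i ^ 2` over the nontrivial blocks.
  refine le_trans (le_of_eq ?_) (add_le_add_right hb2 _)
  field_simp
  ring

end CountBound

/-! ### The homological obstruction as a surface word -/

noncomputable section Obstruction

open groupHomology
open scoped commutatorElement

/-- The trivial integral representation in the universe of the group. -/
abbrev trivialRep (P : Type u) [Group P] : Rep (ULift.{u} ℤ) P :=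
  Rep.trivial (ULift.{u} ℤ) P (ULift.{u} ℤ)

variable {P : Type u} [Group P]

section CochainSum

variable {A : Type*} [AddCommGroup A]

/-- The evaluation of an inhomogeneous cochain on inhomogeneous chains. -/
def cochainSum {X : Type u} (f : X → A) : (X →₀ trivialRep P) →+ A :=
  Finsupp.liftAddHom fun p =>
    ((zmultiplesHom A (f p)).comp (AddEquiv.ulift (α := ℤ)).toAddMonoidHom :
      ULift.{u} ℤ →+ A)

theorem cochainSum_single {X : Type u} (f : X → A) (p : X) (n : ULift.{u} ℤ) :
    cochainSum (P := P) f (Finsupp.single p n) = n.down • f p := by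
  exact Finsupp.liftAddHom_apply_single _ _ _

theorem cochainSum_boundary {f : P × P → A}
    (hf : ∀ x y z, f (y, z) - f (x * y, z) + f (x, y * z) - f (x, y) = 0)
    {c : P × P →₀ trivialRep P} (hc : c ∈ boundaries₂ (trivialRep P)) :
    cochainSum (P := P) f c = 0 := by
  obtain ⟨b, rfl⟩ := hc
  induction b using Finsupp.induction_linear with
  | zero => rw [map_zero, map_zero]
  | add b b' h h' => rw [map_add, map_add, h, h', add_zero]
  | single x n =>
    change cochainSum f (d₃₂ (trivialRep P) (Finsupp.single x n)) = 0
    rw [d₃₂_single, map_sub, map_add, map_sub]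
    erw [cochainSum_single, cochainSum_single, cochainSum_single, cochainSum_single]
    change n.down • _ - n.down • _ + n.down • _ - n.down • _ = _
    rw [← smul_sub, ← smul_add, ← smul_sub, hf, smul_zero]

/-- Evaluating the coboundary of `t` on a chain amounts to evaluating `t` on the boundary of the
chain. -/
theorem cochainSum_coboundary {t : P → A} {c : P × P →₀ trivialRep P}
    (hc : c ∈ cycles₂ (trivialRep P)) :
    cochainSum (P := P) (fun p : P × P => t p.2 - t (p.1 * p.2) + t p.1) c = 0 := by
  have key : ∀ c : P × P →₀ trivialRep P,
      cochainSum (P := P) (fun p : P × P => t p.2 - t (p.1 * p.2) + t p.1) c =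
        cochainSum (P := P) t (d₂₁ (trivialRep P) c) := by
    intro c
    induction c using Finsupp.induction_linear with
    | zero => rw [map_zero, map_zero, map_zero]
    | add b b' h h' => rw [map_add, map_add, map_add, h, h']
    | single x n =>
      rw [d₂₁_single, map_add, map_sub]
      erw [cochainSum_single, cochainSum_single, cochainSum_single, cochainSum_single]
      change _ = n.down • _ - n.down • _ + n.down • _
      rw [← smul_sub, ← smul_add]
  rw [key]
  have : d₂₁ (trivialRep P) c = 0 := hc
  rw [this, map_zero]

theorem cochainSum_map {G : Type u} [Group G] (g : P →* G) (f : G × G → A)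
    (c : P × P →₀ trivialRep P) :
    cochainSum (P := G) f (chainsMap₂ (A := trivialRep P) (B := trivialRep G) g
      (CategoryTheory.CategoryStruct.id (trivialRep P)) c) =
      cochainSum (P := P) (fun p : P × P => f (g p.1, g p.2)) c := by
  induction c using Finsupp.induction_linear with
  | zero => rw [map_zero, map_zero, map_zero]
  | add b b' h h' => rw [map_add, map_add, map_add, h, h']
  | single x n =>
    rw [cochainSum_single]
    refine Eq.trans (congrArg (cochainSum (P := G) f) ?_)
      (cochainSum_single (P := G) f (g x.1, g x.2) n)
    change Finsupp.mapRange (fun n : ULift.{u} ℤ => n) rfl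
      (Finsupp.mapDomain (Prod.map g g) (Finsupp.single x n)) = _
    rw [Finsupp.mapDomain_single, Finsupp.mapRange_single]
    rfl

end CochainSum

section Defect

instance centerCommGroup (Q : Type*) [Group Q] : CommGroup (Subgroup.center Q) where
  mul_comm x y := Subtype.ext (Subgroup.mem_center_iff.1 y.2 x)

variable {Q : Type*} [Group Q]

/-- The failure of multiplicativity of a map that is multiplicative modulo the centre. -/
def defect (s : P → Q) (hs : ∀ x y, s x * s y * (s (x * y))⁻¹ ∈ Subgroup.center Q) (p : P × P) :
    Additive (Subgroup.center Q) :=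
  .ofMul ⟨_, hs p.1 p.2⟩

theorem coe_defect (s : P → Q) (hs : ∀ x y, s x * s y * (s (x * y))⁻¹ ∈ Subgroup.center Q)
    (p : P × P) : ((defect s hs p).toMul : Q) = s p.1 * s p.2 * (s (p.1 * p.2))⁻¹ := rfl

theorem mul_eq_defect_mul (s : P → Q)
    (hs : ∀ x y, s x * s y * (s (x * y))⁻¹ ∈ Subgroup.center Q) (x y : P) :
    s x * s y = (defect s hs (x, y)).toMul * s (x * y) := by
  rw [coe_defect, inv_mul_cancel_right]

theorem coe_center_comm (z : Subgroup.center Q) (x : Q) : x * z = z * x :=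
  Subgroup.mem_center_iff.1 z.2 x

theorem coe_center_left_comm (z : Subgroup.center Q) (x y : Q) : x * (z * y) = z * (x * y) := by
  rw [← mul_assoc, coe_center_comm, mul_assoc]

/-- Both bracketings of `s x * s y * s z` are reduced to a central factor times `s (x * y * z)`. -/
theorem defect_cocycle (s : P → Q)
    (hs : ∀ x y, s x * s y * (s (x * y))⁻¹ ∈ Subgroup.center Q) (x y z : P) :
    defect s hs (y, z) - defect s hs (x * y, z) + defect s hs (x, y * z) - defect s hs (x, y) =
      0 := by
  have h : defect s hs (x, y) + defect s hs (x * y, z) =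
      defect s hs (y, z) + defect s hs (x, y * z) := by
    apply Additive.toMul.injective
    apply Subtype.ext
    apply mul_right_cancel (b := s (x * y * z))
    rw [toMul_add, toMul_add, Subgroup.coe_mul, Subgroup.coe_mul]
    calc _ = (s x * s y) * s z := by
          rw [mul_eq_defect_mul s hs x y, mul_assoc, mul_assoc _ (s (x * y)),
            mul_eq_defect_mul s hs (x * y) z]
      _ = s x * (s y * s z) := mul_assoc _ _ _
      _ = _ := by
          rw [mul_eq_defect_mul s hs y z, coe_center_left_comm, mul_eq_defect_mul s hs x (y * z),
            mul_assoc, mul_assoc x]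
  rw [sub_add_eq_add_sub, ← h]
  abel

/-- A `2`-chain of commutators whose boundary is the value of a surface word. -/
theorem exists_surface_chain {d : ℕ} (a b : Fin d → P) :
    ∃ c : P × P →₀ trivialRep P,
      d₂₁ (trivialRep P) c = Finsupp.single (surfaceWord a b) (1 : ULift.{u} ℤ) ∧
      ∀ {Q : Type u} [Group Q] (s : P → Q)
        (hs : ∀ x y, s x * s y * (s (x * y))⁻¹ ∈ Subgroup.center Q),
        s (surfaceWord a b) = ((cochainSum (P := P) (defect s hs) c).toMul : Q) *
          surfaceWord (fun j => s (a j)) (fun j => s (b j)) := by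
  have hd : ∀ x y : P, d₂₁ (trivialRep P) (Finsupp.single (x, y) (1 : ULift.{u} ℤ)) =
      Finsupp.single y (1 : ULift.{u} ℤ) - Finsupp.single (x * y) (1 : ULift.{u} ℤ) +
        Finsupp.single x (1 : ULift.{u} ℤ) := fun x y => d₂₁_single _ _
  have he : ∀ {Q : Type u} [Group Q] (s : P → Q)
      (hs : ∀ x y, s x * s y * (s (x * y))⁻¹ ∈ Subgroup.center Q) (x y : P),
      cochainSum (P := P) (defect s hs) (Finsupp.single (x, y) (1 : ULift.{u} ℤ)) =
        defect s hs (x, y) := fun s hs x y => by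
    rw [cochainSum_single, ULift.one_down, one_smul]
  induction d with
  | zero =>
    -- The empty word needs a nonzero chain, since `s 1` need not be `1`: the defect at `(1, 1)` is
    -- `s 1`.
    refine ⟨Finsupp.single (1, 1) (1 : ULift.{u} ℤ), ?_, fun s hs => ?_⟩
    · rw [hd]
      simp [surfaceWord]
    · rw [he, coe_defect]
      simp [surfaceWord]
  | succ d ih =>
    obtain ⟨c, hc, hs⟩ := ih (fun j => a j.succ) (fun j => b j.succ)
    set w := surfaceWord (fun j => a j.succ) (fun j => b j.succ) with hw
    set x := a 0
    set y := b 0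
    have hword : surfaceWord a b = ⁅x, y⁆ * w := by
      rw [hw, surfaceWord, List.ofFn_succ, List.prod_cons]; rfl
    -- As `⁅x, y⁆ * (y * x) = x * y`, the first three terms have boundary `⁅x, y⁆`; the last one
    -- merges `⁅x, y⁆` and `w` into their product.
    refine ⟨Finsupp.single (⁅x, y⁆, y * x) (1 : ULift.{u} ℤ) -
      Finsupp.single (x, y) (1 : ULift.{u} ℤ) + Finsupp.single (y, x) (1 : ULift.{u} ℤ) + c -
      Finsupp.single (⁅x, y⁆, w) (1 : ULift.{u} ℤ), ?_, fun {Q} _ s hs' => ?_⟩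
    · have hxy : ⁅x, y⁆ * (y * x) = x * y := by
        rw [commutatorElement_def]; group
      rw [map_sub, map_add, map_add, map_sub, hc, hd, hd, hd, hd, hword, hxy]
      abel
    · have hword' : surfaceWord (fun j => s (a j)) (fun j => s (b j)) =
          ⁅s x, s y⁆ * surfaceWord (fun j => s (a j.succ)) (fun j => s (b j.succ)) := by
        rw [surfaceWord, List.ofFn_succ, List.prod_cons]; rfl
      have hxy : ⁅x, y⁆ * (y * x) = x * y := by
        rw [commutatorElement_def]; group
      have hsum : cochainSum (P := P) (defect s hs') (Finsupp.single (⁅x, y⁆, y * x) (1 : ULift.{u} ℤ) -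
          Finsupp.single (x, y) (1 : ULift.{u} ℤ) + Finsupp.single (y, x) (1 : ULift.{u} ℤ) + c -
          Finsupp.single (⁅x, y⁆, w) (1 : ULift.{u} ℤ)) = defect s hs' (⁅x, y⁆, y * x) -
            defect s hs' (x, y) + defect s hs' (y, x) + cochainSum (P := P) (defect s hs') c -
            defect s hs' (⁅x, y⁆, w) := by
        rw [map_sub, map_add, map_add, map_sub, he, he, he, he]
      rw [hsum, hword, hword']
      have h1 := mul_eq_defect_mul s hs' ⁅x, y⁆ w
      have h2 := mul_eq_defect_mul s hs' ⁅x, y⁆ (y * x)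
      have h3 := mul_eq_defect_mul s hs' x y
      have h4 := mul_eq_defect_mul s hs' y x
      have h5 := hs s hs'
      rw [hxy] at h2
      simp only [toMul_sub, toMul_add, Subgroup.coe_mul, div_eq_mul_inv]
      set f1 := (defect s hs' (⁅x, y⁆, w)).toMul
      set f2 := (defect s hs' (⁅x, y⁆, y * x)).toMul
      set f3 := (defect s hs' (x, y)).toMul
      set f4 := (defect s hs' (y, x)).toMul
      set f5 := (cochainSum (P := P) (defect s hs') c).toMul
      set W := surfaceWord (fun j => s (a j.succ)) (fun j => s (b j.succ))
      have h6 : s ⁅x, y⁆ = f2 * f3⁻¹ * f4 * ⁅s x, s y⁆ := by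
        have e1 : s (x * y) = f3⁻¹ * (s x * s y) := by
          rw [h3]; push_cast; rw [inv_mul_cancel_left]
        have e2 : s (y * x) = f4⁻¹ * (s y * s x) := by
          rw [h4]; push_cast; rw [inv_mul_cancel_left]
        have e3 : s ⁅x, y⁆ = f2 * s (x * y) * (s (y * x))⁻¹ := by
          rw [← h2, mul_inv_cancel_right]
        rw [e3, e1, e2, commutatorElement_def]
        push_cast
        have e4 : (s x * s y) * ((s y * s x)⁻¹ * (f4 : Q)) =
            (f4 : Q) * (s x * s y * (s x)⁻¹ * (s y)⁻¹) := by
          rw [coe_center_comm, coe_center_left_comm]; group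
        rw [mul_inv_rev, inv_inv]
        simp only [mul_assoc] at e4 ⊢
        rw [e4]
      have h7 : s (⁅x, y⁆ * w) = ((f1⁻¹ : Subgroup.center Q) : Q) * (s ⁅x, y⁆ * s w) := by
        push_cast
        rw [h1, inv_mul_cancel_left]
      have e5 := coe_center_left_comm f5 ⁅s x, s y⁆ W
      have e6 := fun z : Q => coe_center_left_comm f1⁻¹ z
      rw [h7, h6, h5]
      simp only [mul_assoc]
      rw [e5]
      simp only [e6]

end Defect

theorem mk_mem_center_of_mem {G' : Type u} [Group G'] {N : Subgroup G'} [N.Normal] {x : G'}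
    (hx : x ∈ N) :
    (QuotientGroup.mk' ⁅N, (⊤ : Subgroup G')⁆ x) ∈ Subgroup.center (G' ⧸ ⁅N, (⊤ : Subgroup G')⁆) := by
  rw [Subgroup.mem_center_iff]
  intro y
  obtain ⟨y, rfl⟩ := QuotientGroup.mk'_surjective _ y
  symm
  rw [← commutatorElement_eq_one_iff_mul_comm, ← map_commutatorElement]
  exact (QuotientGroup.eq_one_iff _).2 (Subgroup.commutator_mem_commutator hx trivial)

/-- If the homological obstruction vanishes, then so does the obstruction to solving the surface
equation modulo commutators with the kernel. -/
theorem surfaceWord_mem_of_obstruction {G G' : Type u} [Group G] [Group G'] (q : G' →* G)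
    (hq : Function.Surjective q) (g : P →* G) {μ : H₂ P} (hμ : IsFundamentalClass μ)
    (hobs : HomologicalObstructionVanishes q g μ) {d : ℕ} {a b : Fin d → P}
    (hab : surfaceWord a b = 1) :
    surfaceWord (fun j => Function.surjInv hq (g (a j))) (fun j => Function.surjInv hq (g (b j))) ∈
      ⁅q.ker, (⊤ : Subgroup G')⁆ := by
  set K := ⁅q.ker, (⊤ : Subgroup G')⁆
  have hinv : ∀ x, q (Function.surjInv hq x) = x := Function.surjInv_eq hq
  -- A set-theoretic section of the central extension `G' ⧸ K → G`; its defect is the extension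
  -- cocycle.
  let s : G → G' ⧸ K := fun x => QuotientGroup.mk' K (Function.surjInv hq x)
  have hs : ∀ x y, s x * s y * (s (x * y))⁻¹ ∈ Subgroup.center (G' ⧸ K) := fun x y => by
    simp only [s, ← map_mul, ← map_inv]
    refine mk_mem_center_of_mem ?_
    simp [MonoidHom.mem_ker, hinv]
  obtain ⟨c₀, hc₀, hword⟩ := exists_surface_chain a b
  have hone : d₂₁ (trivialRep P) (Finsupp.single (1, 1) (1 : ULift.{u} ℤ)) =
      Finsupp.single 1 (1 : ULift.{u} ℤ) := (d₂₁_single _ _).trans (by simp)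
  -- Since the word is `1` in `P`, subtracting the chain `(1, 1)` makes `c₀` a cycle.
  have hcyc : c₀ - Finsupp.single (1, 1) (1 : ULift.{u} ℤ) ∈ cycles₂ (trivialRep P) := by
    change d₂₁ (trivialRep P) (c₀ - Finsupp.single (1, 1) (1 : ULift.{u} ℤ)) = 0
    rw [map_sub, hc₀, hab, hone, sub_self]
  set c : cycles₂ (trivialRep P) := ⟨_, hcyc⟩
  have hμ' : H2π (trivialRep P) c ∈ Submodule.span (ULift.{u} ℤ) {μ} := by
    rw [show Submodule.span (ULift.{u} ℤ) {μ} = ⊤ from hμ]; trivial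
  -- It suffices that the class of this cycle is some multiple of `μ`; it need not be identified
  -- with the generator.
  obtain ⟨r, hr⟩ := Submodule.mem_span_singleton.1 hμ'
  obtain ⟨ν', hν'⟩ : H₂map g (H2π (trivialRep P) c) ∈ LinearMap.range (H₂map q) := by
    rw [← hr, LinearMap.map_smul]
    exact Submodule.smul_mem _ r hobs
  replace hν' := hν'.symm
  revert hν'
  induction ν' using H2_induction_on with
  | h ν' =>
  intro hν'
  have h1 := (H2π_comp_map_apply (A := trivialRep P) (B := trivialRep G) g
    (CategoryTheory.CategoryStruct.id (trivialRep P)) c).symm.trans (hν'.trans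
    (H2π_comp_map_apply (A := trivialRep G') (B := trivialRep G) q
      (CategoryTheory.CategoryStruct.id (trivialRep G')) ν'))
  have h2 := cochainSum_boundary (defect_cocycle s hs) ((H2π_eq_iff _ _).1 h1)
  replace h2 : cochainSum (P := G) (defect s hs)
      (chainsMap₂ (A := trivialRep P) (B := trivialRep G) g
        (CategoryTheory.CategoryStruct.id (trivialRep P)) c.1) = cochainSum (P := G) (defect s hs)
      (chainsMap₂ (A := trivialRep G') (B := trivialRep G) q
        (CategoryTheory.CategoryStruct.id (trivialRep G')) ν'.1) :=
    sub_eq_zero.1 ((map_sub (cochainSum (P := G) (defect s hs)) _ _).symm.trans h2)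
  rw [cochainSum_map, cochainSum_map] at h2
  -- Over `G'` the extension has the quotient homomorphism as a section. The cochain `t`, which
  -- compares it with `s ∘ q`, exhibits the pulled back cocycle as a coboundary.
  have hright : cochainSum (P := G') (fun p : G' × G' => defect s hs (q p.1, q p.2)) ν'.1 = 0 := by
    let t : G' → Additive (Subgroup.center (G' ⧸ K)) := fun x =>
      .ofMul ⟨s (q x) * (QuotientGroup.mk' K x)⁻¹, by
        simp only [s, ← map_mul, ← map_inv]
        refine mk_mem_center_of_mem ?_
        simp [MonoidHom.mem_ker, hinv]⟩
    have ht : ∀ x, s (q x) = (t x).toMul * QuotientGroup.mk' K x := fun x => by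
      simp [t]
    refine Eq.trans ?_ (cochainSum_coboundary (t := t) ν'.2)
    congr 2
    funext p
    have : defect s hs (q p.1, q p.2) + t (p.1 * p.2) = t p.1 + t p.2 := by
      apply Additive.toMul.injective
      apply Subtype.ext
      rw [toMul_add, toMul_add, Subgroup.coe_mul, Subgroup.coe_mul, coe_defect]
      apply mul_right_cancel (b := QuotientGroup.mk' K (p.1 * p.2))
      rw [mul_assoc, ← ht, map_mul, inv_mul_cancel_right, ht, ht, map_mul]
      simp only [mul_assoc]
      rw [coe_center_left_comm]
    rw [eq_sub_of_add_eq this]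
    abel
  rw [hright] at h2
  have hs' : ∀ x y, s (g x) * s (g y) * (s (g (x * y)))⁻¹ ∈ Subgroup.center (G' ⧸ K) :=
    fun x y => by rw [map_mul]; exact hs _ _
  have hfun : (fun p : P × P => defect s hs (g p.1, g p.2)) = defect (fun x => s (g x)) hs' := by
    funext p
    apply Additive.toMul.injective
    apply Subtype.ext
    rw [coe_defect, coe_defect, map_mul]
  have h3 : cochainSum (P := P) (defect (fun x => s (g x)) hs') c₀ =
      defect (fun x => s (g x)) hs' (1, 1) := by
    rw [hfun] at h2
    have h4 := sub_eq_zero.1 ((map_sub (cochainSum (P := P) (defect (fun x => s (g x)) hs')) c₀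
      (Finsupp.single (1, 1) (1 : ULift.{u} ℤ))).symm.trans h2)
    rw [h4, cochainSum_single, ULift.one_down, one_smul]
  have h5 := hword (fun x => s (g x)) hs'
  -- The central factor is `s (g 1)` and the left side is `s (g 1)` as well, so the word in `G' ⧸ K`
  -- is `1`.
  rw [h3, hab, coe_defect, mul_one, mul_inv_cancel_right] at h5
  have h6 := mul_eq_left.1 h5.symm
  rw [← QuotientGroup.eq_one_iff]
  exact (map_surfaceWord (QuotientGroup.mk' K) _ _).trans h6

end Obstruction

/-! ### Holonomy of paths in simply connected spaces -/

noncomputable section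

open CategoryTheory

instance : ContractibleSpace unitInterval :=
  (convex_Icc (0 : ℝ) 1).contractibleSpace ⟨0, by simp⟩

section Holonomy

variable {X : Type*} [TopologicalSpace X] {x₀ : X}
  (τ : ∀ x : X, FundamentalGroupoid.mk x₀ ⟶ FundamentalGroupoid.mk x)

/-- The unique morphism between two points in the fundamental groupoid of a simply connected
space. -/
def simplyConnectedHom {Y : Type*} [TopologicalSpace Y] [SimplyConnectedSpace Y] (y y' : Y) :
    FundamentalGroupoid.mk y ⟶ FundamentalGroupoid.mk y' :=
  (⟦PathConnectedSpace.somePath y y'⟧ : Path.Homotopic.Quotient y y')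

instance {Y : Type*} [TopologicalSpace Y] [SimplyConnectedSpace Y] (y y' : Y) :
    Subsingleton (FundamentalGroupoid.mk y ⟶ FundamentalGroupoid.mk y') :=
  inferInstanceAs (Subsingleton (Path.Homotopic.Quotient y y'))

/-- The holonomy, in `π₁(X, x₀)`, of the image in `X` of a path from `y'` to `y` in a simply
connected space, closed up by means of the chosen paths `τ`. -/
def hol {Y : Type*} [TopologicalSpace Y] [SimplyConnectedSpace Y] (f : C(Y, X)) (y y' : Y) :
    FundamentalGroup X x₀ :=
  τ (f y') ≫ (FundamentalGroupoid.map f).map (simplyConnectedHom y' y) ≫ Groupoid.inv (τ (f y))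

variable {Y : Type*} [TopologicalSpace Y] [SimplyConnectedSpace Y]
  {Z : Type*} [TopologicalSpace Z] [SimplyConnectedSpace Z]

/-- The arguments of `hol` run from end to start so that holonomies multiply in the written order,
although the product of endomorphisms composes from right to left. -/
theorem hol_mul_hol (f : C(Y, X)) (y y' y'' : Y) :
    hol τ f y y' * hol τ f y' y'' = hol τ f y y'' := by
  have h : simplyConnectedHom y'' y = simplyConnectedHom y'' y' ≫ simplyConnectedHom y' y :=
    Subsingleton.elim _ _
  have h' : (FundamentalGroupoid.map f).map (simplyConnectedHom y'' y) =
      (FundamentalGroupoid.map f).map (simplyConnectedHom y'' y') ≫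
        (FundamentalGroupoid.map f).map (simplyConnectedHom y' y) := by
    rw [h, Functor.map_comp]
  have key : ∀ {C : Type _} [Groupoid C] {a b c d : C} (s : a ⟶ b) (t : a ⟶ c) (r : a ⟶ d)
      (u : b ⟶ c) (v : c ⟶ d), (s ≫ u ≫ Groupoid.inv t) ≫ t ≫ v ≫ Groupoid.inv r =
        s ≫ (u ≫ v) ≫ Groupoid.inv r := by
    intros; simp
  rw [End.mul_def]
  refine (key _ _ _ _ _).trans ?_
  exact congrArg (fun m => τ (f y'') ≫ m ≫ Groupoid.inv (τ (f y))) h'.symm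

theorem hol_self (f : C(Y, X)) (y : Y) : hol τ f y y = 1 := by
  exact mul_eq_left.1 (hol_mul_hol τ f y y y)

theorem hol_inv (f : C(Y, X)) (y y' : Y) : (hol τ f y y')⁻¹ = hol τ f y' y := by
  rw [inv_eq_iff_mul_eq_one, hol_mul_hol, hol_self]

/-- In `Y` there is only one class of paths between two points, so it may be taken from `Z`. Writing
one map as a composite in two ways thus gives identities between holonomies. -/
theorem hol_comp (f : C(Y, X)) (g : C(Z, Y)) (z z' : Z) :
    hol τ (f.comp g) z z' = hol τ f (g z) (g z') := by
  unfold hol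
  rw [Subsingleton.elim (simplyConnectedHom (g z') (g z))
    ((FundamentalGroupoid.map g).map (simplyConnectedHom z' z))]
  rfl

theorem hol_const (x : X) (y y' : Y) : hol τ (ContinuousMap.const Y x) y y' = 1 := by
  have : ContinuousMap.const Y x = (ContinuousMap.const PUnit x).comp
    (ContinuousMap.const Y PUnit.unit) := rfl
  rw [this, hol_comp]
  exact hol_self _ _ _

theorem hol_path {x x' : X} (γ : Path x x') :
    hol τ γ.toContinuousMap 1 0 =
      τ (γ 0) ≫ (Path.Homotopic.Quotient.mk (γ.cast γ.source γ.target) :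
        FundamentalGroupoid.mk (γ 0) ⟶ FundamentalGroupoid.mk (γ 1)) ≫ Groupoid.inv (τ (γ 1)) := by
  unfold hol
  rw [Subsingleton.elim (simplyConnectedHom (0 : unitInterval) 1)
    (⟦⟨⟨fun t => t, continuous_id⟩, rfl, rfl⟩⟧ : Path.Homotopic.Quotient (0 : unitInterval) 1)]
  rfl

theorem hol_loop (hτ : τ x₀ = 𝟙 _) (γ : Path x₀ x₀) :
    hol τ γ.toContinuousMap 1 0 = FundamentalGroup.fromPath (.mk γ) := by
  rw [hol_path]
  have key : ∀ x x' (h : x = x₀) (h' : x' = x₀),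
      τ x ≫ (Path.Homotopic.Quotient.mk (γ.cast h h') :
        FundamentalGroupoid.mk x ⟶ FundamentalGroupoid.mk x') ≫ Groupoid.inv (τ x') =
      Path.Homotopic.Quotient.mk γ := by
    rintro _ _ rfl rfl
    rw [hτ]
    simp
  exact key _ _ _ _

end Holonomy

end

/-! ### Generators of the fundamental group of a quotient -/

noncomputable section

open CategoryTheory unitInterval Topology

section Generation

variable {D X : Type*} [TopologicalSpace D] [TopologicalSpace X]

/-- A contraction in `X` of an open subset `U` of `X` to a point, whose tracks lift to `D`. -/
structure LiftableContraction (p : C(D, X)) (U : Set X) where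
  /-- the contraction -/
  F : C(U × I, X)
  /-- the point to which `U` is contracted -/
  m : X
  map_zero : ∀ u, F (u, 0) = u
  map_one : ∀ u, F (u, 1) = m
  lift : ∀ y (hy : p y ∈ U), ∃ κ : C(I, D), κ 0 = y ∧ ∀ s, p (κ s) = F (⟨p y, hy⟩, s)

/-- A contraction of a saturated open subset of `D` that respects the fibres of a quotient map
descends to the image. -/
theorem exists_liftableContraction {p : C(D, X)} (hp : IsQuotientMap p) {U : Set X}
    (hU : IsOpen U) (K : C((p ⁻¹' U) × I, D)) (h0 : ∀ y, K (y, 0) = y)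
    (hK : ∀ y y' : p ⁻¹' U, p y = p y' → ∀ s, p (K (y, s)) = p (K (y', s)))
    (h1 : ∀ y y', p (K (y, 1)) = p (K (y', 1))) [Nonempty X] :
    Nonempty (LiftableContraction p U) := by
  have hq := hp.restrictPreimage_isOpen hU
  -- As a map into the path space, the homotopy descends along the quotient map itself; no product
  -- of a quotient map with `I` is involved.
  let L : C((p ⁻¹' U), C(I, X)) := (p.comp K).curry
  let M : U → C(I, X) := fun u => L (Function.surjInv hq.surjective u)
  have hML : ∀ y, M (U.restrictPreimage p y) = L y := fun y => by
    ext s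
    refine hK _ _ ?_ s
    exact congrArg Subtype.val (Function.surjInv_eq hq.surjective (U.restrictPreimage p y))
  have hM : Continuous M := by
    rw [hq.continuous_iff]
    exact L.continuous.congr fun y => (hML y).symm
  have hMs : ∀ (y) (hy : p y ∈ U) s, M ⟨p y, hy⟩ s = p (K (⟨y, hy⟩, s)) := fun y hy s =>
    congrArg (fun f : C(I, X) => f s) (hML ⟨y, hy⟩)
  obtain ⟨m, hm⟩ : ∃ m, ∀ y, p (K (y, 1)) = m := by
    rcases isEmpty_or_nonempty (p ⁻¹' U) with h | ⟨⟨y⟩⟩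
    · exact ⟨Classical.arbitrary X, fun y => (h.false y).elim⟩
    · exact ⟨p (K (y, 1)), fun y' => h1 _ _⟩
  refine ⟨⟨(ContinuousMap.mk M hM).uncurry, m, ?_, ?_, ?_⟩⟩
  · rintro ⟨u, hu⟩
    obtain ⟨y, rfl⟩ := hp.surjective u
    exact (hMs y hu 0).trans (by rw [h0])
  · rintro ⟨u, hu⟩
    obtain ⟨y, rfl⟩ := hp.surjective u
    exact (hMs y hu 1).trans (hm _)
  · intro y hy
    exact ⟨⟨fun s => K (⟨y, hy⟩, s), by fun_prop⟩, h0 _, fun s => (hMs y hy s).symm⟩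

variable [SimplyConnectedSpace D] {x₀ : X}
  (τ : ∀ x : X, FundamentalGroupoid.mk x₀ ⟶ FundamentalGroupoid.mk x)

/-- The contraction spreads `γ` over a square. The edge opposite to `γ` is constant and the two
remaining edges lift to paths in `D` from `y` and `y'` with end points in one fibre. Going round the
square expresses the holonomy of `γ` by holonomies in `D`, to which `hS` applies. -/
theorem hol_mem_of_liftableContraction {p : C(D, X)} {U : Set X} (c : LiftableContraction p U)
    (v₀ : D) {S : Subgroup (FundamentalGroup X x₀)}
    (hS : ∀ y y', p y = p y' → hol τ p v₀ y * hol τ p y' v₀ ∈ S)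
    (γ : C(I, X)) (hγ : ∀ s, γ s ∈ U) (y y' : D) (hy : p y = γ 0) (hy' : p y' = γ 1) :
    hol τ p v₀ y * hol τ γ 0 1 * hol τ p y' v₀ ∈ S := by
  let G : C(I × I, X) := ⟨fun z => c.F (⟨γ z.1, hγ z.1⟩, z.2), by fun_prop⟩
  have hpU : p y ∈ U := hy ▸ hγ 0
  have hpU' : p y' ∈ U := hy' ▸ hγ 1
  obtain ⟨κ, hκ0, hκ⟩ := c.lift y hpU
  obtain ⟨κ', hκ0', hκ'⟩ := c.lift y' hpU'
  have e1 : hol τ γ 0 1 = hol τ G (0, 0) (1, 0) := by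
    have : γ = G.comp ⟨fun s => (s, 0), by fun_prop⟩ := by
      ext s; exact (c.map_zero ⟨γ s, hγ s⟩).symm
    conv_lhs => rw [this]
    exact hol_comp τ _ _ _ _
  have e2 : hol τ G (0, 1) (1, 1) = 1 := by
    have : G.comp ⟨fun s => (s, 1), by fun_prop⟩ = ContinuousMap.const I c.m := by
      ext s; exact c.map_one _
    have h := hol_comp τ G ⟨fun s : I => (s, (1 : I)), by fun_prop⟩ 0 1
    rw [this, hol_const] at h
    exact h.symm
  have e3 : hol τ G (0, 0) (0, 1) = hol τ p y (κ 1) := by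
    have : G.comp ⟨fun s => (0, s), by fun_prop⟩ = p.comp κ := by
      ext s; refine Eq.trans ?_ (hκ s).symm
      change c.F _ = c.F _
      congr 2
      exact Subtype.ext hy.symm
    have h := hol_comp τ G ⟨fun s : I => ((0 : I), s), by fun_prop⟩ 0 1
    rw [this, hol_comp, hκ0] at h
    exact h.symm
  have e4 : hol τ G (1, 1) (1, 0) = hol τ p (κ' 1) y' := by
    have : G.comp ⟨fun s => (1, s), by fun_prop⟩ = p.comp κ' := by
      ext s; refine Eq.trans ?_ (hκ' s).symm
      change c.F _ = c.F _
      congr 2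
      exact Subtype.ext hy'.symm
    have h := hol_comp τ G ⟨fun s : I => ((1 : I), s), by fun_prop⟩ 1 0
    rw [this, hol_comp, hκ0'] at h
    exact h.symm
  have hend : p (κ 1) = p (κ' 1) := by rw [hκ, hκ', c.map_one, c.map_one]
  rw [e1, ← hol_mul_hol τ G (0, 0) (0, 1), ← hol_mul_hol τ G (0, 1) (1, 1), e2, e3, e4, one_mul]
  convert hS _ _ hend using 1
  rw [← hol_mul_hol τ p v₀ y (κ 1), ← hol_mul_hol τ p (κ' 1) y' v₀]
  simp only [mul_assoc]

/-- If `X` is a quotient of a simply connected space and is covered by open sets that contract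
along tracks that lift, then the fundamental group of `X` is generated by the holonomies between
points with the same image. -/
theorem mem_of_forall_hol_mem {p : C(D, X)} (hp : Function.Surjective p)
    (hcov : ∀ x : X, ∃ U, IsOpen U ∧ x ∈ U ∧ Nonempty (LiftableContraction p U))
    (hτ : τ x₀ = 𝟙 _) {v₀ : D} (hv₀ : p v₀ = x₀) {S : Subgroup (FundamentalGroup X x₀)}
    (hS : ∀ y y', p y = p y' → hol τ p v₀ y * hol τ p y' v₀ ∈ S) (a : FundamentalGroup X x₀) :
    a ∈ S := by
  choose U hUo hxU hUc using hcov
  obtain ⟨γ, rfl⟩ : ∃ γ : Path x₀ x₀, a = FundamentalGroup.fromPath (.mk γ) := by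
    obtain ⟨γ, hγ⟩ := Quotient.exists_rep (s := Path.Homotopic.setoid x₀ x₀) a
    exact ⟨γ, hγ.symm⟩
  rw [← hol_loop τ hτ, ← inv_mem_iff, hol_inv]
  -- Subdivision of the loop into pieces that lie in the contractible sets `U x`.
  obtain ⟨t, ht0, htm, ⟨n, hn⟩, ht⟩ := exists_monotone_Icc_subset_open_cover_unitInterval
    (c := fun x => γ ⁻¹' U x) (fun x => (hUo x).preimage γ.continuous)
    (fun s _ => Set.mem_iUnion.2 ⟨γ s, hxU _⟩)
  have piece : ∀ k y y', p y = γ (t k) → p y' = γ (t (k + 1)) →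
      hol τ p v₀ y * hol τ γ.toContinuousMap (t k) (t (k + 1)) * hol τ p y' v₀ ∈ S := by
    intro k y y' hy hy'
    obtain ⟨x, hx⟩ := ht k
    obtain ⟨c⟩ := hUc x
    let l : C(I, I) := ⟨fun s => ⟨(1 - (s : ℝ)) * t k + (s : ℝ) * t (k + 1), by
      have := (convex_Icc (0 : ℝ) 1) (t k).2 (t (k + 1)).2 (a := 1 - (s : ℝ)) (b := (s : ℝ))
        (by have := s.2.2; linarith) s.2.1 (by ring)
      simpa using this⟩, by fun_prop⟩
    have hl0 : l 0 = t k := by ext; simp [l]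
    have hl1 : l 1 = t (k + 1) := by ext; simp [l]
    have hmono : (t k : ℝ) ≤ t (k + 1) := htm k.le_succ
    have := hol_mem_of_liftableContraction τ c v₀ hS (γ.toContinuousMap.comp l) (fun s => by
      refine hx ⟨?_, ?_⟩
      · change (t k : ℝ) ≤ (1 - (s : ℝ)) * t k + (s : ℝ) * t (k + 1)
        nlinarith [s.2.1]
      · change (1 - (s : ℝ)) * t k + (s : ℝ) * t (k + 1) ≤ (t (k + 1) : ℝ)
        nlinarith [s.2.2]) y y' (by rw [hy]; simp [hl0]) (by rw [hy']; simp [hl1])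
    rwa [hol_comp, hl0, hl1] at this
  have all : ∀ k y y', p y = γ 0 → p y' = γ (t k) →
      hol τ p v₀ y * hol τ γ.toContinuousMap 0 (t k) * hol τ p y' v₀ ∈ S := by
    intro k
    induction k with
    | zero =>
      intro y y' hy hy'
      rw [ht0] at hy' ⊢
      rw [hol_self, mul_one]
      exact hS _ _ (hy.trans hy'.symm)
    | succ k ih =>
      intro y y' hy hy'
      -- Any point over the division point serves: the detours from it to `v₀` and back cancel.
      obtain ⟨z, hz⟩ := hp (γ (t k))
      have := S.mul_mem (ih y z hy hz) (piece k z y' hz hy')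
      convert this using 1
      rw [← hol_mul_hol τ γ.toContinuousMap 0 (t k) (t (k + 1))]
      have h1 : hol τ p z v₀ * hol τ p v₀ z = 1 := by rw [hol_mul_hol, hol_self]
      simp only [mul_assoc]
      rw [← mul_assoc (hol τ p z v₀), h1, one_mul]
  have := all n v₀ v₀ (by simpa using hv₀) (by rw [hn n le_rfl]; simpa using hv₀)
  rwa [hol_self, one_mul, mul_one, hn n le_rfl] at this

end Generation

end

/-! ### The polygon and the contraction of its boundary sectors -/

noncomputable section

open CategoryTheory unitInterval Topology

section Polygon

variable {d : ℕ}

theorem coe_boundaryArc (d k : ℕ) (t : ℝ) : (boundaryArc d k t : ℂ) =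
    Complex.exp (((2 * Real.pi * ((k + t) / (4 * d)) : ℝ) : ℂ) * Complex.I) := by
  rw [boundaryArc, Circle.coe_exp]

@[fun_prop]
theorem continuous_boundaryArc (d k : ℕ) : Continuous (boundaryArc d k) := by
  unfold boundaryArc
  fun_prop

theorem boundaryArc_add_one (d k : ℕ) (t : ℝ) :
    boundaryArc d k (t + 1) = boundaryArc d (k + 1) t := by
  ext
  rw [coe_boundaryArc, coe_boundaryArc]
  push_cast
  ring_nf

theorem boundaryArc_one (d k : ℕ) : boundaryArc d k 1 = boundaryArc d (k + 1) 0 := by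
  simpa using boundaryArc_add_one d k 0

theorem boundaryArc_closed (hd : 1 ≤ d) : boundaryArc d (4 * d) 0 = boundaryArc d 0 0 := by
  have : (d : ℂ) ≠ 0 := Nat.cast_ne_zero.2 (by omega)
  ext
  rw [coe_boundaryArc, coe_boundaryArc]
  push_cast
  rw [show 2 * (Real.pi : ℂ) * ((4 * d + 0) / (4 * d)) * Complex.I = 2 * Real.pi * Complex.I by
    field_simp; ring, Complex.exp_two_pi_mul_I]
  simp

theorem boundaryArc_injective (hd : 1 ≤ d) {k l : ℕ} (hk : k < 4 * d) (hl : l < 4 * d) {t s : ℝ}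
    (ht : t ∈ Set.Ico (0 : ℝ) 1) (hs : s ∈ Set.Ico (0 : ℝ) 1)
    (h : boundaryArc d k t = boundaryArc d l s) : k = l ∧ t = s := by
  have hd' : (0 : ℝ) < 4 * d := by positivity
  have h1 := congrArg Subtype.val h
  rw [coe_boundaryArc, coe_boundaryArc, Complex.exp_eq_exp_iff_exists_int] at h1
  obtain ⟨n, hn⟩ := h1
  have h2 : (k : ℝ) + t = l + s + n * (4 * d) := by
    have hI : (2 * Real.pi * ((k + t) / (4 * d)) : ℝ) =
        (2 * Real.pi * ((l + s) / (4 * d)) : ℝ) + n * (2 * Real.pi) := by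
      refine Complex.ofReal_injective (mul_right_cancel₀ Complex.I_ne_zero (hn.trans ?_))
      push_cast
      ring
    have hpi := Real.pi_ne_zero
    field_simp at hI
    linarith
  have hk' : (k : ℝ) + 1 ≤ 4 * d := by exact_mod_cast hk
  have hl' : (l : ℝ) + 1 ≤ 4 * d := by exact_mod_cast hl
  have hn0 : n = 0 := by
    have a1 : (n : ℝ) < 1 := by
      by_contra hc
      push Not at hc
      nlinarith [ht.1, ht.2, hs.1, hs.2]
    have a2 : (-1 : ℝ) < n := by
      by_contra hc
      push Not at hc
      nlinarith [ht.1, ht.2, hs.1, hs.2]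
    have b1 : n < 1 := by exact_mod_cast a1
    have b2 : -1 < n := by exact_mod_cast a2
    omega
  subst hn0
  have hkl : k = l := by
    have a1 : (k : ℝ) < l + 1 := by push_cast at h2; linarith [ht.1, hs.2]
    have a2 : (l : ℝ) < k + 1 := by push_cast at h2; linarith [hs.1, ht.2]
    have b1 : k < l + 1 := by exact_mod_cast a1
    have b2 : l < k + 1 := by exact_mod_cast a2
    omega
  subst hkl
  refine ⟨rfl, ?_⟩
  push_cast at h2
  linarith

/-- The power map wraps every side once round the circle, with the vertices at `1` and the midpoints
at `-1`. Conditions on `y ^ (4 * d)` therefore treat all sides alike, and reversal of a side becomes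
complex conjugation. -/
theorem boundaryArc_pow (hd : 1 ≤ d) (k : ℕ) (t : ℝ) :
    (boundaryArc d k t : ℂ) ^ (4 * d) = Complex.exp ((2 * Real.pi * t : ℝ) * Complex.I) := by
  have : (d : ℂ) ≠ 0 := Nat.cast_ne_zero.2 (by omega)
  rw [coe_boundaryArc, ← Complex.exp_nat_mul, Complex.exp_eq_exp_iff_exists_int]
  refine ⟨k, ?_⟩
  push_cast
  field_simp
  ring

/-- The sides of the polygon that are the first ones in their pairs. -/
def IsFirstSide (d k : ℕ) : Prop := k < 4 * d ∧ k % 4 < 2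

theorem sideIdentification_iff {y y' : Metric.closedBall (0 : ℂ) 1} :
    SideIdentification d y y' ↔ ∃ k, IsFirstSide d k ∧ ∃ t ∈ Set.Icc (0 : ℝ) 1,
      y = boundaryArc d k t ∧ y' = boundaryArc d (k + 2) (1 - t) := by
  constructor
  · rintro (⟨i, hi, t, ht⟩ | ⟨i, hi, t, ht⟩)
    · exact ⟨4 * i, ⟨by omega, by omega⟩, t, ht, rfl, rfl⟩
    · exact ⟨4 * i + 1, ⟨by omega, by omega⟩, t, ht, rfl, rfl⟩
  · rintro ⟨k, ⟨hk, hk4⟩, t, ht, rfl, rfl⟩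
    obtain ⟨i, rfl | rfl⟩ : ∃ i, k = 4 * i ∨ k = 4 * i + 1 := ⟨k / 4, by omega⟩
    · exact .a i (by omega) t ht
    · exact .b i (by omega) t ht

/-- Contraction of the sector around the radius through an `n`-th root of `ε⁻¹` (`n = 4 d`) onto
the end point of this radius. -/
def sectorContraction (d : ℕ) (ε : ℂ) (y : Metric.closedBall (0 : ℂ) 1) (s : I) :
    Metric.closedBall (0 : ℂ) 1 :=
  -- For `y ≠ 0`, the exponential removes the fraction `s` of the angle to the central radius, and
  -- the last factor changes the norm `r` into `(1 - s) r + s`.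
  ⟨y * Complex.exp ((-(s * (ε * (y : ℂ) ^ (4 * d)).arg / (4 * d)) : ℝ) * Complex.I) *
    ((1 - s + s / ‖(y : ℂ)‖ : ℝ) : ℂ), by
    rw [mem_closedBall_zero_iff, norm_mul, norm_mul, Complex.norm_exp_ofReal_mul_I, mul_one,
      Complex.norm_real, Real.norm_eq_abs, abs_of_nonneg]
    · have hy : ‖(y : ℂ)‖ ≤ 1 := mem_closedBall_zero_iff.1 y.2
      rcases eq_or_ne ‖(y : ℂ)‖ 0 with h | h
      · rw [h]; simp
      · have : ‖(y : ℂ)‖ * (1 - s + s / ‖(y : ℂ)‖) = (1 - s) * ‖(y : ℂ)‖ + s := by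
          field_simp
        rw [this]
        nlinarith [s.2.1, s.2.2]
    · have : 0 ≤ (s : ℝ) / ‖(y : ℂ)‖ := div_nonneg s.2.1 (norm_nonneg _)
      linarith [s.2.2]⟩

/-- The union of the open sectors around the radii through the `n`-th roots of `ε⁻¹`, `n = 4 d`. -/
def sectors (d : ℕ) (ε : ℂ) : Set (Metric.closedBall (0 : ℂ) 1) :=
  {y | ε * (y : ℂ) ^ (4 * d) ∈ Complex.slitPlane}

theorem isOpen_sectors (d : ℕ) (ε : ℂ) : IsOpen (sectors d ε) :=
  Complex.isOpen_slitPlane.preimage (by fun_prop)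

theorem ne_zero_of_mem_sectors (hd : 1 ≤ d) {ε : ℂ} {y : Metric.closedBall (0 : ℂ) 1}
    (hy : y ∈ sectors d ε) : (y : ℂ) ≠ 0 := by
  intro h
  have := Complex.slitPlane_ne_zero hy
  rw [h, zero_pow (by omega), mul_zero] at this
  exact this rfl

theorem sectorContraction_zero (d : ℕ) (ε : ℂ) (y : Metric.closedBall (0 : ℂ) 1) :
    sectorContraction d ε y 0 = y := by
  ext
  simp [sectorContraction]

theorem continuous_sectorContraction (hd : 1 ≤ d) (ε : ℂ) :
    Continuous fun z : sectors d ε × I => sectorContraction d ε z.1 z.2 := by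
  have h1 : Continuous fun z : sectors d ε × I => (ε * ((z.1 : Metric.closedBall (0 : ℂ) 1) : ℂ) ^
      (4 * d)).arg := by
    rw [continuous_iff_continuousAt]
    intro z
    refine (Complex.continuousAt_arg z.1.2).comp (f := fun z : sectors d ε × I =>
      ε * ((z.1 : Metric.closedBall (0 : ℂ) 1) : ℂ) ^ (4 * d)) ?_
    fun_prop
  have h2 : Continuous fun z : sectors d ε × I =>
      (z.2 : ℝ) / ‖((z.1 : Metric.closedBall (0 : ℂ) 1) : ℂ)‖ :=
    (by fun_prop : Continuous fun z : sectors d ε × I => (z.2 : ℝ)).div (by fun_prop)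
      fun z => norm_ne_zero_iff.2 (ne_zero_of_mem_sectors hd z.1.2)
  unfold sectorContraction
  refine Continuous.subtype_mk ?_ _
  fun_prop

/-- At time `1` the argument of `ε * y ^ (4 * d)` has been removed and the norm is `1`. The end
points are thus vertices for `ε = 1` and midpoints of sides for `ε = -1`. -/
theorem sectorContraction_one_pow (hd : 1 ≤ d) {ε : ℂ} (hε : ε = 1 ∨ ε = -1)
    {y : Metric.closedBall (0 : ℂ) 1} (hy : y ∈ sectors d ε) :
    (sectorContraction d ε y 1 : ℂ) ^ (4 * d) = ε := by
  have hy0 := ne_zero_of_mem_sectors hd hy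
  have hd0 : (d : ℂ) ≠ 0 := Nat.cast_ne_zero.2 (by omega)
  have hn : (‖(y : ℂ)‖ : ℂ) ≠ 0 := by simpa using hy0
  have hεn : ‖ε‖ = 1 := by rcases hε with rfl | rfl <;> simp
  have hε2 : ε * ε = 1 := by rcases hε with rfl | rfl <;> simp
  have h := Complex.norm_mul_exp_arg_mul_I (ε * (y : ℂ) ^ (4 * d))
  rw [norm_mul, hεn, one_mul, norm_pow] at h
  set α := (ε * (y : ℂ) ^ (4 * d)).arg with hα
  have h' : (y : ℂ) ^ (4 * d) = ε * ((‖(y : ℂ)‖ ^ (4 * d) : ℝ) * Complex.exp (α * Complex.I)) := by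
    rw [h, ← mul_assoc, hε2, one_mul]
  simp only [sectorContraction, ← hα]
  rw [mul_pow, mul_pow, ← Complex.exp_nat_mul, h', mul_assoc, mul_assoc, mul_assoc]
  conv_rhs => rw [← mul_one ε]
  congr 1
  have e1 : Complex.exp (α * Complex.I) * Complex.exp (((4 * d : ℕ) : ℂ) *
      (((-((1 : I) * α / (4 * d)) : ℝ) : ℂ) * Complex.I)) = 1 := by
    rw [← Complex.exp_add, Complex.exp_eq_one_iff]
    refine ⟨0, ?_⟩
    push_cast
    field_simp
    ring_nf
  rw [← mul_assoc (Complex.exp (α * Complex.I)), e1, one_mul]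
  push_cast
  rw [← mul_pow]
  simp only [sub_self, zero_add]
  rw [mul_one_div_cancel hn, one_pow]

/-- On the boundary the norm stays `1` and the angle moves linearly, so the contraction is affine in
the parameter of the side. -/
theorem sectorContraction_boundaryArc (hd : 1 ≤ d) {ε : ℂ} {k : ℕ} {t t₀ : ℝ}
    (h : (ε * Complex.exp ((2 * Real.pi * t : ℝ) * Complex.I)).arg = 2 * Real.pi * (t - t₀))
    (s : I) : sectorContraction d ε (boundaryArc d k t) s =
      boundaryArc d k ((1 - s) * t + s * t₀) := by
  have hd0 : (d : ℂ) ≠ 0 := Nat.cast_ne_zero.2 (by omega)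
  have hn : ‖(boundaryArc d k t : ℂ)‖ = 1 := by
    rw [coe_boundaryArc, Complex.norm_exp_ofReal_mul_I]
  ext
  simp only [sectorContraction, boundaryArc_pow hd, h, hn]
  rw [coe_boundaryArc, coe_boundaryArc, ← Complex.exp_add]
  rw [show (1 - (s : ℝ) + s / 1) = 1 by ring, Complex.ofReal_one, mul_one]
  congr 1
  push_cast
  field_simp
  ring

/-- The end points of the contraction of the sectors on a side of the polygon. -/
theorem exists_arg_eq {ε : ℂ} (hε : ε = 1 ∨ ε = -1) {t : ℝ} (ht : t ∈ Set.Icc (0 : ℝ) 1)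
    (h : ε * Complex.exp ((2 * Real.pi * t : ℝ) * Complex.I) ∈ Complex.slitPlane) :
    ∃ t₀ : ℝ, (t₀ = 0 ∨ t₀ = 1 / 2 ∨ t₀ = 1) ∧
      (ε * Complex.exp ((2 * Real.pi * t : ℝ) * Complex.I)).arg = 2 * Real.pi * (t - t₀) ∧
      (ε * Complex.exp ((2 * Real.pi * (1 - t) : ℝ) * Complex.I)).arg =
        2 * Real.pi * ((1 - t) - (1 - t₀)) := by
  have hpi := Real.pi_pos
  -- Since `ε` is real, replacing `t` by `1 - t` is complex conjugation; off the cut it changes the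
  -- sign of the argument.
  have hconj : ε * Complex.exp ((2 * Real.pi * (1 - t) : ℝ) * Complex.I) =
      (starRingEnd ℂ) (ε * Complex.exp ((2 * Real.pi * t : ℝ) * Complex.I)) := by
    rw [map_mul, ← Complex.exp_conj, map_mul, Complex.conj_I, Complex.conj_ofReal]
    congr 1
    · rcases hε with rfl | rfl <;> simp
    · rw [Complex.exp_eq_exp_iff_exists_int]
      refine ⟨1, ?_⟩
      push_cast
      ring
  have harg : (ε * Complex.exp ((2 * Real.pi * (1 - t) : ℝ) * Complex.I)).arg =
      -(ε * Complex.exp ((2 * Real.pi * t : ℝ) * Complex.I)).arg := by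
    rw [hconj, Complex.arg_conj, if_neg (Complex.mem_slitPlane_iff_arg.1 h).1]
  have harg' : ∀ θ : ℝ, ε * Complex.exp ((2 * Real.pi * t : ℝ) * Complex.I) =
      Complex.exp (θ * Complex.I) → -Real.pi < θ → θ ≤ Real.pi →
      (ε * Complex.exp ((2 * Real.pi * t : ℝ) * Complex.I)).arg = θ := by
    intro θ hθ h1 h2
    rw [hθ, Complex.arg_exp_mul_I, toIocMod_eq_self]
    exact ⟨h1, by linarith⟩
  suffices ∃ t₀ : ℝ, (t₀ = 0 ∨ t₀ = 1 / 2 ∨ t₀ = 1) ∧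
      (ε * Complex.exp ((2 * Real.pi * t : ℝ) * Complex.I)).arg = 2 * Real.pi * (t - t₀) by
    obtain ⟨t₀, h0, h1⟩ := this
    exact ⟨t₀, h0, h1, by rw [harg, h1]; ring⟩
  rcases hε with rfl | rfl
  · rcases le_or_gt t (1 / 2) with h2 | h2
    · exact ⟨0, by simp, harg' _ (by rw [one_mul]; simp) (by nlinarith [ht.1]) (by nlinarith)⟩
    · refine ⟨1, by simp, harg' _ ?_ (by nlinarith) (by nlinarith [ht.2])⟩
      rw [one_mul, Complex.exp_eq_exp_iff_exists_int]
      exact ⟨1, by push_cast; ring⟩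
  · have ht0 : t ≠ 0 := by
      rintro rfl
      simp [Complex.mem_slitPlane_iff] at h
      norm_num at h
    refine ⟨1 / 2, by simp, harg' _ ?_ ?_ (by nlinarith [ht.2])⟩
    · rw [← Complex.exp_pi_mul_I, ← Complex.exp_add, Complex.exp_eq_exp_iff_exists_int]
      exact ⟨1, by push_cast; ring⟩
    · have : 0 < t := lt_of_le_of_ne ht.1 (Ne.symm ht0)
      nlinarith

theorem conj_mem_slitPlane {z : ℂ} (hz : z ∈ Complex.slitPlane) :
    (starRingEnd ℂ) z ∈ Complex.slitPlane := by
  rw [Complex.mem_slitPlane_iff] at hz ⊢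
  simpa using hz

theorem mem_sectors_boundaryArc (hd : 1 ≤ d) {ε : ℂ} {k : ℕ} {t : ℝ} :
    boundaryArc d k t ∈ sectors d ε ↔
      ε * Complex.exp ((2 * Real.pi * t : ℝ) * Complex.I) ∈ Complex.slitPlane := by
  rw [sectors, Set.mem_ofPred_eq, boundaryArc_pow hd]

theorem mem_sectors_boundaryArc_one_sub (hd : 1 ≤ d) {ε : ℂ} (hε : ε = 1 ∨ ε = -1) {k l : ℕ}
    {t : ℝ} : boundaryArc d k t ∈ sectors d ε ↔ boundaryArc d l (1 - t) ∈ sectors d ε := by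
  rw [mem_sectors_boundaryArc hd, mem_sectors_boundaryArc hd]
  have hconj : ε * Complex.exp ((2 * Real.pi * (1 - t) : ℝ) * Complex.I) =
      (starRingEnd ℂ) (ε * Complex.exp ((2 * Real.pi * t : ℝ) * Complex.I)) := by
    rw [map_mul, ← Complex.exp_conj, map_mul, Complex.conj_I, Complex.conj_ofReal]
    congr 1
    · rcases hε with rfl | rfl <;> simp
    · rw [Complex.exp_eq_exp_iff_exists_int]
      refine ⟨1, ?_⟩
      push_cast
      ring
  rw [hconj]
  exact ⟨conj_mem_slitPlane, fun h => by simpa using conj_mem_slitPlane h⟩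

theorem SideIdentification.mem_sectors_iff (hd : 1 ≤ d) {ε : ℂ} (hε : ε = 1 ∨ ε = -1)
    {y y' : Metric.closedBall (0 : ℂ) 1} (h : SideIdentification d y y') :
    y ∈ sectors d ε ↔ y' ∈ sectors d ε := by
  obtain ⟨k, -, t, -, rfl, rfl⟩ := sideIdentification_iff.1 h
  exact mem_sectors_boundaryArc_one_sub hd hε

/-- The contraction of the sectors is compatible with the side identifications. -/
theorem SideIdentification.sectorContraction (hd : 1 ≤ d) {ε : ℂ} (hε : ε = 1 ∨ ε = -1)
    {y y' : Metric.closedBall (0 : ℂ) 1} (h : SideIdentification d y y') (hy : y ∈ sectors d ε) :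
    ∃ k, IsFirstSide d k ∧ ∃ t ∈ Set.Icc (0 : ℝ) 1, ∃ t₀ : ℝ, (t₀ = 0 ∨ t₀ = 1 / 2 ∨ t₀ = 1) ∧
      y = boundaryArc d k t ∧ y' = boundaryArc d (k + 2) (1 - t) ∧
      ∀ s : I, sectorContraction d ε y s = boundaryArc d k ((1 - s) * t + s * t₀) ∧
      sectorContraction d ε y' s = boundaryArc d (k + 2) (1 - ((1 - s) * t + s * t₀)) ∧
      ((1 - s) * t + s * t₀ : ℝ) ∈ Set.Icc (0 : ℝ) 1 := by
  obtain ⟨k, hk, t, ht, rfl, rfl⟩ := sideIdentification_iff.1 h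
  obtain ⟨t₀, h0, h1, h2⟩ := exists_arg_eq hε ht ((mem_sectors_boundaryArc hd).1 hy)
  refine ⟨k, hk, t, ht, t₀, h0, rfl, rfl, fun s => ⟨sectorContraction_boundaryArc hd h1 s, ?_, ?_⟩⟩
  · rw [sectorContraction_boundaryArc hd h2 s]
    ring_nf
  · have ht0 : t₀ ∈ Set.Icc (0 : ℝ) 1 := by
      rcases h0 with rfl | rfl | rfl <;> norm_num
    exact convex_Icc (0 : ℝ) 1 ht ht0 (by linarith [s.2.2]) s.2.1 (by ring)

end Polygon

end

/-! ### Generation of the fundamental group of the standard surface -/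

noncomputable section

open CategoryTheory unitInterval Topology
open scoped commutatorElement

section StandardSurface

variable {d : ℕ}

/-- The projection of the polygon onto the standard surface. -/
def surfaceProj (d : ℕ) : C(Metric.closedBall (0 : ℂ) 1, StandardSurface d) :=
  ⟨Quot.mk _, continuous_quot_mk⟩

theorem isQuotientMap_surfaceProj (d : ℕ) : IsQuotientMap (surfaceProj d) :=
  isQuotientMap_quot_mk

theorem surfaceProj_eq {y y' : Metric.closedBall (0 : ℂ) 1} (h : SideIdentification d y y') :
    surfaceProj d y = surfaceProj d y' :=
  Quot.sound h

/-- This stands in for a description of the generated equivalence relation: what is needed about it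
is read off from a suitable invariant function `f`. -/
theorem eq_of_surfaceProj_eq {T : Type*} {f : Metric.closedBall (0 : ℂ) 1 → T}
    (hf : ∀ y y', SideIdentification d y y' → f y = f y') {y y' : Metric.closedBall (0 : ℂ) 1}
    (h : surfaceProj d y = surfaceProj d y') : f y = f y' :=
  congrArg (Quot.lift f hf) h

theorem preimage_image_surfaceProj {V : Set (Metric.closedBall (0 : ℂ) 1)}
    (hV : ∀ y y', SideIdentification d y y' → (y ∈ V ↔ y' ∈ V)) :
    surfaceProj d ⁻¹' (surfaceProj d '' V) = V := by
  ext y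
  constructor
  · rintro ⟨y', hy', h⟩
    have := eq_of_surfaceProj_eq (f := fun y => y ∈ V) (fun y y' h => propext (hV y y' h)) h
    exact this ▸ hy'
  · exact fun hy => ⟨y, hy, rfl⟩

theorem isOpen_image_surfaceProj {V : Set (Metric.closedBall (0 : ℂ) 1)} (hVo : IsOpen V)
    (hV : ∀ y y', SideIdentification d y y' → (y ∈ V ↔ y' ∈ V)) :
    IsOpen (surfaceProj d '' V) := by
  rw [← (isQuotientMap_surfaceProj d).isOpen_preimage, preimage_image_surfaceProj hV]
  exact hVo

theorem norm_boundaryArc (d k : ℕ) (t : ℝ) : ‖(boundaryArc d k t : ℂ)‖ = 1 := by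
  rw [coe_boundaryArc, Complex.norm_exp_ofReal_mul_I]

theorem SideIdentification.norm_eq_one {y y' : Metric.closedBall (0 : ℂ) 1}
    (h : SideIdentification d y y') : ‖(y : ℂ)‖ = 1 ∧ ‖(y' : ℂ)‖ = 1 := by
  obtain ⟨k, -, t, -, rfl, rfl⟩ := sideIdentification_iff.1 h
  exact ⟨norm_boundaryArc .., norm_boundaryArc ..⟩

/-- The end map of the contraction is continuous with values in a finite set of roots, all of whose
subsets are closed. Hence `A` may be arbitrary. -/
theorem isOpen_sectors_preimage (hd : 1 ≤ d) {ε : ℂ} (hε : ε = 1 ∨ ε = -1)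
    (A : Set (Metric.closedBall (0 : ℂ) 1)) :
    IsOpen {y | y ∈ sectors d ε ∧ sectorContraction d ε y 1 ∈ A} := by
  let C : Set (Metric.closedBall (0 : ℂ) 1) := {z | (z : ℂ) ^ (4 * d) = ε}
  have hC : C.Finite := by
    refine Set.Finite.of_finite_image (f := Subtype.val) ?_ Subtype.val_injective.injOn
    refine (Polynomial.nthRoots (4 * d) ε).toFinset.finite_toSet.subset ?_
    rintro _ ⟨z, hz, rfl⟩
    rw [Finset.mem_coe, Multiset.mem_toFinset, Polynomial.mem_nthRoots (by omega)]
    exact hz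
  have hc : Continuous fun z : sectors d ε => sectorContraction d ε z 1 :=
    (continuous_sectorContraction hd ε).comp (by fun_prop : Continuous fun z => (z, (1 : I)))
  have hCA : IsOpen ((C \ A)ᶜ) := (hC.subset Set.sdiff_subset).isClosed.isOpen_compl
  have := (isOpen_sectors d ε).isOpenMap_subtype_val _ (hCA.preimage hc)
  convert this using 1
  ext y
  constructor
  · rintro ⟨hy, hyA⟩
    exact ⟨⟨y, hy⟩, fun h => h.2 hyA, rfl⟩
  · rintro ⟨⟨z, hz⟩, h, rfl⟩
    exact ⟨hz, by_contra fun hA => h ⟨sectorContraction_one_pow hd hε hz, hA⟩⟩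

/-- A nonzero number and its negative cannot both lie on the cut. -/
theorem mem_sectors_of_norm_eq_one {y : Metric.closedBall (0 : ℂ) 1} (hy : ‖(y : ℂ)‖ = 1) :
    y ∈ sectors d 1 ∨ y ∈ sectors d (-1) := by
  by_contra! h
  simp only [sectors, Set.mem_ofPred_eq, Complex.mem_slitPlane_iff, one_mul, neg_mul,
    Complex.neg_re, Complex.neg_im] at h
  push Not at h
  have h0 : ((y : ℂ) ^ (4 * d)) = 0 := Complex.ext (by simp; linarith) (by simpa using h.1.2)
  have := congrArg norm h0
  rw [norm_pow, hy] at this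
  simp at this

theorem surfaceProj_sectorContraction (hd : 1 ≤ d) {ε : ℂ} (hε : ε = 1 ∨ ε = -1)
    {y y' : Metric.closedBall (0 : ℂ) 1} (h : surfaceProj d y = surfaceProj d y')
    (hy : y ∈ sectors d ε) (hy' : y' ∈ sectors d ε) (s : I) :
    surfaceProj d (sectorContraction d ε y s) = surfaceProj d (sectorContraction d ε y' s) := by
  classical
  -- Outside the sectors the function is continued by the projection, which makes it invariant on
  -- the whole disc.
  have := eq_of_surfaceProj_eq (d := d) (f := fun y => if y ∈ sectors d ε then
    surfaceProj d (sectorContraction d ε y s) else surfaceProj d y) (fun y y' h => by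
      have h1 := h.mem_sectors_iff hd hε
      by_cases hy : y ∈ sectors d ε
      · rw [if_pos hy, if_pos (h1.1 hy)]
        obtain ⟨k, hk, t, ht, t₀, -, rfl, rfl, hs⟩ := h.sectorContraction hd hε hy
        obtain ⟨h2, h3, h4⟩ := hs s
        rw [h2, h3]
        exact surfaceProj_eq (sideIdentification_iff.2 ⟨k, hk, _, h4, rfl, rfl⟩)
      · rw [if_neg hy, if_neg (fun h => hy (h1.2 h))]
        exact surfaceProj_eq h) h
  simpa [hy, hy'] using this

/-- Side identifications affect only the boundary, so the radial contraction of the open disc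
descends. -/
theorem exists_liftableContraction_ball :
    ∃ U, IsOpen U ∧ (∀ y : Metric.closedBall (0 : ℂ) 1, ‖(y : ℂ)‖ < 1 → surfaceProj d y ∈ U) ∧
      Nonempty (LiftableContraction (surfaceProj d) U) := by
  let V : Set (Metric.closedBall (0 : ℂ) 1) := {y | ‖(y : ℂ)‖ < 1}
  have hVo : IsOpen V := isOpen_lt (by fun_prop) (by fun_prop)
  have hV : ∀ y y', SideIdentification d y y' → (y ∈ V ↔ y' ∈ V) := fun y y' h => by
    simp [V, h.norm_eq_one.1, h.norm_eq_one.2]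
  have hpre := preimage_image_surfaceProj hV
  have hUo := isOpen_image_surfaceProj hVo hV
  have hinj : ∀ y y' : surfaceProj d ⁻¹' (surfaceProj d '' V),
      surfaceProj d y = surfaceProj d y' → y = y' := by
    rintro ⟨y, hy⟩ ⟨y', hy'⟩ h
    rw [hpre] at hy hy'
    refine Subtype.ext ?_
    change ‖(y : ℂ)‖ < 1 at hy
    change ‖(y' : ℂ)‖ < 1 at hy'
    classical
    have := eq_of_surfaceProj_eq (d := d) (f := fun y => if ‖(y : ℂ)‖ < 1 then some y else none)
      (fun y y' h => by simp [h.norm_eq_one.1, h.norm_eq_one.2]) h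
    simpa [hy, hy'] using this
  refine ⟨surfaceProj d '' V, hUo, fun y hy => ⟨y, hy, rfl⟩, ?_⟩
  have : Nonempty (StandardSurface d) := ⟨surfaceProj d ⟨0, by simp⟩⟩
  refine exists_liftableContraction (isQuotientMap_surfaceProj d) hUo
    ⟨fun z => ⟨((1 - (z.2 : ℝ) : ℝ) : ℂ) * ((z.1 : Metric.closedBall (0 : ℂ) 1) : ℂ), ?_⟩, ?_⟩
    ?_ ?_ ?_
  · have h1 := z.2.2.1
    have h2 := z.2.2.2
    have h3 := mem_closedBall_zero_iff.1 z.1.1.2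
    rw [mem_closedBall_zero_iff, norm_mul, Complex.norm_real, Real.norm_of_nonneg (by linarith)]
    exact mul_le_one₀ (by linarith) (norm_nonneg _) h3
  · fun_prop
  · intro y
    ext
    simp
  · intro y y' h s
    rw [hinj y y' h]
  · intro y y'
    simp

/-- The sectors end at several vertices or midpoints. Keeping those whose end point has the same
image as that of `y` gives an open saturated set, contracted to a single point of the surface. -/
theorem exists_liftableContraction_sectors (hd : 1 ≤ d) {ε : ℂ} (hε : ε = 1 ∨ ε = -1)
    {y : Metric.closedBall (0 : ℂ) 1} (hy : y ∈ sectors d ε) :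
    ∃ U, IsOpen U ∧ surfaceProj d y ∈ U ∧
      Nonempty (LiftableContraction (surfaceProj d) U) := by
  let A : Set (Metric.closedBall (0 : ℂ) 1) :=
    {z | surfaceProj d z = surfaceProj d (sectorContraction d ε y 1)}
  let V : Set (Metric.closedBall (0 : ℂ) 1) :=
    {y | y ∈ sectors d ε ∧ sectorContraction d ε y 1 ∈ A}
  have hVo : IsOpen V := isOpen_sectors_preimage hd hε A
  have hV : ∀ y y', SideIdentification d y y' → (y ∈ V ↔ y' ∈ V) := fun y y' h => by
    have h1 := h.mem_sectors_iff hd hε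
    have h2 : y ∈ sectors d ε → surfaceProj d (sectorContraction d ε y 1) =
        surfaceProj d (sectorContraction d ε y' 1) := fun hy =>
      surfaceProj_sectorContraction hd hε (surfaceProj_eq h) hy (h1.1 hy) 1
    constructor
    · rintro ⟨a, b⟩
      exact ⟨h1.1 a, (h2 a).symm.trans b⟩
    · rintro ⟨a, b⟩
      exact ⟨h1.2 a, (h2 (h1.2 a)).trans b⟩
  have hpre := preimage_image_surfaceProj hV
  have hUo := isOpen_image_surfaceProj hVo hV
  have hmem : ∀ z : surfaceProj d ⁻¹' (surfaceProj d '' V), (z : Metric.closedBall (0 : ℂ) 1) ∈ V :=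
    fun z => hpre.subset z.2
  refine ⟨surfaceProj d '' V, hUo, ⟨y, ⟨hy, rfl⟩, rfl⟩, ?_⟩
  have : Nonempty (StandardSurface d) := ⟨surfaceProj d y⟩
  have hc : Continuous fun z : (surfaceProj d ⁻¹' (surfaceProj d '' V)) × I =>
      ((⟨z.1, (hmem z.1).1⟩ : sectors d ε), z.2) := by fun_prop
  refine exists_liftableContraction (isQuotientMap_surfaceProj d) hUo
    ⟨fun z => sectorContraction d ε z.1 z.2, (continuous_sectorContraction hd ε).comp hc⟩
    ?_ ?_ ?_
  · exact fun z => sectorContraction_zero d ε z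
  · exact fun z z' h s => surfaceProj_sectorContraction hd hε h (hmem z).1 (hmem z').1 s
  · exact fun z z' => (hmem z).2.trans (hmem z').2.symm

theorem exists_liftableContraction_surfaceProj (hd : 1 ≤ d) (x : StandardSurface d) :
    ∃ U, IsOpen U ∧ x ∈ U ∧ Nonempty (LiftableContraction (surfaceProj d) U) := by
  obtain ⟨y, rfl⟩ := (isQuotientMap_surfaceProj d).surjective x
  rcases lt_or_eq_of_le (mem_closedBall_zero_iff.1 y.2) with h | h
  · obtain ⟨U, hU, hy, hc⟩ := exists_liftableContraction_ball (d := d)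
    exact ⟨U, hU, hy y h, hc⟩
  · rcases mem_sectors_of_norm_eq_one (d := d) h with h | h
    · exact exists_liftableContraction_sectors hd (.inl rfl) h
    · exact exists_liftableContraction_sectors hd (.inr rfl) h

instance : ContractibleSpace (Metric.closedBall (0 : ℂ) 1) :=
  (convex_closedBall (0 : ℂ) 1).contractibleSpace ⟨0, by simp⟩

section Generators

variable {x₀ : StandardSurface d}
  (τ : ∀ x : StandardSurface d, FundamentalGroupoid.mk x₀ ⟶ FundamentalGroupoid.mk x)

/-- The element of the fundamental group represented by the `k`-th side of the polygon, traversed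
backwards. -/
def sideElement (k : ℕ) : FundamentalGroup (StandardSurface d) x₀ :=
  hol τ (surfaceProj d) (boundaryArc d k 0) (boundaryArc d (k + 1) 0)

/-- The side and its partner, reversed, project to the same path in the surface. -/
theorem hol_boundaryArc {k : ℕ} (hk : IsFirstSide d k) (s t : I) :
    hol τ (surfaceProj d) (boundaryArc d k s) (boundaryArc d k t) =
      hol τ (surfaceProj d) (boundaryArc d (k + 2) (1 - s)) (boundaryArc d (k + 2) (1 - t)) := by
  let e : C(I, Metric.closedBall (0 : ℂ) 1) := ⟨fun s => boundaryArc d k s, by fun_prop⟩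
  let e' : C(I, Metric.closedBall (0 : ℂ) 1) := ⟨fun s => boundaryArc d (k + 2) (1 - s), by fun_prop⟩
  have h : (surfaceProj d).comp e = (surfaceProj d).comp e' := by
    ext s
    exact surfaceProj_eq (sideIdentification_iff.2 ⟨k, hk, s, s.2, rfl, rfl⟩)
  have h1 := hol_comp τ (surfaceProj d) e s t
  have h2 := hol_comp τ (surfaceProj d) e' s t
  rw [h] at h1
  exact h1.symm.trans h2

theorem sideElement_add_two {k : ℕ} (hk : IsFirstSide d k) :
    sideElement τ (k + 2) = (sideElement τ k)⁻¹ := by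
  have h := hol_boundaryArc τ hk 0 1
  simp only [Set.Icc.coe_zero, Set.Icc.coe_one, sub_self, sub_zero, boundaryArc_one] at h
  rw [sideElement, sideElement, h, hol_inv]

/-- Inverses of side elements are the elements of the opposite sides, so each commutator is the
holonomy along four consecutive sides and the product telescopes. -/
theorem prod_commutator_sideElement {m : ℕ} (hm : m ≤ d) :
    (List.ofFn fun i : Fin m =>
      ⁅(sideElement τ (4 * i) : FundamentalGroup (StandardSurface d) x₀),
        sideElement τ (4 * i + 1)⁆).prod =
      hol τ (surfaceProj d) (boundaryArc d 0 0) (boundaryArc d (4 * m) 0) := by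
  induction m with
  | zero => simp [hol_self]
  | succ m ih =>
    rw [List.ofFn_succ', List.prod_concat]
    simp only [Fin.val_castSucc, Fin.val_last]
    rw [ih (by omega), commutatorElement_def, ← sideElement_add_two τ (k := 4 * m) ⟨by omega, by omega⟩,
      ← sideElement_add_two τ (k := 4 * m + 1) ⟨by omega, by omega⟩]
    simp only [sideElement]
    rw [hol_mul_hol, hol_mul_hol, hol_mul_hol, hol_mul_hol]
    rfl

theorem surfaceWord_sideElement (hd : 1 ≤ d) :
    surfaceWord (fun i : Fin d => (sideElement τ (4 * i) : FundamentalGroup (StandardSurface d) x₀))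
      (fun i => sideElement τ (4 * i + 1)) = 1 := by
  rw [surfaceWord, prod_commutator_sideElement τ le_rfl, boundaryArc_closed hd, hol_self]

/-- By `mem_of_forall_hol_mem` only detours through identified points matter. The coset modulo `S`
of the holonomy between a point and the initial vertex is invariant under the side identifications:
the two glued boundary segments cancel, leaving products of side elements. -/
theorem closure_sideElement (hd : 1 ≤ d) (hτ : τ x₀ = 𝟙 _)
    (hx₀ : surfaceProj d (boundaryArc d 0 0) = x₀) :
    Subgroup.closure (Set.range (fun i : Fin d =>
      (sideElement τ (4 * i) : FundamentalGroup (StandardSurface d) x₀)) ∪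
      Set.range (fun i : Fin d => sideElement τ (4 * i + 1))) = ⊤ := by
  set S := Subgroup.closure (Set.range (fun i : Fin d =>
      (sideElement τ (4 * i) : FundamentalGroup (StandardSurface d) x₀)) ∪
      Set.range (fun i : Fin d => sideElement τ (4 * i + 1))) with hS
  have h1 : ∀ k, IsFirstSide d k → sideElement τ k ∈ S := by
    rintro k ⟨hk, hk4⟩
    obtain ⟨i, rfl | rfl⟩ : ∃ i, k = 4 * i ∨ k = 4 * i + 1 := ⟨k / 4, by omega⟩
    · exact Subgroup.subset_closure (.inl ⟨⟨i, by omega⟩, rfl⟩)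
    · exact Subgroup.subset_closure (.inr ⟨⟨i, by omega⟩, rfl⟩)
  have h2 : ∀ k < 4 * d, sideElement τ k ∈ S := by
    intro k hk
    by_cases hk4 : k % 4 < 2
    · exact h1 k ⟨hk, hk4⟩
    · obtain ⟨j, rfl⟩ : ∃ j, k = j + 2 := ⟨k - 2, by omega⟩
      have hj : IsFirstSide d j := ⟨by omega, by omega⟩
      rw [sideElement_add_two τ hj]
      exact S.inv_mem (h1 j hj)
  have h3 : ∀ k ≤ 4 * d,
      hol τ (surfaceProj d) (boundaryArc d 0 0) (boundaryArc d k 0) ∈ S := by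
    intro k
    induction k with
    | zero => intro _; rw [hol_self]; exact S.one_mem
    | succ k ih =>
      intro hk
      rw [← hol_mul_hol τ _ _ (boundaryArc d k 0)]
      exact S.mul_mem (ih (by omega)) (h2 k (by omega))
  rw [eq_top_iff]
  intro a _
  refine mem_of_forall_hol_mem τ (isQuotientMap_surfaceProj d).surjective
    (exists_liftableContraction_surfaceProj hd) hτ hx₀ (fun y y' hyy => ?_) a
  have := eq_of_surfaceProj_eq (d := d) (f := fun y =>
    (QuotientGroup.mk (hol τ (surfaceProj d) y (boundaryArc d 0 0)) :
      FundamentalGroup (StandardSurface d) x₀ ⧸ S)) (fun y y' h => by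
      obtain ⟨k, hk, t, ht, rfl, rfl⟩ := sideIdentification_iff.1 h
      rw [QuotientGroup.eq, hol_inv]
      have h4 := hol_boundaryArc τ hk 0 ⟨t, ht⟩
      simp only [Set.Icc.coe_zero, sub_zero, boundaryArc_one] at h4
      rw [← hol_mul_hol τ _ _ (boundaryArc d k 0), h4, mul_assoc,
        ← hol_mul_hol τ (surfaceProj d) (boundaryArc d (k + 2) (1 - t))
          (boundaryArc d (k + 2 + 1) 0), ← mul_assoc (hol τ (surfaceProj d) _ _) _ (hol _ _ _ _),
        hol_mul_hol τ _ _ (boundaryArc d (k + 2) (1 - t)), hol_self, one_mul]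
      have := hk.1
      have := hk.2
      refine S.mul_mem (h3 k (by omega)) ?_
      rw [← hol_inv]
      exact S.inv_mem (h3 _ (by omega))) hyy
  rwa [QuotientGroup.eq, hol_inv] at this

end Generators

end StandardSurface

end

/-! ### Coverings glued from copies of the polygon -/

noncomputable section

open CategoryTheory unitInterval Topology
open scoped commutatorElement

section Covering

variable {d : ℕ} {H : Type*} [Group H]

/-- The inverses of the partial products of a sequence in a group. -/
def partialWord (E : ℕ → H) : ℕ → H
  | 0 => 1
  | k + 1 => (E k)⁻¹ * partialWord E k

/-- The element by which the fibres over a first side and the opposite side are glued. -/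
def gluingElement (E : ℕ → H) (k : ℕ) : H := (partialWord E k)⁻¹ * partialWord E (k + 3)

/-- The gluing element is made to match vertex `k` with vertex `k + 3`. The relation between
opposite labels ensures that it also matches the other ends, `k + 1` and `k + 2`. -/
theorem partialWord_succ_mul_gluingElement {E : ℕ → H} {k : ℕ} (h : E (k + 2) = (E k)⁻¹) :
    partialWord E (k + 1) * gluingElement E k = partialWord E (k + 2) := by
  simp only [gluingElement, partialWord, h]
  group

/-- The gluing of copies of the polygon, indexed by a group `H`, along their sides. -/
def SideGluing (d : ℕ) (E : ℕ → H) (r r' : Σ _ : H, Metric.closedBall (0 : ℂ) 1) : Prop :=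
  ∃ k, IsFirstSide d k ∧ ∃ t ∈ Set.Icc (0 : ℝ) 1, r.2 = boundaryArc d k t ∧
    r'.2 = boundaryArc d (k + 2) (1 - t) ∧ r'.1 = r.1 * gluingElement E k

/-- The covering of the standard surface obtained by gluing copies of the polygon. -/
def SurfaceCover (d : ℕ) (E : ℕ → H) : Type _ := Quot (SideGluing d E)

variable (E : ℕ → H)

instance : TopologicalSpace (SurfaceCover d E) :=
  inferInstanceAs (TopologicalSpace (Quot (SideGluing d E)))

/-- The point over the point `y` of the polygon in the copy with index `h`. -/
def SurfaceCover.mk (h : H) (y : Metric.closedBall (0 : ℂ) 1) : SurfaceCover d E :=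
  Quot.mk _ ⟨h, y⟩

instance : MulAction H (SurfaceCover d E) where
  smul g := Quot.map (fun r => ⟨g * r.1, r.2⟩) (by
    rintro r r' ⟨k, hk, t, ht, h1, h2, h3⟩
    exact ⟨k, hk, t, ht, h1, h2, by rw [h3, mul_assoc]⟩)
  one_smul := by
    rintro ⟨h, y⟩
    change SurfaceCover.mk E (1 * h) y = SurfaceCover.mk E h y
    rw [one_mul]
  mul_smul := by
    rintro g g' ⟨h, y⟩
    change SurfaceCover.mk E (g * g' * h) y = SurfaceCover.mk E (g * (g' * h)) y
    rw [mul_assoc]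

variable {E}

theorem SurfaceCover.smul_mk (g h : H) (y : Metric.closedBall (0 : ℂ) 1) :
    g • (SurfaceCover.mk E h y : SurfaceCover d E) = SurfaceCover.mk E (g * h) y := rfl

theorem SurfaceCover.mk_boundaryArc {k : ℕ} (hk : IsFirstSide d k) {t : ℝ}
    (ht : t ∈ Set.Icc (0 : ℝ) 1) (h : H) :
    (SurfaceCover.mk E h (boundaryArc d k t) : SurfaceCover d E) =
      SurfaceCover.mk E (h * gluingElement E k) (boundaryArc d (k + 2) (1 - t)) :=
  Quot.sound ⟨k, hk, t, ht, rfl, rfl, rfl⟩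

theorem SurfaceCover.exists_rep (e : SurfaceCover d E) : ∃ h y, SurfaceCover.mk E h y = e := by
  obtain ⟨⟨h, y⟩, rfl⟩ := Quot.exists_rep e
  exact ⟨h, y, rfl⟩

theorem SurfaceCover.continuous_mk (h : H) :
    Continuous fun y => (SurfaceCover.mk E h y : SurfaceCover d E) :=
  continuous_quot_mk.comp continuous_sigmaMk

variable (d E)

/-- The projection of the cover onto the standard surface. -/
def SurfaceCover.proj : SurfaceCover d E → StandardSurface d :=
  Quot.lift (fun r => surfaceProj d r.2) (by
    rintro r r' ⟨k, hk, t, ht, h1, h2, -⟩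
    exact surfaceProj_eq (sideIdentification_iff.2 ⟨k, hk, t, ht, h1, h2⟩))

theorem SurfaceCover.continuous_proj : Continuous (SurfaceCover.proj d E) :=
  continuous_quot_lift _ (continuous_sigma fun _ => (surfaceProj d).continuous)

theorem SurfaceCover.isQuotientMap_proj : IsQuotientMap (SurfaceCover.proj d E) :=
  IsQuotientMap.of_comp (SurfaceCover.continuous_mk 1) (SurfaceCover.continuous_proj d E)
    (isQuotientMap_surfaceProj d)

theorem SurfaceCover.proj_eq_iff {e e' : SurfaceCover d E} :
    SurfaceCover.proj d E e = SurfaceCover.proj d E e' ↔ e ∈ MulAction.orbit H e' := by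
  obtain ⟨h, y, rfl⟩ := e.exists_rep
  obtain ⟨h', y', rfl⟩ := e'.exists_rep
  constructor
  · intro hyy
    have := eq_of_surfaceProj_eq (d := d) (f := fun y =>
      (Quotient.mk (MulAction.orbitRel H (SurfaceCover d E)) (SurfaceCover.mk E 1 y)))
      (fun y y' h => by
        obtain ⟨k, hk, t, ht, rfl, rfl⟩ := sideIdentification_iff.1 h
        refine Quotient.sound ⟨gluingElement E k, ?_⟩
        change SurfaceCover.mk E (gluingElement E k * 1) _ = _
        rw [SurfaceCover.mk_boundaryArc hk ht, one_mul, mul_one]) hyy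
    obtain ⟨g, hg⟩ := Quotient.exact this
    change SurfaceCover.mk E (g * 1) y' = _ at hg
    refine ⟨h * g * h'⁻¹, ?_⟩
    change SurfaceCover.mk E (h * g * h'⁻¹ * h') y' = _
    have h2 := congrArg (fun e => h • e) hg
    simpa [SurfaceCover.smul_mk, mul_assoc] using h2
  · rintro ⟨g, hg⟩
    rw [← hg]
    rfl

variable {d E}

/-- The function `u` describes a section over the image of `V`. On the preimage the quantity `h * (u
y)⁻¹` is compatible with the gluing and locally constant, so its level sets are open; `g` multiplies
it by `g` on the left, so distinct translates are disjoint. -/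
theorem isQuotientCoveringMap_proj
    (hpatch : ∀ y₀ : Metric.closedBall (0 : ℂ) 1, ∃ (V : Set (Metric.closedBall (0 : ℂ) 1))
      (u : Metric.closedBall (0 : ℂ) 1 → H), y₀ ∈ V ∧ (∀ h, IsOpen {y | y ∈ V ∧ u y = h}) ∧
      ∀ k, IsFirstSide d k → ∀ t ∈ Set.Icc (0 : ℝ) 1,
        (boundaryArc d k t ∈ V ↔ boundaryArc d (k + 2) (1 - t) ∈ V) ∧
        (boundaryArc d k t ∈ V →
          u (boundaryArc d (k + 2) (1 - t)) = u (boundaryArc d k t) * gluingElement E k)) :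
    IsQuotientCoveringMap (SurfaceCover.proj d E) H where
  __ := SurfaceCover.isQuotientMap_proj d E
  continuous_const_smul g := by
    refine continuous_quot_lift _ (continuous_sigma fun h => ?_)
    exact SurfaceCover.continuous_mk (g * h)
  apply_eq_iff_mem_orbit := SurfaceCover.proj_eq_iff d E
  disjoint e := by
    obtain ⟨h₀, y₀, rfl⟩ := e.exists_rep
    obtain ⟨V, u, hy₀, hu, hV⟩ := hpatch y₀
    let P : SurfaceCover d E → Prop := Quot.lift
      (fun r => r.2 ∈ V ∧ r.1 * (u r.2)⁻¹ = h₀ * (u y₀)⁻¹) (by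
        rintro ⟨h, y⟩ ⟨h', y'⟩ ⟨k, hk, t, ht, h1, h2, h3⟩
        dsimp only at h1 h2 h3
        subst h1 h2 h3
        obtain ⟨a, b⟩ := hV k hk t ht
        refine propext ⟨?_, ?_⟩
        · rintro ⟨c, e⟩
          refine ⟨a.1 c, ?_⟩
          simp only [b c] at e ⊢
          rw [← e]
          group
        · rintro ⟨c, e⟩
          refine ⟨a.2 c, ?_⟩
          simp only [b (a.2 c)] at e ⊢
          rw [← e]
          group)
    have hPmk : ∀ h y, P (SurfaceCover.mk E h y) ↔ y ∈ V ∧ h * (u y)⁻¹ = h₀ * (u y₀)⁻¹ :=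
      fun h y => Iff.rfl
    refine ⟨{e | P e}, IsOpen.mem_nhds ?_ ⟨hy₀, rfl⟩, ?_⟩
    · refine isOpen_coinduced.2 (isOpen_sigma_iff.2 fun h => ?_)
      convert hu (u y₀ * h₀⁻¹ * h) using 1
      ext y
      refine (hPmk h y).trans (and_congr_right fun _ => ?_)
      rw [mul_inv_eq_iff_eq_mul, mul_assoc, mul_assoc, eq_comm, ← eq_inv_mul_iff_mul_eq, inv_mul_eq_iff_eq_mul]
    · rintro g ⟨_, ⟨e, he, rfl⟩, he'⟩
      obtain ⟨h, y, rfl⟩ := e.exists_rep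
      have h1 := ((hPmk h y).1 he).2
      have h2 := ((hPmk (g * h) y).1 he').2
      rw [mul_assoc, h1] at h2
      simpa using h2

end Covering

end

/-! ### Monodromy and the universal property of the surface group -/

noncomputable section

open CategoryTheory unitInterval Topology
open scoped commutatorElement

section Monodromy

variable {d : ℕ} {H : Type*} [Group H] {E : ℕ → H}

/-- The function on the polygon with prescribed values on the half-open sides. -/
def boundaryExtend (d : ℕ) (F : ℕ → ℝ → H) (z : Metric.closedBall (0 : ℂ) 1) : H :=
  open Classical in
  if h : ∃ kt : ℕ × ℝ, kt.1 < 4 * d ∧ kt.2 ∈ Set.Ico (0 : ℝ) 1 ∧ z = boundaryArc d kt.1 kt.2 then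
    F h.choose.1 h.choose.2 else 1

theorem boundaryExtend_boundaryArc (hd : 1 ≤ d) (F : ℕ → ℝ → H) {k : ℕ} (hk : k < 4 * d) {t : ℝ}
    (ht : t ∈ Set.Ico (0 : ℝ) 1) : boundaryExtend d F (boundaryArc d k t) = F k t := by
  have h : ∃ kt : ℕ × ℝ, kt.1 < 4 * d ∧ kt.2 ∈ Set.Ico (0 : ℝ) 1 ∧
    boundaryArc d k t = boundaryArc d kt.1 kt.2 := ⟨(k, t), hk, ht, rfl⟩
  rw [boundaryExtend, dif_pos h]
  obtain ⟨h1, h2, h3⟩ := h.choose_spec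
  obtain ⟨h4, h5⟩ := boundaryArc_injective hd hk h1 ht h2 h3
  rw [← h4, ← h5]

/-- The value at the end points of the radii of a section of the cover near the boundary. -/
def sideSection (E : ℕ → H) (k : ℕ) (t : ℝ) : H :=
  open Classical in
  if t = 0 then partialWord E k else if k % 4 < 2 then 1 else gluingElement E (k - 2)

/-- The surface relation enters at `k = 4 * d`: this vertex is vertex `0`, and the two prescribed
values agree because the full word is `1`. -/
theorem boundaryExtend_sideSection (hd : 1 ≤ d) (hrel : partialWord E (4 * d) = 1) {k : ℕ}
    (hk : k ≤ 4 * d) :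
    boundaryExtend d (sideSection E) (boundaryArc d k 0) = partialWord E k := by
  rcases hk.lt_or_eq with hk | rfl
  · rw [boundaryExtend_boundaryArc hd _ hk (by simp)]
    simp [sideSection]
  · rw [boundaryArc_closed hd, boundaryExtend_boundaryArc hd _ (by omega) (by simp), hrel]
    simp [sideSection, partialWord]

/-- At vertices this is the matching of partial words. At the midpoints, the value on the second
side of a pair was chosen to be the gluing element. -/
theorem boundaryExtend_glue (hd : 1 ≤ d) (hE : ∀ k, IsFirstSide d k → E (k + 2) = (E k)⁻¹)
    (hrel : partialWord E (4 * d) = 1) {k : ℕ} (hk : IsFirstSide d k) {t₀ : ℝ}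
    (ht₀ : t₀ = 0 ∨ t₀ = 1 / 2 ∨ t₀ = 1) :
    boundaryExtend d (sideSection E) (boundaryArc d (k + 2) (1 - t₀)) =
      boundaryExtend d (sideSection E) (boundaryArc d k t₀) * gluingElement E k := by
  have h1 := hk.1
  have h2 := hk.2
  rcases ht₀ with rfl | rfl | rfl
  · rw [sub_zero, boundaryArc_one, boundaryExtend_sideSection hd hrel (by omega),
      boundaryExtend_sideSection hd hrel (by omega), gluingElement, mul_inv_cancel_left]
  · rw [boundaryExtend_boundaryArc hd _ (by omega) (by norm_num),
      boundaryExtend_boundaryArc hd _ (by omega) (by norm_num)]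
    have h3 : ¬ (k + 2) % 4 < 2 := by omega
    have h4 : (1 : ℝ) - 1 / 2 ≠ 0 := by norm_num
    simp [sideSection, h2, h3]
    norm_num
  · rw [sub_self, boundaryArc_one, boundaryExtend_sideSection hd hrel (by omega),
      boundaryExtend_sideSection hd hrel (by omega), partialWord_succ_mul_gluingElement (hE k hk)]

/-- In the interior a constant section works. Near the boundary the section is prescribed at
vertices and midpoints and extended to the sectors as the value at the end of the contraction. -/
theorem isQuotientCoveringMap_surfaceCover (hd : 1 ≤ d)
    (hE : ∀ k, IsFirstSide d k → E (k + 2) = (E k)⁻¹) (hrel : partialWord E (4 * d) = 1) :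
    IsQuotientCoveringMap (SurfaceCover.proj d E) H := by
  refine isQuotientCoveringMap_proj fun y₀ => ?_
  have hsec : ∀ ε : ℂ, ε = 1 ∨ ε = -1 → y₀ ∈ sectors d ε → ∃ (V : Set (Metric.closedBall (0 : ℂ) 1))
      (u : Metric.closedBall (0 : ℂ) 1 → H), y₀ ∈ V ∧ (∀ h, IsOpen {y | y ∈ V ∧ u y = h}) ∧
      ∀ k, IsFirstSide d k → ∀ t ∈ Set.Icc (0 : ℝ) 1,
        (boundaryArc d k t ∈ V ↔ boundaryArc d (k + 2) (1 - t) ∈ V) ∧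
        (boundaryArc d k t ∈ V →
          u (boundaryArc d (k + 2) (1 - t)) = u (boundaryArc d k t) * gluingElement E k) := by
    intro ε hε hy
    refine ⟨sectors d ε, fun y => boundaryExtend d (sideSection E) (sectorContraction d ε y 1), hy,
      fun h => isOpen_sectors_preimage hd hε {z | boundaryExtend d (sideSection E) z = h}, ?_⟩
    intro k hk t ht
    refine ⟨mem_sectors_boundaryArc_one_sub hd hε, fun hm => ?_⟩
    obtain ⟨t₀, h0, h1, h2⟩ := exists_arg_eq hε ht ((mem_sectors_boundaryArc hd).1 hm)
    dsimp only
    rw [sectorContraction_boundaryArc hd h1, sectorContraction_boundaryArc hd h2]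
    simp only [Set.Icc.coe_one, sub_self, zero_mul, one_mul, zero_add]
    exact boundaryExtend_glue hd hE hrel hk h0
  rcases lt_or_eq_of_le (mem_closedBall_zero_iff.1 y₀.2) with h | h
  · have hVo : IsOpen {y : Metric.closedBall (0 : ℂ) 1 | ‖(y : ℂ)‖ < 1} :=
      isOpen_lt (by fun_prop) (by fun_prop)
    refine ⟨{y | ‖(y : ℂ)‖ < 1}, fun _ => 1, h, fun h => ?_, fun k _ t _ => ?_⟩
    · by_cases h1 : 1 = h
      · convert hVo using 1
        ext y
        simp [h1]
      · simp [h1]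
    · simp [norm_boundaryArc]
  · rcases mem_sectors_of_norm_eq_one (d := d) h with h | h
    · exact hsec 1 (.inl rfl) h
    · exact hsec (-1) (.inr rfl) h

/-- A function on the vertices of the polygon that is compatible with the side identifications
is constant. -/
theorem eq_zero_of_glued {T : Type*} {f : ℕ → T}
    (h : ∀ k, IsFirstSide d k → f k = f (k + 3) ∧ f (k + 1) = f (k + 2)) :
    ∀ k ≤ 4 * d, f k = f 0 := by
  have h4 : ∀ m < d, f (4 * m) = f (4 * m + 1) ∧ f (4 * m) = f (4 * m + 2) ∧
      f (4 * m) = f (4 * m + 3) ∧ f (4 * m) = f (4 * m + 4) := by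
    intro m hm
    have h1 := h (4 * m) ⟨by omega, by omega⟩
    have h2 := h (4 * m + 1) ⟨by omega, by omega⟩
    simp only [add_assoc] at h1 h2
    norm_num at h1 h2
    refine ⟨?_, ?_, h1.1, ?_⟩
    · rw [h1.1, ← h2.2, h1.2]
    · rw [h1.1, ← h2.2]
    · rw [h1.1, ← h2.2, ← h1.2, h2.1]
  have h0 : ∀ m ≤ d, f (4 * m) = f 0 := by
    intro m
    induction m with
    | zero => simp
    | succ m ih => intro hm; rw [← ih (by omega)]; exact (h4 m (by omega)).2.2.2.symm
  intro k hk
  rcases hk.lt_or_eq with hk | rfl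
  · have h5 := h4 (k / 4) (by omega)
    rw [← h0 (k / 4) (by omega)]
    obtain h6 | h6 | h6 | h6 : k = 4 * (k / 4) ∨ k = 4 * (k / 4) + 1 ∨ k = 4 * (k / 4) + 2 ∨
      k = 4 * (k / 4) + 3 := by omega
    · rw [← h6]
    · rw [h5.1, ← h6]
    · rw [h5.2.1, ← h6]
    · rw [h5.2.2.1, ← h6]
  · exact h0 d le_rfl

theorem surfaceProj_vertex {k : ℕ} (hk : k ≤ 4 * d) :
    surfaceProj d (boundaryArc d k 0) = surfaceProj d (boundaryArc d 0 0) := by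
  refine eq_zero_of_glued (f := fun k => surfaceProj d (boundaryArc d k 0)) (fun k hk => ?_) k hk
  have h0 : surfaceProj d (boundaryArc d k 0) = surfaceProj d (boundaryArc d (k + 2) (1 - 0)) :=
    surfaceProj_eq (sideIdentification_iff.2 ⟨k, hk, 0, by simp, rfl, rfl⟩)
  have h1 : surfaceProj d (boundaryArc d k 1) = surfaceProj d (boundaryArc d (k + 2) (1 - 1)) :=
    surfaceProj_eq (sideIdentification_iff.2 ⟨k, hk, 1, by simp, rfl, rfl⟩)
  rw [sub_zero, boundaryArc_one] at h0
  rw [sub_self, boundaryArc_one] at h1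
  exact ⟨h0, h1⟩

theorem SurfaceCover.mk_vertex (hE : ∀ k, IsFirstSide d k → E (k + 2) = (E k)⁻¹) {k : ℕ}
    (hk : k ≤ 4 * d) :
    (SurfaceCover.mk E (partialWord E k) (boundaryArc d k 0) : SurfaceCover d E) =
      SurfaceCover.mk E 1 (boundaryArc d 0 0) := by
  refine eq_zero_of_glued (f := fun k => (SurfaceCover.mk E (partialWord E k) (boundaryArc d k 0) :
    SurfaceCover d E)) (fun k hk => ?_) k hk
  have h0 := SurfaceCover.mk_boundaryArc (E := E) hk (t := 0) (by simp) (partialWord E k)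
  have h1 := SurfaceCover.mk_boundaryArc (E := E) hk (t := 1) (by simp) (partialWord E (k + 1))
  rw [sub_zero, boundaryArc_one, gluingElement, mul_inv_cancel_left] at h0
  rw [sub_self, boundaryArc_one, partialWord_succ_mul_gluingElement (hE k hk)] at h1
  exact ⟨h0, h1⟩

/-- The base point of the standard surface. -/
def surfaceBasePoint (d : ℕ) : StandardSurface d := surfaceProj d (boundaryArc d 0 0)

/-- The loop formed by a side of the polygon. -/
def sideLoop {k : ℕ} (hk : k < 4 * d) : Path (surfaceBasePoint d) (surfaceBasePoint d) where
  toFun t := surfaceProj d (boundaryArc d k t)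
  continuous_toFun := by fun_prop
  source' := surfaceProj_vertex hk.le
  target' := by
    simp only [Set.Icc.coe_one, boundaryArc_one]
    exact surfaceProj_vertex (k := k + 1) hk

theorem sideElement_eq {τ : ∀ x : StandardSurface d,
      FundamentalGroupoid.mk (surfaceBasePoint d) ⟶ FundamentalGroupoid.mk x} (hτ : τ _ = 𝟙 _)
    {k : ℕ} (hk : k < 4 * d) :
    sideElement τ k = (FundamentalGroup.fromPath (.mk (sideLoop hk)))⁻¹ := by
  rw [← hol_loop τ hτ, hol_inv, sideElement]
  have := hol_comp τ (surfaceProj d) (⟨fun s : I => boundaryArc d k s, by fun_prop⟩ : C(I, _)) 0 1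
  simp only [ContinuousMap.coe_mk, Set.Icc.coe_zero, Set.Icc.coe_one, boundaryArc_one] at this
  exact this.symm

/-- Lifted to the copy with index `partialWord E k`, the side `k` leads from the base point `e` to
`E k • e`. Monodromy takes values in the opposite group; inversion turns it into a homomorphism to
`H` and at the same time accounts for side elements being traversed backwards. -/
theorem exists_hom_sideElement (hd : 1 ≤ d) (hE : ∀ k, IsFirstSide d k → E (k + 2) = (E k)⁻¹)
    (hrel : partialWord E (4 * d) = 1) {τ : ∀ x : StandardSurface d,
      FundamentalGroupoid.mk (surfaceBasePoint d) ⟶ FundamentalGroupoid.mk x} (hτ : τ _ = 𝟙 _) :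
    ∃ φ : FundamentalGroup (StandardSurface d) (surfaceBasePoint d) →* H,
      ∀ k < 4 * d, φ (sideElement τ k) = E k := by
  have hp := isQuotientCoveringMap_surfaceCover hd hE hrel
  let e : SurfaceCover.proj d E ⁻¹' {surfaceBasePoint d} :=
    ⟨SurfaceCover.mk E 1 (boundaryArc d 0 0), rfl⟩
  let Φ := hp.fundamentalGroupToMulOpposite e
  have hΦ : ∀ k (hk : k < 4 * d),
      Φ (FundamentalGroup.fromPath (.mk (sideLoop hk))) = MulOpposite.op (E k) := by
    intro k hk
    rw [IsQuotientCoveringMap.fundamentalGroupToMulOpposite_apply_eq_Iff]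
    let Γ : Path (e : SurfaceCover d E) (E k • e) :=
      { toFun := fun t => SurfaceCover.mk E (partialWord E k) (boundaryArc d k t)
        continuous_toFun := (SurfaceCover.continuous_mk _).comp (by fun_prop)
        source' := SurfaceCover.mk_vertex hE hk.le
        target' := by
          simp only [Set.Icc.coe_one, boundaryArc_one, e]
          rw [← SurfaceCover.mk_vertex hE (k := k + 1) hk, SurfaceCover.smul_mk, partialWord,
            mul_inv_cancel_left] }
    have := hp.isCoveringMap.monodromy_eq_of_map_eq
      (γ := .mk (sideLoop hk)) (ex := e) (ey := ⟨E k • e, rfl⟩) (.mk Γ) rfl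
    exact (congrArg Subtype.val this).symm
  refine ⟨(MulEquiv.inv' H).symm.toMonoidHom.comp Φ, fun k hk => ?_⟩
  change (MulOpposite.unop (Φ (sideElement τ k)))⁻¹ = E k
  rw [sideElement_eq hτ hk, map_inv, hΦ k hk]
  simp

end Monodromy

end

/-! ### Presentation and first Betti number of the surface group -/

noncomputable section

open CategoryTheory unitInterval Topology
open scoped commutatorElement

universe v

section Presentation

/-- The group elements attached to the sides of the polygon. -/
def sideLabel {H : Type*} [Group H] (x y : ℕ → H) (k : ℕ) : H :=
  if k % 4 = 0 then x (k / 4) else if k % 4 = 1 then y (k / 4) else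
    if k % 4 = 2 then (x (k / 4))⁻¹ else (y (k / 4))⁻¹

theorem sideLabel_add_two {H : Type*} [Group H] (x y : ℕ → H) {d k : ℕ} (hk : IsFirstSide d k) :
    sideLabel x y (k + 2) = (sideLabel x y k)⁻¹ := by
  have h2 := hk.2
  obtain ⟨i, rfl | rfl⟩ : ∃ i, k = 4 * i ∨ k = 4 * i + 1 := ⟨k / 4, by omega⟩
  · have : (4 * i + 2) / 4 = i := by omega
    simp [sideLabel, this]
  · have : (4 * i + 1) / 4 = i := by omega
    have h : (4 * i + 1 + 2) / 4 = i := by omega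
    have h' : (4 * i + 1 + 2) % 4 = 3 := by omega
    simp [sideLabel, this, h, h']

theorem partialWord_sideLabel {H : Type*} [Group H] (x y : ℕ → H) (m : ℕ) :
    partialWord (sideLabel x y) (4 * m) = (surfaceWord (fun i : Fin m => x i) (fun i => y i))⁻¹ := by
  induction m with
  | zero => simp [surfaceWord, partialWord]
  | succ m ih =>
    rw [surfaceWord] at ih ⊢
    rw [List.ofFn_succ', List.prod_concat, mul_inv_rev]
    simp only [Fin.val_castSucc, Fin.val_last]
    rw [← ih, show 4 * (m + 1) = 4 * m + 1 + 1 + 1 + 1 by ring]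
    have e0 : sideLabel x y (4 * m) = x m := by simp [sideLabel]
    have e1 : sideLabel x y (4 * m + 1) = y m := by
      have : (4 * m + 1) / 4 = m := by omega
      simp [sideLabel, this]
    have e2 : sideLabel x y (4 * m + 1 + 1) = (x m)⁻¹ := by
      have : (4 * m + 1 + 1) / 4 = m := by omega
      have h' : (4 * m + 1 + 1) % 4 = 2 := by omega
      simp [sideLabel, this, h']
    have e3 : sideLabel x y (4 * m + 1 + 1 + 1) = (y m)⁻¹ := by
      have : (4 * m + 1 + 1 + 1) / 4 = m := by omega
      have h' : (4 * m + 1 + 1 + 1) % 4 = 3 := by omega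
      simp [sideLabel, this, h']
    simp only [partialWord, e0, e1, e2, e3, commutatorElement_def]
    group

instance (d : ℕ) : PathConnectedSpace (StandardSurface d) :=
  (isQuotientMap_surfaceProj d).surjective.pathConnectedSpace (surfaceProj d).continuous

/-- The group `P` has generators `a₁, b₁, …, a_d, b_d`, with `[a₁, b₁] ⋯ [a_d, b_d] = 1` as the
only relation, as far as homomorphisms to groups in the universe `v` are concerned. -/
structure IsSurfacePresentation {P : Type*} [Group P] {d : ℕ} (a b : Fin d → P) : Prop where
  closure_eq_top : Subgroup.closure (Set.range a ∪ Set.range b) = ⊤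
  surfaceWord_eq_one : surfaceWord a b = 1
  exists_hom : ∀ (H : Type v) [Group H] (x y : Fin d → H), surfaceWord x y = 1 →
    ∃ φ : P →* H, (∀ j, φ (a j) = x j) ∧ ∀ j, φ (b j) = y j

theorem IsSurfacePresentation.map {P Q : Type*} [Group P] [Group Q] {d : ℕ} {a b : Fin d → P}
    (h : IsSurfacePresentation.{v} a b) (e : P ≃* Q) :
    IsSurfacePresentation.{v} (fun j => e (a j)) (fun j => e (b j)) where
  closure_eq_top := by
    have := congrArg (Subgroup.map e.toMonoidHom) h.closure_eq_top
    rw [MonoidHom.map_closure, Subgroup.map_top_of_surjective _ e.surjective, Set.image_union,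
      ← Set.range_comp, ← Set.range_comp] at this
    exact this
  surfaceWord_eq_one := by
    have := map_surfaceWord e.toMonoidHom a b
    rw [h.surfaceWord_eq_one, map_one] at this
    exact this.symm
  exists_hom H _ x y hxy := by
    obtain ⟨φ, h1, h2⟩ := h.exists_hom H x y hxy
    exact ⟨φ.comp e.symm.toMonoidHom, fun j => by simp [h1], fun j => by simp [h2]⟩

theorem exists_isSurfacePresentation_standardSurface {d : ℕ} (hd : 1 ≤ d) :
    ∃ a b : Fin d → FundamentalGroup (StandardSurface d) (surfaceBasePoint d),
      IsSurfacePresentation.{v} a b := by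
  let δ : ∀ x : StandardSurface d,
      FundamentalGroupoid.mk (surfaceBasePoint d) ⟶ FundamentalGroupoid.mk x := fun x =>
    FundamentalGroupoid.fromPath (.mk (PathConnectedSpace.somePath _ x))
  -- The chosen paths are corrected so that the one to the base point becomes trivial.
  let τ : ∀ x : StandardSurface d,
      FundamentalGroupoid.mk (surfaceBasePoint d) ⟶ FundamentalGroupoid.mk x := fun x =>
    Groupoid.inv (δ _) ≫ δ x
  have hτ : τ (surfaceBasePoint d) = 𝟙 _ := Groupoid.inv_comp _
  refine ⟨fun i => sideElement τ (4 * i), fun i => sideElement τ (4 * i + 1),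
    closure_sideElement τ hd hτ rfl, surfaceWord_sideElement τ hd, fun H _ x y hxy => ?_⟩
  let X : ℕ → H := fun n => if h : n < d then x ⟨n, h⟩ else 1
  let Y : ℕ → H := fun n => if h : n < d then y ⟨n, h⟩ else 1
  have hrel : partialWord (sideLabel X Y) (4 * d) = 1 := by
    rw [partialWord_sideLabel]
    simpa [X, Y] using hxy
  obtain ⟨φ, hφ⟩ := exists_hom_sideElement hd (fun k hk => sideLabel_add_two X Y hk) hrel hτ
  refine ⟨φ, fun j => ?_, fun j => ?_⟩
  · rw [hφ _ (by omega)]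
    simp [sideLabel, X]
  · rw [hφ _ (by omega)]
    have : (4 * (j : ℕ) + 1) / 4 = j := by omega
    simp [sideLabel, Y, this]

/-- The fundamental groups of homeomorphic path connected spaces are isomorphic. -/
def fundamentalGroupEquivOfHomeomorph {X Y : Type*} [TopologicalSpace X] [TopologicalSpace Y]
    [PathConnectedSpace Y] (f : X ≃ₜ Y) (x : X) (y : Y) :
    FundamentalGroup X x ≃* FundamentalGroup Y y :=
  ({ FundamentalGroup.map (f : C(X, Y)) x with
    invFun := FundamentalGroup.mapOfEq (f.symm : C(Y, X)) (f.symm_apply_apply x)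
    left_inv := by
      rintro ⟨p⟩
      rw [FundamentalGroup.mapOfEq_apply]
      refine congrArg Path.Homotopic.Quotient.mk ?_
      ext s
      exact f.symm_apply_apply (p s)
    right_inv := by
      rintro ⟨q⟩
      refine (congrArg (FundamentalGroup.map (f : C(X, Y)) x)
        (FundamentalGroup.mapOfEq_apply (f.symm : C(Y, X)) (f.symm_apply_apply x) _)).trans ?_
      refine congrArg Path.Homotopic.Quotient.mk ?_
      ext s
      exact f.apply_symm_apply (q s) } : FundamentalGroup X x ≃* FundamentalGroup Y (f x)).trans
  (FundamentalGroup.fundamentalGroupMulEquivOfPathConnected _ _)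

theorem exists_isSurfacePresentation {d : ℕ} {W : Type*} [TopologicalSpace W]
    (hW : IsClosedOrientableSurface d W) (w : W) :
    ∃ a b : Fin d → FundamentalGroup W w, IsSurfacePresentation.{v} a b := by
  obtain ⟨hd, ⟨f⟩⟩ := hW
  obtain ⟨a, b, h⟩ := exists_isSurfacePresentation_standardSurface.{v} hd
  exact ⟨_, _, h.map (fundamentalGroupEquivOfHomeomorph f w (surfaceBasePoint d)).symm⟩

/-- The surface word is trivial in every commutative group, so the generators can be sent to a basis
of `ℤ^(2d)`. Their classes are therefore independent, and they span because the generators generate.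
-/
theorem finrank_abelianization {P : Type v} [Group P] {d : ℕ} {a b : Fin d → P}
    (h : IsSurfacePresentation.{v} a b) :
    Module.finrank ℤ (Additive (Abelianization P)) = 2 * d := by
  -- The index type is lifted so that `Multiplicative (ι → ℤ)` lies in the universe for which
  -- `h.exists_hom` is available.
  let ι := ULift.{v} (Fin d ⊕ Fin d)
  let c : ι → Additive (Abelianization P) := fun i =>
    Additive.ofMul (Abelianization.of (Sum.elim a b i.down))
  obtain ⟨φ, hφa, hφb⟩ := h.exists_hom (Multiplicative (ι → ℤ))
    (fun j => Multiplicative.ofAdd (Pi.single ⟨.inl j⟩ 1))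
    (fun j => Multiplicative.ofAdd (Pi.single ⟨.inr j⟩ 1)) (surfaceWord_eq_one_of_comm _ _)
  let f : Additive (Abelianization P) →ₗ[ℤ] (ι → ℤ) :=
    (MonoidHom.toAdditiveLeft (Abelianization.lift φ)).toIntLinearMap
  have hf : f ∘ c = Pi.basisFun ℤ ι := by
    funext i
    obtain ⟨j | j⟩ := i
    · rw [Pi.basisFun_apply]
      exact hφa j
    · rw [Pi.basisFun_apply]
      exact hφb j
  have hli : LinearIndependent ℤ c :=
    LinearIndependent.of_comp f (hf ▸ (Pi.basisFun ℤ ι).linearIndependent)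
  have hspan : ⊤ ≤ Submodule.span ℤ (Set.range c) := by
    let S : Subgroup P := (AddSubgroup.toSubgroup'
      (Submodule.span ℤ (Set.range c)).toAddSubgroup).comap Abelianization.of
    have hS : S = ⊤ := by
      rw [eq_top_iff, ← h.closure_eq_top, Subgroup.closure_le]
      rintro _ (⟨j, rfl⟩ | ⟨j, rfl⟩)
      · exact Submodule.subset_span ⟨⟨.inl j⟩, rfl⟩
      · exact Submodule.subset_span ⟨⟨.inr j⟩, rfl⟩
    rintro x -
    obtain ⟨p, hp⟩ := QuotientGroup.mk_surjective (Additive.toMul x)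
    have : p ∈ S := hS ▸ Subgroup.mem_top p
    change Additive.ofMul (Abelianization.of p) ∈ Submodule.span ℤ (Set.range c) at this
    have e : Additive.ofMul (Abelianization.of p) = x := congrArg Additive.ofMul hp
    rwa [e] at this
  rw [Module.finrank_eq_card_basis (Module.Basis.mk hli hspan)]
  simp [ι]
  ring

end Presentation

end

/-! ### Lifts as solutions of the surface equation -/

noncomputable section

open CategoryTheory
open scoped commutatorElement

section Lifts

theorem H₂map_comp {P G' G : Type u} [Group P] [Group G'] [Group G] (g' : P →* G') (q : G' →* G)
    (μ : H₂ P) : H₂map (q.comp g') μ = H₂map q (H₂map g' μ) := by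
  have h := groupHomology.map_comp (A := Rep.trivial (ULift.{u} ℤ) P (ULift.{u} ℤ))
    (B := Rep.trivial (ULift.{u} ℤ) G' (ULift.{u} ℤ))
    (C := Rep.trivial (ULift.{u} ℤ) G (ULift.{u} ℤ)) g' q
    (CategoryTheory.CategoryStruct.id (Rep.trivial (ULift.{u} ℤ) P (ULift.{u} ℤ)))
    (CategoryTheory.CategoryStruct.id (Rep.trivial (ULift.{u} ℤ) G' (ULift.{u} ℤ))) 2
  exact congrArg (fun f => f.hom μ) h

theorem homologicalObstructionVanishes_of_lift {P G' G : Type u} [Group P] [Group G'] [Group G]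
    {q : G' →* G} {g : P →* G} {g' : P →* G'} (h : q.comp g' = g) (μ : H₂ P) :
    HomologicalObstructionVanishes q g μ :=
  ⟨H₂map g' μ, by rw [← H₂map_comp, h]⟩

variable {P G G' : Type u} [Group P] [Group G] [Group G'] {q : G' →* G} {g : P →* G} {d : ℕ}
  {a b : Fin d → P} {α β : Fin d → G'}

/-- Lifts of a homomorphism from a surface group correspond to solutions of the surface equation in
a coset of the kernel. -/
theorem exists_equiv_lifts (hP : IsSurfacePresentation.{u} a b) (hα : ∀ j, q (α j) = g (a j))
    (hβ : ∀ j, q (β j) = g (b j)) :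
    Nonempty (Lifts q g ≃ {x : Fin d → q.ker × q.ker // twistedWord α β x = 1}) := by
  have hext : ∀ {M : Type u} [Group M] {f f' : P →* M}, (∀ j, f (a j) = f' (a j)) →
      (∀ j, f (b j) = f' (b j)) → f = f' := by
    intro M _ f f' h1 h2
    refine MonoidHom.eq_of_eqOn_dense hP.closure_eq_top ?_
    rintro _ (⟨j, rfl⟩ | ⟨j, rfl⟩)
    · exact h1 j
    · exact h2 j
  have hq : ∀ g' : Lifts q g, ∀ p, q (g'.1 p) = g p := fun g' p =>
    congrArg (fun f : P →* G => f p) g'.2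
  let x : Lifts q g → Fin d → q.ker × q.ker := fun g' j =>
    (⟨(α j)⁻¹ * g'.1 (a j), by rw [MonoidHom.mem_ker, map_mul, map_inv, hα, hq, inv_mul_cancel]⟩,
      ⟨(β j)⁻¹ * g'.1 (b j), by rw [MonoidHom.mem_ker, map_mul, map_inv, hβ, hq, inv_mul_cancel]⟩)
  have hx : ∀ g', twistedWord α β (x g') = 1 := fun g' => by
    have := map_surfaceWord g'.1 a b
    rw [hP.surfaceWord_eq_one, map_one] at this
    simpa [twistedWord, x] using this.symm
  refine ⟨Equiv.ofBijective (fun g' => ⟨x g', hx g'⟩) ⟨fun g' g'' h => ?_, ?_⟩⟩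
  · have h' : ∀ j, x g' j = x g'' j := fun j => congrFun (congrArg Subtype.val h) j
    refine Subtype.ext (hext (fun j => ?_) fun j => ?_)
    · exact mul_left_cancel (congrArg Subtype.val (congrArg Prod.fst (h' j)))
    · exact mul_left_cancel (congrArg Subtype.val (congrArg Prod.snd (h' j)))
  · rintro ⟨z, hz⟩
    obtain ⟨φ, h1, h2⟩ := hP.exists_hom G' (fun j => α j * (z j).1) (fun j => β j * (z j).2) hz
    refine ⟨⟨φ, hext (fun j => ?_) fun j => ?_⟩, Subtype.ext (funext fun j => Prod.ext ?_ ?_)⟩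
    · rw [MonoidHom.comp_apply, h1, map_mul, hα, MonoidHom.mem_ker.1 (z j).1.2, mul_one]
    · rw [MonoidHom.comp_apply, h2, map_mul, hβ, MonoidHom.mem_ker.1 (z j).2.2, mul_one]
    · exact Subtype.ext (by simp [x, h1])
    · exact Subtype.ext (by simp [x, h2])

/-- A subgroup containing the kernel is determined by its image, and here the image contains the
image of the generators under the surjection `g`. -/
theorem closure_union_ker_eq_top (hP : Subgroup.closure (Set.range a ∪ Set.range b) = ⊤)
    (hα : ∀ j, q (α j) = g (a j)) (hβ : ∀ j, q (β j) = g (b j)) (hg : Function.Surjective g) :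
    Subgroup.closure (Set.range α ∪ Set.range β ∪ q.ker) = ⊤ := by
  set T := Subgroup.closure (Set.range α ∪ Set.range β ∪ (q.ker : Set G')) with hT
  have hker : q.ker ≤ T := fun x hx => Subgroup.subset_closure (.inr hx)
  have h1 : (⊤ : Subgroup P) ≤ (T.map q).comap g := by
    rw [← hP, Subgroup.closure_le]
    rintro _ (⟨j, rfl⟩ | ⟨j, rfl⟩)
    · exact ⟨α j, Subgroup.subset_closure (.inl (.inl ⟨j, rfl⟩)), hα j⟩
    · exact ⟨β j, Subgroup.subset_closure (.inl (.inr ⟨j, rfl⟩)), hβ j⟩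
  rw [← Subgroup.comap_map_eq_self hker, eq_top_iff]
  intro x _
  obtain ⟨p, hp⟩ := hg (q x)
  have := h1 (Subgroup.mem_top p)
  rw [Subgroup.mem_comap, hp] at this
  exact this

end Lifts

end

theorem theorem7p1p2 {G G' : Type u} [Group G] [Group G']
    (q : G' →* G) (hq : Function.Surjective q) [Finite q.ker]
    {W : Type u} [TopologicalSpace W] {d : ℕ} (hW : IsClosedOrientableSurface d W) (w : W)
    (μ : H₂ (FundamentalGroup W w)) (hμ : IsFundamentalClass μ)
    (hb : (⁅q.ker, (⊤ : Subgroup G')⁆ : Subgroup G') ≠ ⊥ →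
      Real.logb 2 ((Nat.card (⁅q.ker, (⊤ : Subgroup G')⁆ : Subgroup G') : ℝ) - 1) < (firstBetti W w : ℝ))
    (g : FundamentalGroup W w →* G) (hg : Function.Surjective g) :
    ((Lifts q g).Nonempty ↔ HomologicalObstructionVanishes q g μ) ∧
    ((Lifts q g).Nonempty → (Lifts q g).Finite ∧
      (Nat.card q.ker : ℝ) ^ firstBetti W w *
          (Nat.card (⁅q.ker, (⊤ : Subgroup G')⁆ : Subgroup G') : ℝ)⁻¹ *
          (1 - ((Nat.card (⁅q.ker, (⊤ : Subgroup G')⁆ : Subgroup G') : ℝ) - 1) / 2 ^ firstBetti W w) ≤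
        ((Lifts q g).ncard : ℝ)) := by
  obtain ⟨a, b, hP⟩ := exists_isSurfacePresentation.{u} hW w
  have hbetti : firstBetti W w = 2 * d := finrank_abelianization hP
  rw [hbetti] at hb ⊢
  set K : Subgroup G' := ⁅q.ker, (⊤ : Subgroup G')⁆ with hK
  let α : Fin d → G' := fun j => Function.surjInv hq (g (a j))
  let β : Fin d → G' := fun j => Function.surjInv hq (g (b j))
  have hα : ∀ j, q (α j) = g (a j) := fun j => Function.surjInv_eq hq _
  have hβ : ∀ j, q (β j) = g (b j) := fun j => Function.surjInv_eq hq _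
  obtain ⟨e⟩ := exists_equiv_lifts hP hα hβ
  have hfin : (Lifts q g).Finite := @Set.toFinite _ _ (Finite.of_equiv _ e.symm)
  -- The bound is derived from the vanishing of the obstruction alone, not from the existence of a
  -- lift, so that its positivity can produce a lift.
  have hbound : HomologicalObstructionVanishes q g μ →
      (Nat.card q.ker : ℝ) ^ (2 * d) * (Nat.card K : ℝ)⁻¹ *
        (1 - ((Nat.card K : ℝ) - 1) / 2 ^ (2 * d)) ≤ ((Lifts q g).ncard : ℝ) := by
    intro hobs
    rw [← Nat.card_coe_set_eq, Nat.card_congr e]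
    exact card_twistedWord_eq_one_ge
      (surfaceWord_mem_of_obstruction q hq g hμ hobs hP.surfaceWord_eq_one)
      (closure_union_ker_eq_top hP.closure_eq_top hα hβ hg)
  have hobs : (Lifts q g).Nonempty → HomologicalObstructionVanishes q g μ :=
    fun ⟨g', hg'⟩ => homologicalObstructionVanishes_of_lift hg' μ
  refine ⟨⟨hobs, fun h => ?_⟩, fun h => ⟨hfin, hbound (hobs h)⟩⟩
  have : Finite K := Finite.Set.subset (q.ker : Set G') (commutator_top_le q.ker)
  have hKpos : (0 : ℝ) < Nat.card K := by exact_mod_cast Nat.card_pos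
  -- This is the logarithmic hypothesis in exponential form; for `K = ⊥` the left side is `0` and
  -- nothing has to be assumed.
  have hlt : (Nat.card K : ℝ) - 1 < 2 ^ (2 * d) := by
    by_cases hbot : K = ⊥
    · rw [hbot, Subgroup.card_bot]
      simp
    · have h1 := hb hbot
      have hone : (1 : ℝ) < Nat.card K := by
        exact_mod_cast (Subgroup.one_lt_card_iff_ne_bot K).2 hbot
      rw [Real.logb_lt_iff_lt_rpow one_lt_two (by linarith), Real.rpow_natCast] at h1
      exact h1
  have hpos : (0 : ℝ) < (Nat.card q.ker : ℝ) ^ (2 * d) * (Nat.card K : ℝ)⁻¹ *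
      (1 - ((Nat.card K : ℝ) - 1) / 2 ^ (2 * d)) := by
    have hN : (0 : ℝ) < Nat.card q.ker := by exact_mod_cast Nat.card_pos
    have : ((Nat.card K : ℝ) - 1) / 2 ^ (2 * d) < 1 := (div_lt_one (by positivity)).2 hlt
    have : 0 < 1 - ((Nat.card K : ℝ) - 1) / 2 ^ (2 * d) := by linarith
    positivity
  have hcard : 0 < (Lifts q g).ncard := by exact_mod_cast hpos.trans_le (hbound h)
  exact (Set.ncard_pos hfin).1 hcard
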